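/- Let $d\in\{2,3\}$ and let $\Omega\subset\mathbb R^d$ be an open, bounded and connected domain with Lipschitz continuous boundary. Let $\mathcal T_h$ be a finite partition of $\Omega$ into polygons ($d=2$) or polyhedra ($d=3$), not necessarily convex, with set $\mathcal E_h$ of edges or flat faces; $h_T$ is the diameter of $T\in\mathcal T_h$ and $\mathbf n$ denotes outward unit normals (to $\partial\Omega$, or to $\partial T$ in integrals over $\partial T$). Let the convection vector $\boldsymbol\beta$ and the reaction coefficient $c$ be piecewise constant with respect to $\mathcal T_h$. Put $\Gamma_-=\{x\in\partial\Omega:\boldsymbol\beta(x)\cdot\mathbf n<0\}$ and $\Gamma_+=\partial\Omega\setminus\Gamma_-$, the value of $\boldsymbol\beta$ on a boundary face being that in the adjacent element. Write $(\cdot,\cdot)_D$ and $\langle\cdot,\cdot\rangle_S$ for the $L^2$ inner products over $D\subset\Omega$ (with $D=\Omega$ if omitted) and over a surface $S$, and let $f\in L^2(\Omega)$, $g\in L^2(\Gamma_-)$. Consider the transport problem $\nabla\cdot(\boldsymbol\beta u)+cu=f$ in $\Omega$, $u=g$ on $\Gamma_-$, where a solution is a function $u\in L^2(\Omega)$ with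 $$(u,\boldsymbol\beta\cdot\nabla\sigma-c\sigma)=\langle g,\boldsymbol\beta\cdot\mathbf n\,\sigma\rangle_{\Gamma_-}-(f,\sigma)\qquad\text{for all }\sigma\in H^1(\Omega)\text{ with }\sigma=0\text{ on }\Gamma_+,$$ and its adjoint problem $\boldsymbol\beta\cdot\nabla\Psi-c\Psi=\theta$ a.e. in $\Omega$, $\Psi=0$ on $\Gamma_+$, with $\theta\in L^2(\Omega)$ and $\Psi\in H^1(\Omega)$; boundary values are understood in the sense of traces. For integers $k\ge1$ and $j\ge 0$ let $M_{k-1,h}$ be the space of functions whose restriction to each $T\in\mathcal T_h$ is a polynomial of degree at most $k-1$, and let $W_{j,h}^{0,\Gamma_+}$ be the space of pairs $\sigma=\{\sigma_0,\sigma_b\}$, where $\sigma_0|_T\in P_j(T)$ for each $T\in\mathcal T_h$, $\sigma_b|_e\in P_j(e)$ (single valued) for each $e\in\mathcal E_h$, and $\sigma_b|_e=0$ for each $e\subset\Gamma_+$. The discrete weak gradient $\nabla_w\sigma|_T\in[P_{k-1}(T)]^d$ is defined by $$(\nabla_w\sigma,\boldsymbol\psi)_T=-(\sigma_0,\nabla\cdot\boldsymbol\psi)_T+\langle\sigma_b,\boldsymbol\psi\cdot\mathbf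 n\rangle_{\partial T}\qquad\text{for all }\boldsymbol\psi\in[P_{k-1}(T)]^d .$$ With a parameter $\tau$ let $$s(\rho,\sigma)=\sum_{T\in\mathcal T_h}\Big(h_T^{-1}\langle\rho_0-\rho_b,\sigma_0-\sigma_b\rangle_{\partial T}+\tau(\boldsymbol\beta\cdot\nabla\rho_0-c\rho_0,\boldsymbol\beta\cdot\nabla\sigma_0-c\sigma_0)_T\Big),\qquad b(v,\sigma)=\sum_{T\in\mathcal T_h}(v,\boldsymbol\beta\cdot\nabla_w\sigma-c\sigma_0)_T .$$ **Theorem.** Assume that, for all data $f\in L^2(\Omega)$, $g\in L^2(\Gamma_-)$ and $\theta\in L^2(\Omega)$, the transport problem and its adjoint problem each have at most one solution. If $\tau>0$ and $j=k-1$ or $j=k$, then there is exactly one pair $(u_h;\lambda_h)\in M_{k-1,h}\times W_{j,h}^{0,\Gamma_+}$ such that $$s(\lambda_h,\sigma)+b(u_h,\sigma)=\sum_{e\subset\Gamma_-}\langle\sigma_b,\boldsymbol\beta\cdot\mathbf n\,g\rangle_e-(f,\sigma_0)\qquad\text{for all }\sigma\in W_{j,h}^{0,\Gamma_+},$$ $$b(v,\lambda_h)=0\qquad\text{for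 all }v\in M_{k-1,h}.$$ -/

import Mathlib

open MeasureTheory Filter Topology
open scoped ContDiff

noncomputable section

namespace PDWG

/-- The Euclidean space `ℝ^d`. -/
abbrev Eucl (d : ℕ) := EuclideanSpace ℝ (Fin d)

/-- Surface measure: the `(d-1)`-dimensional Hausdorff measure of `ℝ^d`, normalized so that it is
Lebesgue measure on every hyperplane. -/
def surface (d : ℕ) : Measure (Eucl d) := Measure.euclideanHausdorffMeasure (d - 1)

/-! ### Domains, Sobolev functions and traces -/

/-- The boundary of `Ω` is Lipschitz continuous: near each boundary point `Ω` is the set of points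
above the graph of a Lipschitz function `γ` of the variables orthogonal to some unit vector `ν`. -/
def HasLipschitzBoundary {d : ℕ} (Ω : Set (Eucl d)) : Prop :=
  ∀ x ∈ frontier Ω, ∃ (ν : Eucl d) (γ : Eucl d → ℝ) (K : NNReal) (U : Set (Eucl d)),
    ‖ν‖ = 1 ∧ LipschitzWith K γ ∧ (∀ (y : Eucl d) (t : ℝ), γ (y + t • ν) = γ y) ∧ IsOpen U ∧ x ∈ U ∧
      ∀ y ∈ U, (y ∈ Ω ↔ γ y < inner ℝ ν y)

/-- `G` is the weak (distributional) gradient of `σ` in `Ω`. -/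
def HasWeakGradient {d : ℕ} (Ω : Set (Eucl d)) (σ : Eucl d → ℝ) (G : Eucl d → Eucl d) : Prop :=
  ∀ φ : Eucl d → ℝ, ContDiff ℝ ∞ φ → HasCompactSupport φ → tsupport φ ⊆ Ω → ∀ m : Fin d,
    ∫ x in Ω, σ x * gradient φ x m = - ∫ x in Ω, G x m * φ x

/-- `σ ∈ H¹(Ω)` with weak gradient `G ∈ L²(Ω)^d` and boundary trace `w ∈ L²(∂Ω)`. The trace operator
is the continuous extension to `H¹(Ω)` of the restriction to `∂Ω` of Lipschitz functions. -/
structure IsH1WithTrace {d : ℕ} (Ω : Set (Eucl d)) (σ : Eucl d → ℝ) (G : Eucl d → Eucl d)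
    (w : Eucl d → ℝ) : Prop where
  memLp_fun : MemLp σ 2 (volume.restrict Ω)
  memLp_grad : MemLp G 2 (volume.restrict Ω)
  weak_gradient : HasWeakGradient Ω σ G
  memLp_trace : MemLp w 2 ((surface d).restrict (frontier Ω))
  trace : ∃ φ : ℕ → Eucl d → ℝ, (∀ n, ∃ K, LipschitzWith K (φ n)) ∧
    Tendsto (fun n => eLpNorm (fun x => φ n x - σ x) 2 (volume.restrict Ω)) atTop (𝓝 0) ∧
    Tendsto (fun n => eLpNorm (fun x => gradient (φ n) x - G x) 2 (volume.restrict Ω))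
      atTop (𝓝 0) ∧
    Tendsto (fun n => eLpNorm (fun x => φ n x - w x) 2 ((surface d).restrict (frontier Ω)))
      atTop (𝓝 0)

/-! ### The transport problem and its adjoint

In the following definitions `bn` stands for the function `β · n` on `∂Ω`. -/

/-- The inflow boundary `Γ₋ = {x ∈ ∂Ω : β(x) · n < 0}`. -/
def inflow {d : ℕ} (Ω : Set (Eucl d)) (bn : Eucl d → ℝ) : Set (Eucl d) :=
  {x | x ∈ frontier Ω ∧ bn x < 0}

/-- The outflow boundary `Γ₊ = ∂Ω \ Γ₋`. -/
def outflow {d : ℕ} (Ω : Set (Eucl d)) (bn : Eucl d → ℝ) : Set (Eucl d) :=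
  frontier Ω \ inflow Ω bn

/-- `u ∈ L²(Ω)` is a weak solution of `∇·(βu) + cu = f` in `Ω`, `u = g` on `Γ₋`:
`(u, β·∇σ - cσ) = ⟨g, (β·n) σ⟩_{Γ₋} - (f, σ)` for all `σ ∈ H¹(Ω)` that vanish on `Γ₊`. -/
structure IsWeakSolution {d : ℕ} (Ω : Set (Eucl d)) (β : Eucl d → Eucl d) (c bn : Eucl d → ℝ)
    (f g : Eucl d → ℝ) (u : Eucl d → ℝ) : Prop where
  memLp : MemLp u 2 (volume.restrict Ω)
  weak_form : ∀ σ G w, IsH1WithTrace Ω σ G w →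
    (∀ᵐ x ∂(surface d).restrict (outflow Ω bn), w x = 0) →
    ∫ x in Ω, u x * (inner ℝ (β x) (G x) - c x * σ x) =
      (∫ x in inflow Ω bn, g x * (bn x * w x) ∂(surface d)) - ∫ x in Ω, f x * σ x

/-- `Ψ ∈ H¹(Ω)` solves `β·∇Ψ - cΨ = θ` almost everywhere in `Ω`, `Ψ = 0` on `Γ₊`. -/
def IsAdjointSolution {d : ℕ} (Ω : Set (Eucl d)) (β : Eucl d → Eucl d) (c bn : Eucl d → ℝ)
    (θ : Eucl d → ℝ) (Ψ : Eucl d → ℝ) : Prop :=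
  ∃ G w, IsH1WithTrace Ω Ψ G w ∧ (∀ᵐ x ∂(surface d).restrict (outflow Ω bn), w x = 0) ∧
    ∀ᵐ x ∂volume.restrict Ω, inner ℝ (β x) (G x) - c x * Ψ x = θ x

/-- Uniqueness for the transport problem: at most one weak solution for all data. -/
def TransportUniqueness {d : ℕ} (Ω : Set (Eucl d)) (β : Eucl d → Eucl d)
    (c bn : Eucl d → ℝ) : Prop :=
  ∀ f g : Eucl d → ℝ, MemLp f 2 (volume.restrict Ω) →
    MemLp g 2 ((surface d).restrict (inflow Ω bn)) →
    ∀ u₁ u₂, IsWeakSolution Ω β c bn f g u₁ → IsWeakSolution Ω β c bn f g u₂ →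
      u₁ =ᵐ[volume.restrict Ω] u₂

/-- Uniqueness for the adjoint problem: at most one solution in `H¹(Ω)` for all data. -/
def AdjointUniqueness {d : ℕ} (Ω : Set (Eucl d)) (β : Eucl d → Eucl d)
    (c bn : Eucl d → ℝ) : Prop :=
  ∀ θ : Eucl d → ℝ, MemLp θ 2 (volume.restrict Ω) →
    ∀ Ψ₁ Ψ₂, IsAdjointSolution Ω β c bn θ Ψ₁ → IsAdjointSolution Ω β c bn θ Ψ₂ →
      Ψ₁ =ᵐ[volume.restrict Ω] Ψ₂

/-! ### Polytopal partitions -/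

/-- `e` is an (open) flat face: a connected, relatively open subset of a hyperplane whose relative
boundary lies in finitely many affine subspaces of codimension two. For `d = 2` and bounded `e`
these are the open segments, for `d = 3` they include the relatively open polygons. -/
structure IsFlatFace {d : ℕ} (e : Set (Eucl d)) : Prop where
  connected : IsConnected e
  hyperplane : ∃ H : AffineSubspace ℝ (Eucl d), Module.finrank ℝ H.direction + 1 = d ∧
    ∃ U : Set (Eucl d), IsOpen U ∧ e = U ∩ (H : Set (Eucl d))
  boundary : ∃ A : Finset (AffineSubspace ℝ (Eucl d)),
    (∀ L ∈ A, Module.finrank ℝ L.direction + 2 = d) ∧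
      closure e \ e ⊆ ⋃ L ∈ A, (L : Set (Eucl d))

/-- `n` is the unit normal to the flat face `e` of `T` pointing out of `T`. -/
structure IsOutwardNormal {d : ℕ} (T e : Set (Eucl d)) (n : Eucl d) : Prop where
  unit : ‖n‖ = 1
  orthogonal : ∀ x ∈ e, ∀ y ∈ e, inner ℝ n (y - x) = 0
  outward : ∀ x ∈ e, ∀ᶠ t in 𝓝[>] (0 : ℝ), x - t • n ∈ T ∧ x + t • n ∉ closure T

/-- A finite partition of `Ω` into (open) polytopal elements `cell i`, together with the set of all
its (open) edges or flat faces `face e`. An element has `face e` as one of its faces if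
`face e ⊆ ∂(cell i)`; elements need not be convex, and adjacent coplanar faces (hanging nodes) are
allowed. -/
structure PolytopalMesh (d : ℕ) (Ω : Set (Eucl d)) (ι κ : Type*) where
  cell : ι → Set (Eucl d)
  face : κ → Set (Eucl d)
  isOpen_cell : ∀ i, IsOpen (cell i)
  isConnected_cell : ∀ i, IsConnected (cell i)
  cell_subset : ∀ i, cell i ⊆ Ω
  cell_disjoint : ∀ i i', i ≠ i' → Disjoint (cell i) (cell i')
  closure_eq : closure Ω = ⋃ i, closure (cell i)
  isFlatFace : ∀ e, IsFlatFace (face e)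
  face_disjoint : ∀ e e', e ≠ e' → Disjoint (face e) (closure (face e'))
  face_incident : ∀ e, ∃ i, face e ⊆ frontier (cell i)
  frontier_cell : ∀ i, frontier (cell i) = ⋃ e ∈ {e | face e ⊆ frontier (cell i)}, closure (face e)
  exists_normal : ∀ i e, face e ⊆ frontier (cell i) → ∃ n, IsOutwardNormal (cell i) (face e) n

/-! ### Polynomials -/

/-- The space `P_r` of polynomials of total degree at most `r` in `d` variables. -/
abbrev Poly (d r : ℕ) : Submodule ℝ (MvPolynomial (Fin d) ℝ) :=
  MvPolynomial.restrictTotalDegree (Fin d) ℝ r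

/-- The value of a polynomial at a point of `ℝ^d`. -/
def pval {d : ℕ} (p : MvPolynomial (Fin d) ℝ) (x : Eucl d) : ℝ :=
  MvPolynomial.eval (fun m => x m) p

/-- The value of a vector of polynomials at a point of `ℝ^d`. -/
def pvec {d : ℕ} (q : Fin d → MvPolynomial (Fin d) ℝ) (x : Eucl d) : Eucl d :=
  WithLp.toLp 2 fun m => pval (q m) x

/-- The gradient of a polynomial. -/
def pgrad {d : ℕ} (p : MvPolynomial (Fin d) ℝ) : Fin d → MvPolynomial (Fin d) ℝ :=
  fun m => MvPolynomial.pderiv m p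

/-- The divergence of a vector of polynomials. -/
def pdiv {d : ℕ} (q : Fin d → MvPolynomial (Fin d) ℝ) : MvPolynomial (Fin d) ℝ :=
  ∑ m, MvPolynomial.pderiv m (q m)

/-- `P_r(e)`: the functions on `e` that are restrictions of polynomials of degree at most `r`. A
function on `e` is represented by its extension by zero. -/
def IsPolyOn {d : ℕ} (e : Set (Eucl d)) (r : ℕ) (w : Eucl d → ℝ) : Prop :=
  ∃ p ∈ Poly d r, w = e.indicator (pval p)

/-- Piecewise polynomials: one polynomial per element. As elements are nonempty and open, this is
the same as one polynomial function per element. -/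
abbrev CellPoly (d : ℕ) (ι : Type*) := ι → MvPolynomial (Fin d) ℝ

/-- Discrete weak functions `{σ₀, σ_b}`: a polynomial on each element, and a single function (common
to the adjacent elements) on each face. -/
abbrev WeakFun (d : ℕ) (ι κ : Type*) := CellPoly d ι × (κ → Eucl d → ℝ)

namespace PolytopalMesh

variable {d : ℕ} {Ω : Set (Eucl d)} {ι κ : Type*} [Fintype ι] [Fintype κ]
  (M : PolytopalMesh d Ω ι κ)

open Classical in
/-- The faces of the element `cell i`. -/
def faces (i : ι) : Finset κ := {e | M.face e ⊆ frontier (M.cell i)}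

open Classical in
/-- The outward unit normal to `cell i` on its face `face e`. -/
def normal (i : ι) (e : κ) : Eucl d :=
  if h : ∃ n, IsOutwardNormal (M.cell i) (M.face e) n then h.choose else 0

/-- The mesh size `h_T` of an element. -/
def meshSize (i : ι) : ℝ := Metric.diam (M.cell i)

/-- The piecewise constant function with the value `a i` on `cell i`. -/
def piecewiseConst {V : Type*} [AddCommMonoid V] (a : ι → V) (x : Eucl d) : V :=
  ∑ i, (M.cell i).indicator (fun _ => a i) x

open Classical in
/-- The function `β · n` on `∂Ω`, `β` being piecewise constant: on a face contained in `∂Ω`, `β` has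
its value in the adjacent element, whose outward normal is that of `Ω`. -/
def normalFlux (β : ι → Eucl d) (x : Eucl d) : ℝ :=
  ∑ i, ∑ e ∈ M.faces i,
    if M.face e ⊆ frontier Ω then (M.face e).indicator (fun _ => inner ℝ (β i) (M.normal i e)) x
    else 0

/-- The inflow boundary `Γ₋` of the piecewise constant field `β`. -/
def inflow (β : ι → Eucl d) : Set (Eucl d) := PDWG.inflow Ω (M.normalFlux β)

/-- The outflow boundary `Γ₊` of the piecewise constant field `β`. -/
def outflow (β : ι → Eucl d) : Set (Eucl d) := PDWG.outflow Ω (M.normalFlux β)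

/-- The defining property of the discrete weak gradient of degree `r` of `σ` on `cell i`. -/
structure IsDiscreteWeakGrad (r : ℕ) (i : ι) (σ : WeakFun d ι κ)
    (q : Fin d → MvPolynomial (Fin d) ℝ) : Prop where
  mem : ∀ m, q m ∈ Poly d r
  eq : ∀ ψ : Fin d → MvPolynomial (Fin d) ℝ, (∀ m, ψ m ∈ Poly d r) →
    ∫ x in M.cell i, inner ℝ (pvec q x) (pvec ψ x) =
      - (∫ x in M.cell i, pval (σ.1 i) x * pval (pdiv ψ) x) +
        ∑ e ∈ M.faces i, ∫ x in M.face e,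
          σ.2 e x * inner ℝ (pvec ψ x) (M.normal i e) ∂(surface d)

open Classical in
/-- The discrete weak gradient `∇_{w,r,T} σ` on the element `T = cell i`. -/
def weakGrad (r : ℕ) (i : ι) (σ : WeakFun d ι κ) : Fin d → MvPolynomial (Fin d) ℝ :=
  if h : ∃ q, M.IsDiscreteWeakGrad r i σ q then h.choose else 0

/-- Membership in the space of piecewise polynomials of degree at most `r`. -/
def IsTrial (_M : PolytopalMesh d Ω ι κ) (r : ℕ) (v : CellPoly d ι) : Prop :=
  ∀ i, v i ∈ Poly d r

/-- Membership in the weak finite element space `W_{j,h}^{0,Γ₊}`. -/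
structure IsTest (β : ι → Eucl d) (j : ℕ) (σ : WeakFun d ι κ) : Prop where
  interior : ∀ i, σ.1 i ∈ Poly d j
  bdry : ∀ e, IsPolyOn (M.face e) j (σ.2 e)
  outflow : ∀ e, M.face e ⊆ M.outflow β → σ.2 e = 0

/-- The function `β·∇σ₀ - cσ₀` on `cell i`. -/
def adjointOp (β : ι → Eucl d) (c : ι → ℝ) (σ : WeakFun d ι κ) (i : ι) (x : Eucl d) : ℝ :=
  inner ℝ (β i) (pvec (pgrad (σ.1 i)) x) - c i * pval (σ.1 i) x

/-- The stabilizer `s(ρ, σ)` with parameter `τ`. -/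
def stabilizer (β : ι → Eucl d) (c : ι → ℝ) (τ : ℝ) (ρ σ : WeakFun d ι κ) : ℝ :=
  ∑ i, ((M.meshSize i)⁻¹ * (∑ e ∈ M.faces i, ∫ x in M.face e,
        (pval (ρ.1 i) x - ρ.2 e x) * (pval (σ.1 i) x - σ.2 e x) ∂(surface d)) +
      τ * ∫ x in M.cell i, adjointOp β c ρ i x * adjointOp β c σ i x)

/-- The bilinear form `b(v, σ) = ∑_T (v, β·∇_w σ - cσ₀)_T` with `∇_w` of degree `k - 1`. -/
def bForm (k : ℕ) (β : ι → Eucl d) (c : ι → ℝ) (v : CellPoly d ι) (σ : WeakFun d ι κ) : ℝ :=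
  ∑ i, ∫ x in M.cell i, pval (v i) x *
    (inner ℝ (β i) (pvec (M.weakGrad (k - 1) i σ) x) - c i * pval (σ.1 i) x)

open Classical in
/-- The right-hand side `∑_{e ⊂ Γ₋} ⟨σ_b, β·n g⟩_e - (f, σ₀)`. -/
def load (β : ι → Eucl d) (f g : Eucl d → ℝ) (σ : WeakFun d ι κ) : ℝ :=
  (∑ e with M.face e ⊆ M.inflow β,
      ∫ x in M.face e, σ.2 e x * (M.normalFlux β x * g x) ∂(surface d)) -
    ∑ i, ∫ x in M.cell i, f x * pval (σ.1 i) x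

/-- `(u; l)` is a solution of the primal-dual weak Galerkin scheme, with `u` in the space of
piecewise polynomials of degree at most `k - 1` and `l` in `W_{j,h}^{0,Γ₊}`. -/
structure IsSchemeSolution (k j : ℕ) (τ : ℝ) (β : ι → Eucl d) (c : ι → ℝ) (f g : Eucl d → ℝ)
    (u : CellPoly d ι) (l : WeakFun d ι κ) : Prop where
  trial : M.IsTrial (k - 1) u
  test : M.IsTest β j l
  primal : ∀ σ, M.IsTest β j σ → M.stabilizer β c τ l σ + M.bForm k β c u σ = M.load β f g σ
  dual : ∀ v, M.IsTrial (k - 1) v → M.bForm k β c v l = 0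

end PolytopalMesh

end PDWG

end

/-! The scheme is a linear system whose unknowns and test functions range over the same
finite-dimensional space, `discreteSpace`. By `existsUnique_isSchemeSolution` it is enough that the
homogeneous system has only the zero solution. Testing the homogeneous system with σ = λ removes b,
because b(u, λ) = 0, and leaves s(λ, λ) = 0.

Dual variable (`dual_eq_zero_of_stabilizer_eq_zero`). Since τ and all h_T are positive, λ₀ = λ_b on
every face and β·∇λ₀ - cλ₀ = 0 in every element. Hence the polynomials λ₀ match across faces and are
the restrictions of one Lipschitz function (`IsCompatible.exists_lipschitzWith`). It vanishes on Γ₊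
and solves the homogeneous adjoint problem, so uniqueness for that problem gives λ = 0.

Primal variable (`primal_eq_zero`). Now b(u, σ) = 0 for all σ. Unfolding the weak gradient
(`bForm_eq`) turns b(u, σ) into σ₀ paired with -(β·∇u + cu) in the elements plus σ_b paired with the
sum of the outward fluxes of βu on the faces. Because β and c are piecewise constant and j ≥ k - 1,
these residuals are themselves admissible test data, apart from the fluxes on Γ₊, so they vanish
(`primal_homogeneous`). Integration by parts on each element then shows that u is a weak solution
with zero data (`isWeakSolution_glue`), and uniqueness for the transport problem gives u = 0.

The analytic core is the divergence theorem for Lipschitz functions on a possibly nonconvex polytope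
(`divergenceFormula`). In a half-space it follows by differentiating an integral in the translation
parameter. A partition of unity transfers it to functions supported away from the codimension-two
`skeleton`. The skeleton is removed by a cutoff, whose gradient is of size 1/ε on a tube of volume
O(ε²). Gluing uses that a generic segment avoids the skeleton, and that a Lipschitz boundary
upgrades a Lipschitz bound along segments in Ω to one on all of Ω. -/

noncomputable section

namespace PDWG

/-! ### Hyperplanes -/

/-- The inclusion of `ℝ^m` into `ℝ^(m+1)` as the hyperplane of vectors with first coordinate `0`. -/
def zeroConsIsometry (m : ℕ) : Eucl m →ₗᵢ[ℝ] Eucl (m + 1) where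
  toFun y := WithLp.toLp 2 (Fin.cons 0 (fun i => y i))
  map_add' x y := by
    ext i
    refine Fin.cases ?_ (fun i => ?_) i <;> simp
  map_smul' a y := by
    ext i
    refine Fin.cases ?_ (fun i => ?_) i <;> simp
  norm_map' y := by
    simp [EuclideanSpace.norm_eq, Fin.sum_univ_succ]

/-- Complete `n` to an orthonormal basis that starts with it; in the coordinates of this basis
Lebesgue measure is a product. This provides Fubini along the normal of a face. -/
theorem exists_slicing {m : ℕ} {n : Eucl (m + 1)} (hn : ‖n‖ = 1) :
    ∃ Φ : Eucl m →ₗᵢ[ℝ] Eucl (m + 1), (∀ y, inner ℝ n (Φ y) = 0) ∧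
      (∀ x, inner ℝ n x = 0 → x ∈ Set.range Φ) ∧
      MeasurePreserving (fun p : ℝ × Eucl m => p.1 • n + Φ p.2) (volume.prod volume) volume := by
  have horth : Orthonormal ℝ (({0} : Set (Fin (m + 1))).domRestrict fun _ => n) :=
    ⟨fun _ => hn, fun i j hij => (hij (Subsingleton.elim i j)).elim⟩
  obtain ⟨b, hb⟩ := horth.exists_orthonormalBasis_extension_of_card_eq (by simp)
  have hb0 : b 0 = n := hb 0 rfl
  have hinner : ∀ x, inner ℝ n x = b.repr x 0 := fun x => by rw [b.repr_apply_apply, hb0]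
  refine ⟨b.repr.symm.toLinearIsometry.comp (zeroConsIsometry m), fun y => ?_, fun x hx => ?_, ?_⟩
  · rw [hinner]
    simp [zeroConsIsometry]
  · rw [hinner] at hx
    refine ⟨WithLp.toLp 2 fun i => b.repr x i.succ, ?_⟩
    apply b.repr.injective
    ext i
    refine Fin.cases ?_ (fun i => ?_) i <;> simp [zeroConsIsometry, hx]
  · have h1 := b.measurePreserving_repr_symm
    have h2 := (EuclideanSpace.volume_preserving_symm_measurableEquiv_toLp (Fin (m + 1))).symm
    have h3 := (volume_preserving_piFinSuccAbove (fun _ : Fin (m + 1) => ℝ) 0).symm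
    have h4 := (MeasurePreserving.id (volume : Measure ℝ)).prod
      (EuclideanSpace.volume_preserving_symm_measurableEquiv_toLp (Fin m))
    have h := h1.comp (h2.comp (h3.comp h4))
    convert h using 1
    funext p
    apply b.repr.injective
    ext i
    refine Fin.cases ?_ (fun i => ?_) i
    · simp [zeroConsIsometry, ← hb0, MeasurableEquiv.piFinSuccAbove]
    · simp [zeroConsIsometry, ← hb0, MeasurableEquiv.piFinSuccAbove]

theorem isometry_hyperplane {m : ℕ} (Φ : Eucl m →ₗᵢ[ℝ] Eucl (m + 1)) (z : Eucl (m + 1)) :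
    Isometry fun y => z + Φ y :=
  (IsometryEquiv.addLeft z).isometry.comp Φ.isometry

theorem range_hyperplane {m : ℕ} {n : Eucl (m + 1)} (hn : ‖n‖ = 1) {Φ : Eucl m →ₗᵢ[ℝ] Eucl (m + 1)}
    (h0 : ∀ y, inner ℝ n (Φ y) = 0) (h1 : ∀ x, inner ℝ n x = 0 → x ∈ Set.range Φ) (a : ℝ) :
    Set.range (fun y => a • n + Φ y) = {x | inner ℝ n x = a} := by
  ext x
  constructor
  · rintro ⟨y, rfl⟩
    simp [inner_add_right, inner_smul_right, h0, hn]
  · intro hx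
    obtain ⟨y, hy⟩ := h1 (x - a • n) (by
      simp only [Set.mem_ofPred_eq] at hx
      simp [inner_sub_right, inner_smul_right, hn, hx])
    exact ⟨y, by simp [hy]⟩

/-- Hausdorff measure is intrinsic, so an isometric parametrization of the plane transports Lebesgue
measure of `ℝ^m` to it. -/
theorem surface_restrict_hyperplane {m : ℕ} {n : Eucl (m + 1)} (hn : ‖n‖ = 1)
    {Φ : Eucl m →ₗᵢ[ℝ] Eucl (m + 1)}
    (h0 : ∀ y, inner ℝ n (Φ y) = 0) (h1 : ∀ x, inner ℝ n x = 0 → x ∈ Set.range Φ) (a : ℝ) :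
    (surface (m + 1)).restrict {x | inner ℝ n x = a} = volume.map (fun y => a • n + Φ y) := by
  rw [← range_hyperplane hn h0 h1, ← EuclideanSpace.euclideanHausdorffMeasure_eq_volume,
    (isometry_hyperplane Φ (a • n)).map_euclideanHausdorffMeasure]
  rfl

theorem integral_hyperplane {m : ℕ} {n : Eucl (m + 1)} (hn : ‖n‖ = 1)
    {Φ : Eucl m →ₗᵢ[ℝ] Eucl (m + 1)}
    (h0 : ∀ y, inner ℝ n (Φ y) = 0) (h1 : ∀ x, inner ℝ n x = 0 → x ∈ Set.range Φ) (a : ℝ)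
    (F : Eucl (m + 1) → ℝ) :
    ∫ x in {x | inner ℝ n x = a}, F x ∂surface (m + 1) = ∫ y, F (a • n + Φ y) := by
  rw [surface_restrict_hyperplane hn h0 h1,
    (isometry_hyperplane Φ (a • n)).isClosedEmbedding.measurableEmbedding.integral_map]

theorem isClosed_hyperplane {d : ℕ} (n : Eucl d) (a : ℝ) :
    IsClosed {x : Eucl d | inner ℝ n x = a} :=
  isClosed_eq (by fun_prop) continuous_const

theorem measurableSet_hyperplane {d : ℕ} (n : Eucl d) (a : ℝ) :
    MeasurableSet {x : Eucl d | inner ℝ n x = a} :=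
  (isClosed_hyperplane n a).measurableSet

theorem surface_hyperplane_inter_lt_top {d : ℕ} (hd : 0 < d) {n : Eucl d} (hn : ‖n‖ = 1) (a : ℝ)
    {s : Set (Eucl d)} (hs : Bornology.IsBounded s) :
    surface d (s ∩ {x | inner ℝ n x = a}) < ⊤ := by
  obtain ⟨m, rfl⟩ : ∃ m, d = m + 1 := ⟨d - 1, by omega⟩
  obtain ⟨Φ, h0, h1, -⟩ := exists_slicing hn
  refine (Measure.le_restrict_apply _ _).trans_lt ?_
  rw [surface_restrict_hyperplane hn h0 h1,
    (isometry_hyperplane Φ (a • n)).isClosedEmbedding.measurableEmbedding.map_apply]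
  obtain ⟨R, hR⟩ := hs.subset_closedBall 0
  have : ((fun y => a • n + Φ y) ⁻¹' s) ⊆ Metric.closedBall 0 (R + |a|) := by
    intro y hy
    have h2 := hR hy
    simp only [mem_closedBall_zero_iff] at h2 ⊢
    have h3 : ‖Φ y‖ ≤ ‖a • n + Φ y‖ + ‖a • n‖ := by
      simpa using norm_sub_le (a • n + Φ y) (a • n)
    rw [Φ.norm_map, norm_smul, hn, mul_one, Real.norm_eq_abs] at h3
    linarith
  exact (measure_mono this).trans_lt measure_closedBall_lt_top

/-- A nonempty relatively open subset of a hyperplane has positive surface measure. -/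
theorem surface_inter_hyperplane_pos {d : ℕ} (hd : 0 < d) {n : Eucl d} (hn : ‖n‖ = 1) {a : ℝ}
    {U : Set (Eucl d)} (hU : IsOpen U) {x : Eucl d} (hx : x ∈ U) (hxa : inner ℝ n x = a) :
    0 < surface d (U ∩ {x | inner ℝ n x = a}) := by
  obtain ⟨m, rfl⟩ : ∃ m, d = m + 1 := ⟨d - 1, by omega⟩
  obtain ⟨Φ, h0, h1, -⟩ := exists_slicing hn
  have hiso := isometry_hyperplane Φ (a • n)
  rw [← Measure.restrict_apply hU.measurableSet, surface_restrict_hyperplane hn h0 h1,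
    hiso.isClosedEmbedding.measurableEmbedding.map_apply]
  have hx' : x ∈ Set.range (fun y => a • n + Φ y) := by rw [range_hyperplane hn h0 h1]; exact hxa
  obtain ⟨y, rfl⟩ := hx'
  exact (hU.preimage hiso.continuous).measure_pos volume ⟨y, hx⟩

/-! ### The divergence theorem in a half-space -/

theorem lineDeriv_eq_zero_of_notMem_tsupport {d : ℕ} {F : Eucl d → ℝ} {x : Eucl d}
    (hx : x ∉ tsupport F) (v : Eucl d) : lineDeriv ℝ F x v = 0 := by
  have : F =ᶠ[𝓝 x] fun _ => 0 := by
    filter_upwards [(isClosed_tsupport F).isOpen_compl.mem_nhds hx] with y hy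
    exact image_eq_zero_of_notMem_tsupport hy
  rw [this.lineDeriv_eq]
  simp [lineDeriv]

theorem hasCompactSupport_lineDeriv {d : ℕ} {F : Eucl d → ℝ} (hc : HasCompactSupport F)
    (v : Eucl d) : HasCompactSupport fun x => lineDeriv ℝ F x v := by
  refine hc.mono' fun x hx => ?_
  by_contra hx'
  exact hx (lineDeriv_eq_zero_of_notMem_tsupport hx' v)

theorem integrable_lineDeriv {d : ℕ} {F : Eucl d → ℝ} {C : NNReal} (hF : LipschitzWith C F)
    (hc : HasCompactSupport F) (v : Eucl d) : Integrable (fun x => lineDeriv ℝ F x v) := by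
  have h := hF.locallyIntegrable_lineDeriv (μ := volume) v
  have hi := h.integrableOn_isCompact (hasCompactSupport_lineDeriv hc v)
  rwa [integrableOn_iff_integrable_of_support_subset (subset_tsupport _)] at hi

theorem integral_lineDeriv_eq_zero {d : ℕ} {F : Eucl d → ℝ} {C : NNReal} (hF : LipschitzWith C F)
    (hc : HasCompactSupport F) (v : Eucl d) : ∫ x, lineDeriv ℝ F x v = 0 := by
  -- Integration by parts against the constant 1; the direction `-v` cancels the sign in the
  -- formula.
  have h := LipschitzWith.integral_lineDeriv_mul_eq (μ := (volume : Measure (Eucl d)))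
    (LipschitzWith.const' (K := 0) (1 : ℝ)) hF hc (-v)
  have h0 : ∀ x w : Eucl d, lineDeriv ℝ (fun _ => (1 : ℝ)) x w = 0 := by simp [lineDeriv]
  simpa [h0] using h.symm

/-- By slicing, the half-space integral is the integral over `s < b` of the plane integrals `I s`.
These depend continuously on `s`, so the fundamental theorem of calculus applies. -/
theorem hasDerivAt_integral_halfspace {m : ℕ} {n : Eucl (m + 1)} (hn : ‖n‖ = 1)
    {F : Eucl (m + 1) → ℝ} (hF : Continuous F) (hc : HasCompactSupport F) (a : ℝ) :
    HasDerivAt (fun b => ∫ x in {x | inner ℝ n x < b}, F x)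
      (∫ x in {x | inner ℝ n x = a}, F x ∂surface (m + 1)) a := by
  obtain ⟨Φ, h0, h1, hΦ⟩ := exists_slicing hn
  have hΨc : Continuous (fun p : ℝ × Eucl m => p.1 • n + Φ p.2) := by
    have := Φ.continuous
    fun_prop
  have hin : ∀ p : ℝ × Eucl m, inner ℝ n (p.1 • n + Φ p.2) = p.1 := fun p => by
    simp [inner_add_right, inner_smul_right, h0, hn]
  have hΨi : Function.Injective (fun p : ℝ × Eucl m => p.1 • n + Φ p.2) := by
    intro p q hpq
    have h2 : p.1 = q.1 := by rw [← hin p, ← hin q]; exact congrArg _ hpq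
    refine Prod.ext h2 (Φ.injective ?_)
    simpa [h2] using hpq
  have hemb := hΨc.measurableEmbedding hΨi
  have hFi : Integrable F := hF.integrable_of_hasCompactSupport hc
  have hFΨ : Integrable (fun p : ℝ × Eucl m => F (p.1 • n + Φ p.2)) (volume.prod volume) :=
    (hΦ.integrable_comp_emb hemb).2 hFi
  set I : ℝ → ℝ := fun s => ∫ y, F (s • n + Φ y) with hI
  have hIint : Integrable I := hFΨ.integral_prod_left
  have hJ : ∀ b, ∫ x in {x | inner ℝ n x < b}, F x = ∫ s in Set.Iio b, I s := by
    intro b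
    have h2 := hΦ.setIntegral_preimage_emb hemb F {x | inner ℝ n x < b}
    rw [← h2]
    have h3 : (fun p : ℝ × Eucl m => p.1 • n + Φ p.2) ⁻¹' {x | inner ℝ n x < b}
        = Set.Iio b ×ˢ Set.univ := by
      ext p
      simp [hin]
    rw [h3, setIntegral_prod _ (by rw [← h3]; exact hFΨ.integrableOn)]
    simp [hI]
  have hIcont : Continuous I := by
    obtain ⟨R, hR⟩ := hc.isBounded.subset_closedBall 0
    -- The slice at height `s` lives in the ball of radius `R + |s|`. For heights within 1 of `s`, a
    -- constant on the ball of radius `R + |s| + 1` therefore dominates all slices.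
    have hz : ∀ s (y : Eucl m), ‖y‖ > R + |s| → F (s • n + Φ y) = 0 := by
      intro s y hy
      by_contra hne
      have h4 := hR (subset_tsupport F hne)
      rw [mem_closedBall_zero_iff] at h4
      have h5 : ‖Φ y‖ ≤ ‖s • n + Φ y‖ + ‖s • n‖ := by
        simpa using norm_sub_le (s • n + Φ y) (s • n)
      rw [Φ.norm_map, norm_smul, hn, mul_one, Real.norm_eq_abs] at h5
      linarith
    rw [continuous_iff_continuousAt]
    intro s
    obtain ⟨B, hB⟩ := hF.bounded_above_of_compact_support hc
    refine continuousAt_of_dominated (bound := (Metric.closedBall 0 (R + (|s| + 1))).indicator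
      fun _ => B) (Eventually.of_forall fun t => ?_) ?_ ?_ ?_
    · exact (hF.comp (hΨc.comp (Continuous.prodMk_right t))).aestronglyMeasurable
    · filter_upwards [Metric.ball_mem_nhds s one_pos] with t ht
      refine Eventually.of_forall fun y => ?_
      rw [Metric.mem_ball, Real.dist_eq] at ht
      have h6 : |t| ≤ |s| + 1 := by
        have := abs_sub_abs_le_abs_sub t s
        linarith
      by_cases hy : y ∈ Metric.closedBall 0 (R + (|s| + 1))
      · rw [Set.indicator_of_mem hy]
        exact hB _
      · rw [Set.indicator_of_notMem hy, hz t y, norm_zero]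
        rw [mem_closedBall_zero_iff, not_le] at hy
        linarith
    · exact (integrable_indicator_iff Metric.isClosed_closedBall.measurableSet).2
        (integrableOn_const measure_closedBall_lt_top.ne)
    · exact Eventually.of_forall fun y =>
        (hF.comp (hΨc.comp (Continuous.prodMk_left y))).continuousAt
  have hder : HasDerivAt (fun b => ∫ s in a..b, I s) (I a) a :=
    intervalIntegral.integral_hasDerivAt_right (by simp)
      hIcont.stronglyMeasurable.stronglyMeasurableAtFilter hIcont.continuousAt
  have h7 : (fun b => ∫ x in {x | inner ℝ n x < b}, F x) =
      fun b => (∫ s in Set.Iio a, I s) + ∫ s in a..b, I s := by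
    funext b
    rw [hJ, ← integral_Iic_eq_integral_Iio, ← integral_Iic_eq_integral_Iio,
      ← intervalIntegral.integral_Iic_sub_Iic hIint.integrableOn hIint.integrableOn]
    ring
  rw [h7, integral_hyperplane hn h0 h1]
  exact hder.const_add _

/-- Translating `F` by `t • v` amounts to shifting the half-space by `t * inner ℝ n v`. The
difference quotient of the integral thus has two limits: the integral of the directional derivative,
and, by the chain rule, the plane integral times `inner ℝ n v`. -/
theorem integral_halfspace_lineDeriv {d : ℕ} (hd : 0 < d) {n : Eucl d} (hn : ‖n‖ = 1)
    {F : Eucl d → ℝ} {C : NNReal} (hF : LipschitzWith C F) (hc : HasCompactSupport F)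
    (v : Eucl d) (a : ℝ) :
    ∫ x in {x | inner ℝ n x < a}, lineDeriv ℝ F x v =
      inner ℝ n v * ∫ x in {x | inner ℝ n x = a}, F x ∂surface d := by
  obtain ⟨m, rfl⟩ : ∃ m, d = m + 1 := ⟨d - 1, by omega⟩
  have hmeas : ∀ b, MeasurableSet {x : Eucl (m + 1) | inner ℝ n x < b} := fun b =>
    (isOpen_lt (by fun_prop) continuous_const).measurableSet
  obtain ⟨R, hR⟩ := hc.isBounded.subset_closedBall 0
  -- The limit theorem needs an integrable weight, so the half-space is truncated. The radius `R +
  -- ‖v‖` contains the support of every translate with `0 ≤ t ≤ 1`.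
  set D : Set (Eucl (m + 1)) := {x | inner ℝ n x < a} ∩ Metric.closedBall 0 (R + ‖v‖) with hD
  have hDm : MeasurableSet D := (hmeas a).inter Metric.isClosed_closedBall.measurableSet
  have hg : Integrable (D.indicator fun _ => (1 : ℝ)) :=
    (integrable_indicator_iff hDm).2 (integrableOn_const
      ((measure_mono Set.inter_subset_right).trans_lt measure_closedBall_lt_top).ne)
  have hA := hF.integral_inv_smul_sub_mul_tendsto_integral_lineDeriv_mul hg v
  have hout : ∀ x : Eucl (m + 1), x ∉ Metric.closedBall 0 (R + ‖v‖) → ∀ t ∈ Set.Icc (0 : ℝ) 1,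
      x + t • v ∉ tsupport F := by
    intro x hx t ht hmem
    have h1 := hR hmem
    rw [mem_closedBall_zero_iff] at h1 hx
    have h2 : ‖x‖ ≤ ‖x + t • v‖ + ‖t • v‖ := by simpa using norm_sub_le (x + t • v) (t • v)
    rw [norm_smul, Real.norm_eq_abs, abs_of_nonneg ht.1] at h2
    have h3 : t * ‖v‖ ≤ ‖v‖ := mul_le_of_le_one_left (norm_nonneg _) ht.2
    exact hx (by linarith)
  have hmul : ∀ h : Eucl (m + 1) → ℝ, (∀ x, x ∉ Metric.closedBall 0 (R + ‖v‖) → h x = 0) →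
      ∫ x, h x * D.indicator (fun _ => (1 : ℝ)) x = ∫ x in {x | inner ℝ n x < a}, h x := by
    intro h hh
    rw [← integral_indicator (hmeas a)]
    congr 1
    funext x
    by_cases hx : x ∈ Metric.closedBall 0 (R + ‖v‖)
    · by_cases hxa : x ∈ {x | inner ℝ n x < a}
      · rw [Set.indicator_of_mem hxa, Set.indicator_of_mem (show x ∈ D from ⟨hxa, hx⟩), mul_one]
      · rw [Set.indicator_of_notMem hxa, Set.indicator_of_notMem (fun h => hxa h.1), mul_zero]
    · rw [hh x hx, zero_mul, Set.indicator_apply, hh x hx, ite_self]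
  rw [hmul _ fun x hx => lineDeriv_eq_zero_of_notMem_tsupport
    (by simpa using hout x hx 0 (by simp)) v] at hA
  refine tendsto_nhds_unique hA ?_
  have hJ := hasDerivAt_integral_halfspace hn hF.continuous hc a
  have hlin : HasDerivAt (fun t : ℝ => a + t * inner ℝ n v) (inner ℝ n v) 0 := by
    simpa using ((hasDerivAt_id (0 : ℝ)).mul_const (inner ℝ n v)).const_add a
  have hcomp := HasDerivAt.scomp_of_eq (0 : ℝ) hJ hlin (by simp)
  have hsl := hcomp.tendsto_slope_zero_right
  rw [smul_eq_mul] at hsl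
  refine hsl.congr' ?_
  filter_upwards [Ioo_mem_nhdsGT (zero_lt_one' ℝ)] with t ht
  have hFi : Integrable F := hF.continuous.integrable_of_hasCompactSupport hc
  have htr : ∫ x in {x | inner ℝ n x < a}, F (x + t • v) =
      ∫ x in {x | inner ℝ n x < a + t * inner ℝ n v}, F x := by
    rw [← integral_indicator (hmeas _), ← integral_indicator (hmeas _),
      ← integral_add_right_eq_self ({x | inner ℝ n x < a + t * inner ℝ n v}.indicator F) (t • v)]
    congr 1
    funext x
    have : (x + t • v ∈ {x | inner ℝ n x < a + t * inner ℝ n v}) ↔ x ∈ {x | inner ℝ n x < a} := by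
      simp only [Set.mem_ofPred_eq, inner_add_right, inner_smul_right]
      constructor <;> intro h <;> linarith
    simp only [Set.indicator_apply, this]
  rw [hmul]
  · simp only [smul_eq_mul, Function.comp_def, zero_add, zero_mul, add_zero]
    rw [integral_const_mul, integral_sub (hFi.comp_add_right (t • v)).integrableOn hFi.integrableOn,
      htr]
  · intro x hx
    have hx0 : x ∉ tsupport F := by simpa using hout x hx 0 (by simp)
    simp only [image_eq_zero_of_notMem_tsupport (hout x hx t ⟨ht.1.le, ht.2.le⟩),
      image_eq_zero_of_notMem_tsupport hx0, sub_zero, smul_zero]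

/-! ### Affine subspaces of codimension two -/

theorem exists_orthonormalBasis_of_codim_two {m : ℕ} {K : Submodule ℝ (Eucl (m + 2))}
    (hK : Module.finrank ℝ K = m) :
    ∃ b : OrthonormalBasis (Fin (m + 2)) ℝ (Eucl (m + 2)),
      (∀ w ∈ K, inner ℝ (b 0) w = 0) ∧ ∀ w ∈ K, inner ℝ (b 1) w = 0 := by
  have hfr : Module.finrank ℝ Kᗮ = 2 := by
    have := K.finrank_add_finrank_orthogonal
    rw [hK, finrank_euclideanSpace_fin] at this
    omega
  set e := (stdOrthonormalBasis ℝ Kᗮ).reindex (finCongr hfr) with he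
  let v : Fin (m + 2) → Eucl (m + 2) := fun i => if i = 0 then e 0 else e 1
  have horth : Orthonormal ℝ (({0, 1} : Set (Fin (m + 2))).domRestrict v) := by
    have h01 : inner ℝ (e 0 : Eucl (m + 2)) (e 1) = 0 := by
      rw [← Submodule.coe_inner]
      exact e.orthonormal.2 (by decide)
    refine ⟨?_, ?_⟩
    · rintro ⟨i, rfl | rfl⟩
      · have : ‖(e 0 : Eucl (m + 2))‖ = 1 := e.orthonormal.1 0
        simpa [v] using this
      · have : ‖(e 1 : Eucl (m + 2))‖ = 1 := e.orthonormal.1 1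
        simpa [v] using this
    · rintro ⟨i, rfl | rfl⟩ ⟨j, rfl | rfl⟩ hij
      · exact (hij rfl).elim
      · simpa [v] using h01
      · simpa [v] using (real_inner_comm _ _).trans h01
      · exact (hij rfl).elim
  obtain ⟨b, hb⟩ := horth.exists_orthonormalBasis_extension_of_card_eq (by simp)
  refine ⟨b, fun w hw => ?_, fun w hw => ?_⟩
  · rw [hb 0 (by simp), real_inner_comm]
    simpa [v] using (Submodule.mem_orthogonal _ _).1 (e 0).2 w hw
  · rw [hb 1 (by simp), real_inner_comm]
    simpa [v] using (Submodule.mem_orthogonal _ _).1 (e 1).2 w hw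

/-- In orthonormal coordinates whose first two axes are orthogonal to `L`, the tube lies in a box
with two sides `2ε` and `m` sides `2(R + 1)`; `ε ≤ 1` keeps the long sides fixed. -/
theorem exists_volume_tube_le {d : ℕ} {L : AffineSubspace ℝ (Eucl d)}
    (hL : Module.finrank ℝ L.direction + 2 = d) {S : Set (Eucl d)} (hS : S ⊆ L)
    (hb : Bornology.IsBounded S) :
    ∃ C : ℝ, 0 ≤ C ∧ ∀ ε : ℝ, 0 < ε → ε ≤ 1 →
      volume {y | ∃ z ∈ S, dist y z ≤ ε} ≤ ENNReal.ofReal (C * ε ^ 2) := by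
  obtain ⟨m, rfl⟩ : ∃ m, d = m + 2 := ⟨d - 2, by omega⟩
  obtain ⟨b, hb0, hb1⟩ := exists_orthonormalBasis_of_codim_two (K := L.direction) (by omega)
  rcases S.eq_empty_or_nonempty with rfl | ⟨z₀, hz₀⟩
  · exact ⟨0, le_rfl, fun ε _ _ => by simp⟩
  obtain ⟨R, hR⟩ := hb.subset_closedBall 0
  have hR0 : 0 ≤ R := by
    have := hR hz₀
    rw [mem_closedBall_zero_iff] at this
    exact (norm_nonneg _).trans this
  have hdir : ∀ z ∈ S, z - z₀ ∈ L.direction := fun z hz =>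
    AffineSubspace.vsub_mem_direction (hS hz) (hS hz₀)
  refine ⟨4 * (2 * (R + 1)) ^ m, by positivity, fun ε hε hε1 => ?_⟩
  have hmp := (EuclideanSpace.volume_preserving_symm_measurableEquiv_toLp (Fin (m + 2))).comp
    b.measurePreserving_repr
  set lo : Fin (m + 2) → ℝ := Fin.cons (inner ℝ (b 0) z₀ - ε) (Fin.cons (inner ℝ (b 1) z₀ - ε)
    fun _ => -(R + 1)) with hlo
  set hi : Fin (m + 2) → ℝ := Fin.cons (inner ℝ (b 0) z₀ + ε) (Fin.cons (inner ℝ (b 1) z₀ + ε)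
    fun _ => (R + 1)) with hhi
  have hsub : {y | ∃ z ∈ S, dist y z ≤ ε} ⊆
      (⇑(MeasurableEquiv.toLp 2 (Fin (m + 2) → ℝ)).symm ∘ ⇑b.repr) ⁻¹' Set.Icc lo hi := by
    rintro y ⟨z, hz, hyz⟩
    have hbound : ∀ i, |inner ℝ (b i) (y - z)| ≤ ε := fun i => by
      refine (abs_real_inner_le_norm _ _).trans ?_
      rwa [b.orthonormal.1 i, one_mul, ← dist_eq_norm]
    have hbz : ∀ i, |inner ℝ (b i) z| ≤ R := fun i => by
      refine (abs_real_inner_le_norm _ _).trans ?_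
      rw [b.orthonormal.1 i, one_mul]
      exact mem_closedBall_zero_iff.1 (hR hz)
    have h0 := hb0 _ (hdir z hz)
    have h1 := hb1 _ (hdir z hz)
    rw [inner_sub_right] at h0 h1
    have key : ∀ i, lo i ≤ inner ℝ (b i) y ∧ inner ℝ (b i) y ≤ hi i := by
      intro i
      refine Fin.cases ?_ (fun i => Fin.cases ?_ (fun i => ?_) i) i
      · have := abs_le.1 (hbound 0)
        rw [inner_sub_right] at this
        simp only [hlo, hhi, Fin.cons_zero]
        constructor <;> linarith
      · have := abs_le.1 (hbound 1)
        rw [inner_sub_right] at this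
        simp only [hlo, hhi, Fin.cons_succ, Fin.cons_zero]
        rw [Fin.succ_zero_eq_one]
        constructor <;> linarith
      · have := abs_le.1 (hbound i.succ.succ)
        have h2 := abs_le.1 (hbz i.succ.succ)
        rw [inner_sub_right] at this
        simp only [hlo, hhi, Fin.cons_succ]
        constructor <;> linarith
    constructor
    · intro i
      simpa [b.repr_apply_apply] using (key i).1
    · intro i
      simpa [b.repr_apply_apply] using (key i).2
  refine (measure_mono hsub).trans (le_of_eq ?_)
  rw [hmp.measure_preimage measurableSet_Icc.nullMeasurableSet, Real.volume_Icc_pi,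
    Fin.prod_univ_succ, Fin.prod_univ_succ]
  simp only [hlo, hhi, Fin.cons_succ, Fin.cons_zero, Finset.prod_const, Finset.card_univ,
    Fintype.card_fin]
  rw [← ENNReal.ofReal_pow (by linarith), ← ENNReal.ofReal_mul (by linarith),
    ← ENNReal.ofReal_mul (by linarith)]
  congr 1
  ring

/-- `L` is isometric to a space of dimension `d - 2`, where `(d - 1)`-dimensional Hausdorff measure
is zero. -/
theorem surface_codim_two {d : ℕ} {L : AffineSubspace ℝ (Eucl d)}
    (hL : Module.finrank ℝ L.direction + 2 = d) : surface d (L : Set (Eucl d)) = 0 := by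
  rcases (L : Set (Eucl d)).eq_empty_or_nonempty with h | ⟨z, hz⟩
  · rw [h, measure_empty]
  have hiso : Isometry fun w : L.direction => (w : Eucl d) + z :=
    (IsometryEquiv.addRight z).isometry.comp L.direction.subtypeₗᵢ.isometry
  have himg : (L : Set (Eucl d)) = (fun w : L.direction => (w : Eucl d) + z) '' Set.univ := by
    ext x
    simp only [Set.image_univ, Set.mem_range, SetLike.mem_coe]
    constructor
    · intro hx
      exact ⟨⟨x - z, AffineSubspace.vsub_mem_direction hx hz⟩, by simp⟩
    · rintro ⟨w, rfl⟩
      exact AffineSubspace.vadd_mem_of_mem_direction w.2 hz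
  rw [himg, surface, hiso.euclideanHausdorffMeasure_image,
    Measure.euclideanHausdorffMeasure_def, Measure.smul_apply]
  have h0 : (Measure.hausdorffMeasure ((d - 1 : ℕ) : ℝ) : Measure L.direction) = 0 :=
    Real.hausdorffMeasure_of_finrank_lt
      (by exact_mod_cast (by omega : Module.finrank ℝ L.direction < d - 1))
  rw [h0]
  simp

/-! ### Flat faces -/

/-- Small moves from `x` along the carrying hyperplane stay in `e`, so its direction is orthogonal
to `n`; equal dimensions then identify it with the hyperplane normal to `n`. -/
theorem IsFlatFace.eq_inter_hyperplane {d : ℕ} {e : Set (Eucl d)} (he : IsFlatFace e)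
    {n : Eucl d} (hn : ‖n‖ = 1) (horth : ∀ x ∈ e, ∀ y ∈ e, inner ℝ n (y - x) = 0)
    {x : Eucl d} (hx : x ∈ e) :
    ∃ U, IsOpen U ∧ e = U ∩ {y | inner ℝ n y = inner ℝ n x} := by
  obtain ⟨H, hH, U, hU, rfl⟩ := he.hyperplane
  refine ⟨U, hU, ?_⟩
  have hle : H.direction ≤ (Submodule.span ℝ {n})ᗮ := by
    intro w hw
    rw [Submodule.mem_orthogonal_singleton_iff_inner_right]
    have hcont : Continuous fun t : ℝ => x + t • w := by fun_prop
    have hnear : ∀ᶠ t in 𝓝 (0 : ℝ), x + t • w ∈ U :=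
      (hU.preimage hcont).mem_nhds (by simpa using hx.1)
    obtain ⟨t, ht, ht0⟩ :=
      ((hnear.filter_mono nhdsWithin_le_nhds).and (self_mem_nhdsWithin (s := Set.Ioi (0 : ℝ)))).exists
    have h2 : x + t • w ∈ (H : Set (Eucl d)) := by
      rw [add_comm]
      exact AffineSubspace.vadd_mem_of_mem_direction (H.direction.smul_mem t hw) hx.2
    have := horth x hx _ ⟨ht, h2⟩
    rw [add_sub_cancel_left, inner_smul_right] at this
    exact (mul_eq_zero.1 this).resolve_left (ne_of_gt ht0)
  have hn0 : n ≠ 0 := by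
    rintro rfl
    simp at hn
  have hfr : Module.finrank ℝ (Submodule.span ℝ {n})ᗮ + 1 = d := by
    have := (Submodule.span ℝ {n}).finrank_add_finrank_orthogonal
    rw [finrank_span_singleton hn0, finrank_euclideanSpace_fin] at this
    omega
  have heq := Submodule.eq_of_le_of_finrank_eq hle (by omega)
  ext y
  simp only [Set.mem_inter_iff, Set.mem_ofPred_eq, SetLike.mem_coe]
  refine and_congr_right fun _ => ?_
  have h3 : y ∈ H ↔ y -ᵥ x ∈ H.direction :=
    (AffineSubspace.vsub_right_mem_direction_iff_mem hx.2 y).symm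
  rw [h3, heq, Submodule.mem_orthogonal_singleton_iff_inner_right, vsub_eq_sub, inner_sub_right,
    sub_eq_zero]

theorem IsFlatFace.measurableSet {d : ℕ} {e : Set (Eucl d)} (he : IsFlatFace e) :
    MeasurableSet e := by
  obtain ⟨H, -, U, hU, rfl⟩ := he.hyperplane
  exact hU.measurableSet.inter H.closed_of_finiteDimensional.measurableSet

/-- The carrying hyperplane is closed, so removing `e` from its closure is the same as removing the
open set `U`. -/
theorem IsFlatFace.isClosed_closure_diff {d : ℕ} {e : Set (Eucl d)} (he : IsFlatFace e) :
    IsClosed (closure e \ e) := by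
  obtain ⟨H, -, U, hU, rfl⟩ := he.hyperplane
  have : closure (U ∩ (H : Set (Eucl d))) \ (U ∩ H) = closure (U ∩ (H : Set (Eucl d))) \ U := by
    ext x
    simp only [Set.mem_sdiff, Set.mem_inter_iff, not_and]
    refine and_congr_right fun hx => ⟨fun h hU => h hU ?_, fun h hU => (h hU).elim⟩
    exact H.closed_of_finiteDimensional.closure_subset_iff.2 Set.inter_subset_right hx
  rw [this]
  exact isClosed_closure.sdiff hU

theorem IsFlatFace.volume_closure {d : ℕ} {e : Set (Eucl d)} (he : IsFlatFace e) :
    volume (closure e) = 0 := by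
  obtain ⟨H, hH, U, hU, rfl⟩ := he.hyperplane
  refine measure_mono_null (H.closed_of_finiteDimensional.closure_subset_iff.2
    Set.inter_subset_right) (Measure.addHaar_affineSubspace _ _ ?_)
  rintro rfl
  rw [AffineSubspace.direction_top, finrank_top, finrank_euclideanSpace_fin] at hH
  omega

/-- Applied to the two halves of a ball cut by a face plane, with `t` an element or the domain. -/
theorem isPreconnected_subset_or_disjoint_closure {X : Type*} [TopologicalSpace X] {s t : Set X}
    (hs : IsPreconnected s) (ht : IsOpen t) (h : Disjoint s (frontier t)) :
    s ⊆ t ∨ Disjoint s (closure t) := by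
  by_cases hne : (s ∩ t).Nonempty
  · left
    refine hs.subset_left_of_subset_union ht isClosed_closure.isOpen_compl
      (disjoint_compl_right.mono_left subset_closure) (fun x hx => ?_) hne
    by_contra hx'
    rw [Set.mem_union, not_or, Set.mem_compl_iff, not_not] at hx'
    refine Set.disjoint_left.1 h hx ?_
    rw [ht.frontier_eq]
    exact ⟨hx'.2, hx'.1⟩
  · right
    rw [Set.disjoint_left]
    intro x hx hxt
    refine Set.disjoint_left.1 h hx ?_
    rw [ht.frontier_eq]
    exact ⟨hxt, fun hxt' => hne ⟨x, hx, hxt'⟩⟩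

namespace PolytopalMesh

set_option linter.unusedSectionVars false

variable {d : ℕ} {Ω : Set (Eucl d)} {ι κ : Type*} [Fintype ι] [Fintype κ]
  (M : PolytopalMesh d Ω ι κ)

/-! ### Geometry of the mesh -/

theorem mem_faces {i : ι} {e : κ} : e ∈ M.faces i ↔ M.face e ⊆ frontier (M.cell i) := by
  simp [faces]

theorem isOutwardNormal_normal {i : ι} {e : κ} (he : e ∈ M.faces i) :
    IsOutwardNormal (M.cell i) (M.face e) (M.normal i e) := by
  have h := M.exists_normal i e (M.mem_faces.1 he)
  rw [normal, dif_pos h]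
  exact h.choose_spec

theorem exists_mem_faces (e : κ) : ∃ i, e ∈ M.faces i := by
  simpa [mem_faces] using M.face_incident e

theorem face_nonempty (e : κ) : (M.face e).Nonempty := (M.isFlatFace e).connected.nonempty

/-- The relative boundaries of all faces: vertices for `d = 2`, edges for `d = 3`. -/
def skeleton : Set (Eucl d) := ⋃ e, closure (M.face e) \ M.face e

theorem isClosed_skeleton : IsClosed M.skeleton :=
  isClosed_iUnion_of_finite fun e => (M.isFlatFace e).isClosed_closure_diff

theorem face_disjoint_skeleton (e : κ) : Disjoint (M.face e) M.skeleton := by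
  rw [Set.disjoint_left]
  intro x hx hxs
  obtain ⟨e', he', hne⟩ := Set.mem_iUnion.1 hxs
  by_cases h : e = e'
  · exact hne (h ▸ hx)
  · exact Set.disjoint_left.1 (M.face_disjoint e e' h) hx he'

theorem exists_subset_iUnion_codim_two :
    ∃ A : Finset (AffineSubspace ℝ (Eucl d)),
      (∀ L ∈ A, Module.finrank ℝ L.direction + 2 = d) ∧ M.skeleton ⊆ ⋃ L ∈ A, (L : Set (Eucl d)) := by
  classical
  choose A hA hsub using fun e => (M.isFlatFace e).boundary
  refine ⟨Finset.univ.biUnion A, fun L hL => ?_, Set.iUnion_subset fun e => ?_⟩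
  · obtain ⟨e, -, he⟩ := Finset.mem_biUnion.1 hL
    exact hA e L he
  · refine (hsub e).trans (Set.iUnion₂_subset fun L hL => ?_)
    exact Set.subset_biUnion_of_mem (u := fun L : AffineSubspace ℝ (Eucl d) => (L : Set (Eucl d)))
      (Finset.mem_biUnion.2 ⟨e, Finset.mem_univ _, hL⟩)

theorem surface_skeleton : surface d M.skeleton = 0 := by
  obtain ⟨A, hA, hsub⟩ := M.exists_subset_iUnion_codim_two
  refine measure_mono_null hsub ((measure_biUnion_null_iff A.countable_toSet).2 fun L hL => ?_)
  exact surface_codim_two (hA L hL)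

theorem exists_mem_face_of_mem_frontier {i : ι} {x : Eucl d} (hx : x ∈ frontier (M.cell i))
    (hs : x ∉ M.skeleton) : ∃ e ∈ M.faces i, x ∈ M.face e := by
  rw [M.frontier_cell i] at hx
  obtain ⟨e, he, hxe⟩ := Set.mem_iUnion₂.1 hx
  refine ⟨e, M.mem_faces.2 he, ?_⟩
  by_contra h
  exact hs (Set.mem_iUnion.2 ⟨e, hxe, h⟩)

theorem cell_disjoint_closure {i i' : ι} (h : i ≠ i') :
    Disjoint (M.cell i) (closure (M.cell i')) :=
  (M.cell_disjoint i i' h).closure_right (M.isOpen_cell i)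

theorem cell_disjoint_frontier (i i' : ι) : Disjoint (M.cell i) (frontier (M.cell i')) := by
  by_cases h : i = i'
  · subst h
    rw [(M.isOpen_cell i).frontier_eq]
    exact Set.disjoint_sdiff_right
  · exact (M.cell_disjoint_closure h).mono_right frontier_subset_closure

theorem notMem_cell_of_mem_face {e : κ} {x : Eucl d} (hx : x ∈ M.face e) (i : ι) :
    x ∉ M.cell i := by
  obtain ⟨i', hi'⟩ := M.face_incident e
  exact fun hxi => Set.disjoint_left.1 (M.cell_disjoint_frontier i i') hxi (hi' hx)

theorem eq_of_mem_face_of_mem_closure {e e' : κ} {x : Eucl d} (hx : x ∈ M.face e)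
    (hx' : x ∈ closure (M.face e')) : e = e' := by
  by_contra h
  exact Set.disjoint_left.1 (M.face_disjoint e e' h) hx hx'

/-- A point of an open face lies in no element, so it is a frontier point of `cell i`. It is off the
skeleton, hence lies in an open face of that element, and this can only be `e`. One contact point
therefore decides incidence. -/
theorem mem_faces_of_mem_face_of_mem_closure {e : κ} {i : ι} {x : Eucl d} (hx : x ∈ M.face e)
    (hxi : x ∈ closure (M.cell i)) : e ∈ M.faces i := by
  have hfr : x ∈ frontier (M.cell i) := by
    rw [(M.isOpen_cell i).frontier_eq]
    exact ⟨hxi, M.notMem_cell_of_mem_face hx i⟩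
  obtain ⟨e', he', hxe'⟩ := M.exists_mem_face_of_mem_frontier hfr
    (Set.disjoint_left.1 (M.face_disjoint_skeleton e) hx)
  rwa [M.eq_of_mem_face_of_mem_closure hx (subset_closure hxe')]

theorem exists_mem_closure_cell {x : Eucl d} (hx : x ∈ closure Ω) :
    ∃ i, x ∈ closure (M.cell i) := by
  rw [M.closure_eq] at hx
  exact Set.mem_iUnion.1 hx

theorem closure_cell_subset (i : ι) : closure (M.cell i) ⊆ closure Ω :=
  closure_mono (M.cell_subset i)

theorem face_subset_closure (e : κ) : M.face e ⊆ closure Ω := by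
  obtain ⟨i, hi⟩ := M.face_incident e
  exact hi.trans (frontier_subset_closure.trans (M.closure_cell_subset i))

theorem closure_face_subset_closure (e : κ) : closure (M.face e) ⊆ closure Ω :=
  isClosed_closure.closure_subset_iff.2 (M.face_subset_closure e)

theorem skeleton_subset_closure : M.skeleton ⊆ closure Ω :=
  Set.iUnion_subset fun e => Set.sdiff_subset.trans (M.closure_face_subset_closure e)

theorem frontier_cell_subset (i : ι) : frontier (M.cell i) ⊆ ⋃ e, closure (M.face e) := by
  rw [M.frontier_cell i]
  exact Set.iUnion₂_subset fun e _ => Set.subset_iUnion (fun e => closure (M.face e)) e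

theorem frontier_subset (hΩ : IsOpen Ω) : frontier Ω ⊆ ⋃ e, closure (M.face e) := by
  intro x hx
  rw [hΩ.frontier_eq] at hx
  obtain ⟨i, hi⟩ := M.exists_mem_closure_cell hx.1
  refine M.frontier_cell_subset i ?_
  rw [(M.isOpen_cell i).frontier_eq]
  exact ⟨hi, fun h => hx.2 (M.cell_subset i h)⟩

theorem volume_frontier_cell (i : ι) : volume (frontier (M.cell i)) = 0 :=
  measure_mono_null (M.frontier_cell_subset i)
    (measure_iUnion_null fun e => (M.isFlatFace e).volume_closure)

theorem diff_cells_subset : Ω \ ⋃ i, M.cell i ⊆ ⋃ i, frontier (M.cell i) := by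
  rintro x ⟨hx, hn⟩
  obtain ⟨i, hi⟩ := M.exists_mem_closure_cell (subset_closure hx)
  refine Set.mem_iUnion.2 ⟨i, ?_⟩
  rw [(M.isOpen_cell i).frontier_eq]
  exact ⟨hi, fun h => hn (Set.mem_iUnion.2 ⟨i, h⟩)⟩

theorem iUnion_cell_ae_eq : (⋃ i, M.cell i : Set (Eucl d)) =ᵐ[volume] Ω := by
  refine ae_eq_set.2 ⟨?_, ?_⟩
  · rw [Set.sdiff_eq_empty.2 (Set.iUnion_subset M.cell_subset), measure_empty]
  · exact measure_mono_null M.diff_cells_subset (measure_iUnion_null M.volume_frontier_cell)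

theorem integral_eq_sum {F : Eucl d → ℝ} (hF : IntegrableOn F Ω) :
    ∫ x in Ω, F x = ∑ i, ∫ x in M.cell i, F x := by
  rw [← setIntegral_congr_set M.iUnion_cell_ae_eq,
    integral_iUnion_fintype (fun i => (M.isOpen_cell i).measurableSet)
      (fun i j hij => M.cell_disjoint i j hij) (fun i => hF.mono_set (M.cell_subset i))]

theorem ae_restrict_of_forall_cell {p : Eucl d → Prop} (h : ∀ i, ∀ x ∈ M.cell i, p x) :
    ∀ᵐ x ∂volume.restrict Ω, p x := by
  rw [← Measure.restrict_congr_set M.iUnion_cell_ae_eq,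
    ae_restrict_iff' (MeasurableSet.iUnion fun i => (M.isOpen_cell i).measurableSet)]
  refine Eventually.of_forall fun x hx => ?_
  obtain ⟨i, hi⟩ := Set.mem_iUnion.1 hx
  exact h i x hi

theorem piecewiseConst_of_mem {V : Type*} [AddCommMonoid V] (a : ι → V) {i : ι} {x : Eucl d}
    (hx : x ∈ M.cell i) : M.piecewiseConst a x = a i := by
  rw [piecewiseConst, Finset.sum_eq_single i]
  · exact Set.indicator_of_mem hx _
  · intro j _ hj
    exact Set.indicator_of_notMem
      (fun h => Set.disjoint_left.1 (M.cell_disjoint j i hj) h hx) _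
  · simp

theorem face_eq_inter {i : ι} {e : κ} (he : e ∈ M.faces i) {x : Eucl d} (hx : x ∈ M.face e) :
    ∃ U, IsOpen U ∧
      M.face e = U ∩ {y | inner ℝ (M.normal i e) y = inner ℝ (M.normal i e) x} :=
  (M.isFlatFace e).eq_inter_hyperplane (M.isOutwardNormal_normal he).unit
    (M.isOutwardNormal_normal he).orthogonal hx

/-- Near a point of an open face, the mesh skeleton is a hyperplane. -/
theorem exists_ball_face {i : ι} {e : κ} (he : e ∈ M.faces i) {x : Eucl d} (hx : x ∈ M.face e) :
    ∃ r > 0, (∀ e' ≠ e, Disjoint (Metric.ball x r) (closure (M.face e'))) ∧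
      ∀ y ∈ Metric.ball x r,
        (y ∈ M.face e ↔ inner ℝ (M.normal i e) y = inner ℝ (M.normal i e) x) ∧
        (y ∈ closure (M.face e) ↔ inner ℝ (M.normal i e) y = inner ℝ (M.normal i e) x) := by
  obtain ⟨U, hU, hUe⟩ := M.face_eq_inter he hx
  have hxU : x ∈ U := by rw [hUe] at hx; exact hx.1
  have h1 : ∀ᶠ y in 𝓝 x, ∀ e' : κ, e' ≠ e → y ∉ closure (M.face e') := by
    rw [eventually_all]
    intro e'
    by_cases h : e' = e
    · simp [h]
    · have hxe : x ∉ closure (M.face e') := fun hc =>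
        h (M.eq_of_mem_face_of_mem_closure hx hc).symm
      filter_upwards [isClosed_closure.isOpen_compl.mem_nhds hxe] with y hy _
      exact hy
  obtain ⟨r, hr, hball⟩ := Metric.eventually_nhds_iff_ball.1 (h1.and (hU.mem_nhds hxU))
  refine ⟨r, hr, fun e' he' => ?_, fun y hy => ⟨?_, ?_⟩⟩
  · rw [Set.disjoint_left]
    exact fun y hy => (hball y hy).1 e' he'
  · rw [hUe]
    exact ⟨fun h => h.2, fun h => ⟨(hball y hy).2, h⟩⟩
  · rw [hUe]
    refine ⟨fun h => ?_, fun h => subset_closure ⟨(hball y hy).2, h⟩⟩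
    exact (isClosed_hyperplane _ _).closure_subset_iff.2 Set.inter_subset_right h

/-- In a small ball the frontier of the element lies in the face plane, so each open half-ball is
either inside the element or disjoint from its closure. The outward normal supplies one point on
each side and tells which half is which. -/
theorem exists_ball_cell {i : ι} {e : κ} (he : e ∈ M.faces i) {x : Eucl d} (hx : x ∈ M.face e) :
    ∃ r > 0, (∀ e' ≠ e, Disjoint (Metric.ball x r) (closure (M.face e'))) ∧
      (∀ y ∈ Metric.ball x r,
        (y ∈ M.face e ↔ inner ℝ (M.normal i e) y = inner ℝ (M.normal i e) x) ∧
        (y ∈ closure (M.face e) ↔ inner ℝ (M.normal i e) y = inner ℝ (M.normal i e) x)) ∧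
      ∀ y ∈ Metric.ball x r,
        (y ∈ M.cell i ↔ inner ℝ (M.normal i e) y < inner ℝ (M.normal i e) x) := by
  obtain ⟨r, hr, h1, h2⟩ := M.exists_ball_face he hx
  refine ⟨r, hr, h1, h2, ?_⟩
  set n := M.normal i e with hn
  have hN := M.isOutwardNormal_normal he
  have hfr : ∀ y ∈ Metric.ball x r, y ∈ frontier (M.cell i) → inner ℝ n y = inner ℝ n x := by
    intro y hy hyf
    rw [M.frontier_cell i] at hyf
    obtain ⟨e', -, hye'⟩ := Set.mem_iUnion₂.1 hyf
    by_cases h : e' = e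
    · subst h
      exact ((h2 y hy).2).1 hye'
    · exact (Set.disjoint_left.1 (h1 e' h) hy hye').elim
  have hlin : IsLinearMap ℝ fun y : Eucl d => inner ℝ n y :=
    ⟨fun a b => inner_add_right _ _ _, fun c a => by simp [inner_smul_right]⟩
  have hnn : inner ℝ n n = (1 : ℝ) := by rw [real_inner_self_eq_norm_sq, hN.unit]; norm_num
  have hsmall : ∀ᶠ t in 𝓝[>] (0 : ℝ), 0 < t ∧ t < r ∧ x - t • n ∈ M.cell i ∧
      x + t • n ∉ closure (M.cell i) := by
    filter_upwards [hN.outward x hx, Ioo_mem_nhdsGT hr] with t ht ht'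
    exact ⟨ht'.1, ht'.2, ht.1, ht.2⟩
  obtain ⟨t, ht0, htr, hin, hout⟩ := hsmall.exists
  have hminus : Metric.ball x r ∩ {y | inner ℝ n y < inner ℝ n x} ⊆ M.cell i := by
    have hpre : IsPreconnected (Metric.ball x r ∩ {y | inner ℝ n y < inner ℝ n x}) :=
      ((convex_ball x r).inter (convex_halfSpace_lt hlin _)).isPreconnected
    rcases isPreconnected_subset_or_disjoint_closure hpre (M.isOpen_cell i) (Set.disjoint_left.2
      fun y hy hyf => (ne_of_lt hy.2) (hfr y hy.1 hyf)) with h | h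
    · exact h
    · have hmem : x - t • n ∉ Metric.ball x r ∩ {y | inner ℝ n y < inner ℝ n x} := fun hmem =>
        Set.disjoint_left.1 h hmem (subset_closure hin)
      refine (hmem ⟨?_, ?_⟩).elim
      · rw [mem_ball_iff_norm, sub_sub_cancel_left, norm_neg, norm_smul, hN.unit, mul_one,
          Real.norm_eq_abs, abs_of_pos ht0]
        exact htr
      · simp only [Set.mem_ofPred_eq, inner_sub_right, inner_smul_right, hnn]
        linarith
  have hplus : Disjoint (Metric.ball x r ∩ {y | inner ℝ n x < inner ℝ n y})
      (closure (M.cell i)) := by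
    have hpre : IsPreconnected (Metric.ball x r ∩ {y | inner ℝ n x < inner ℝ n y}) :=
      ((convex_ball x r).inter (convex_halfSpace_gt hlin _)).isPreconnected
    rcases isPreconnected_subset_or_disjoint_closure hpre (M.isOpen_cell i) (Set.disjoint_left.2
      fun y hy hyf => (ne_of_gt hy.2) (hfr y hy.1 hyf)) with h | h
    · refine (hout (subset_closure (h ⟨?_, ?_⟩))).elim
      · rw [mem_ball_iff_norm, add_sub_cancel_left, norm_smul, hN.unit, mul_one,
          Real.norm_eq_abs, abs_of_pos ht0]
        exact htr
      · simp only [Set.mem_ofPred_eq, inner_add_right, inner_smul_right, hnn]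
        linarith
    · exact h
  intro y hy
  refine ⟨fun hyc => ?_, fun h => hminus ⟨hy, h⟩⟩
  by_contra hle
  rcases (not_lt.1 hle).lt_or_eq with h | h
  · exact Set.disjoint_left.1 hplus ⟨hy, h⟩ (subset_closure hyc)
  · exact M.notMem_cell_of_mem_face (((h2 y hy).1).2 h.symm) i hyc

end PolytopalMesh

/-! ### Lipschitz functions with compact support -/

theorem locallyLipschitz_mul {X : Type*} [PseudoEMetricSpace X] {f g : X → ℝ}
    (hf : LocallyLipschitz f) (hg : LocallyLipschitz g) : LocallyLipschitz fun x => f x * g x := by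
  have h : ContDiff ℝ 1 fun p : ℝ × ℝ => p.1 * p.2 := contDiff_fst.mul contDiff_snd
  exact h.locallyLipschitz.comp (hf.prodMk hg)

/-- Compactness gives a constant on the ball of radius `R + 1`. A point of the ball of radius `R`
and a point outside the larger ball are at distance at least 1, so there the supremum `B` serves as
a Lipschitz constant. -/
theorem exists_lipschitzWith_of_hasCompactSupport {d : ℕ} {f : Eucl d → ℝ}
    (hf : LocallyLipschitz f) (hc : HasCompactSupport f) : ∃ C, LipschitzWith C f := by
  obtain ⟨R, hR⟩ := hc.isBounded.subset_closedBall 0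
  obtain ⟨K, hK⟩ := LocallyLipschitzOn.exists_lipschitzOnWith_of_compact
    (isCompact_closedBall (0 : Eucl d) (R + 1)) (hf.locallyLipschitzOn)
  obtain ⟨B, hB⟩ := hf.continuous.bounded_above_of_compact_support hc
  have hB0 : 0 ≤ B := (norm_nonneg _).trans (hB 0)
  have key : ∀ x y : Eucl d, x ∈ Metric.closedBall 0 R → |f x - f y| ≤ max (K : ℝ) B * dist x y := by
    intro x y hx
    by_cases hy : y ∈ Metric.closedBall 0 (R + 1)
    · have h1 := hK.dist_le_mul x (Metric.closedBall_subset_closedBall (by linarith) hx) y hy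
      rw [Real.dist_eq] at h1
      exact h1.trans (mul_le_mul_of_nonneg_right (le_max_left _ _) dist_nonneg)
    · have hy0 : f y = 0 := by
        by_contra hne
        exact hy (Metric.closedBall_subset_closedBall (by linarith) (hR (subset_tsupport f hne)))
      rw [hy0, sub_zero]
      rw [mem_closedBall_zero_iff] at hx hy
      have h2 : 1 ≤ dist x y := by
        have := norm_sub_norm_le y x
        rw [dist_comm, dist_eq_norm]
        linarith
      calc |f x| ≤ B := hB x
        _ ≤ max (K : ℝ) B * 1 := by rw [mul_one]; exact le_max_right _ _
        _ ≤ max (K : ℝ) B * dist x y := mul_le_mul_of_nonneg_left h2 (hB0.trans (le_max_right _ _))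
  refine ⟨(max (K : ℝ) B).toNNReal, LipschitzWith.of_dist_le_mul fun x y => ?_⟩
  rw [Real.coe_toNNReal _ (hB0.trans (le_max_right _ _)), Real.dist_eq]
  by_cases hx : x ∈ Metric.closedBall 0 R
  · exact key x y hx
  by_cases hy : y ∈ Metric.closedBall 0 R
  · rw [abs_sub_comm, dist_comm]
    exact key y x hy
  have h0 : ∀ z, z ∉ Metric.closedBall 0 R → f z = 0 := fun z hz => by
    by_contra hne
    exact hz (hR (subset_tsupport f hne))
  rw [h0 x hx, h0 y hy, sub_zero, abs_zero]
  have := hB0.trans (le_max_right (K : ℝ) B)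
  positivity

theorem abs_lineDeriv_le {d : ℕ} {f : Eucl d → ℝ} {C : NNReal}
    (hf : LipschitzWith C f) (x v : Eucl d) : |lineDeriv ℝ f x v| ≤ C * ‖v‖ :=
  norm_lineDeriv_le_of_lipschitz ℝ hf

theorem ae_lineDeriv_mul {d : ℕ} {f g : Eucl d → ℝ} {C D : NNReal} (hf : LipschitzWith C f)
    (hg : LipschitzWith D g) (v : Eucl d) :
    ∀ᵐ x, lineDeriv ℝ (fun y => f y * g y) x v =
      lineDeriv ℝ f x v * g x + f x * lineDeriv ℝ g x v := by
  filter_upwards [hf.ae_lineDifferentiableAt (μ := volume) v,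
    hg.ae_lineDifferentiableAt (μ := volume) v] with x h1 h2
  have h3 := HasDerivAt.mul h1.hasLineDerivAt h2.hasLineDerivAt
  simp only [zero_smul, add_zero] at h3
  exact HasLineDerivAt.lineDeriv h3

theorem ae_lineDeriv_sum {d : ℕ} {α : Type*} (s : Finset α) {f : α → Eucl d → ℝ}
    (hf : ∀ a, ∃ C, LipschitzWith C (f a)) (v : Eucl d) :
    ∀ᵐ x, lineDeriv ℝ (fun y => ∑ a ∈ s, f a y) x v = ∑ a ∈ s, lineDeriv ℝ (f a) x v := by
  have h : ∀ᵐ x, ∀ a ∈ s, LineDifferentiableAt ℝ (f a) x v := by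
    rw [eventually_all_finset]
    intro a _
    obtain ⟨C, hC⟩ := hf a
    exact hC.ae_lineDifferentiableAt v
  filter_upwards [h] with x hx
  exact HasLineDerivAt.lineDeriv (HasDerivAt.fun_sum fun a ha => (hx a ha).hasLineDerivAt)

theorem setIntegral_eq_of_forall_ne_zero {X : Type*} [MeasurableSpace X] {μ : Measure X}
    {A B : Set X} (hA : MeasurableSet A) (hB : MeasurableSet B) {F : X → ℝ}
    (h : ∀ y, F y ≠ 0 → (y ∈ A ↔ y ∈ B)) : ∫ y in A, F y ∂μ = ∫ y in B, F y ∂μ := by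
  classical
  rw [← integral_indicator hA, ← integral_indicator hB]
  congr 1
  funext y
  by_cases hy : F y = 0
  · simp only [Set.indicator_apply, hy, ite_self]
  · by_cases hyA : y ∈ A
    · rw [Set.indicator_of_mem hyA, Set.indicator_of_mem ((h y hy).1 hyA)]
    · rw [Set.indicator_of_notMem hyA, Set.indicator_of_notMem fun hyB => hyA ((h y hy).2 hyB)]

namespace PolytopalMesh

set_option linter.unusedSectionVars false

variable {d : ℕ} {Ω : Set (Eucl d)} {ι κ : Type*} [Fintype ι] [Fintype κ]
  (M : PolytopalMesh d Ω ι κ)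

/-! ### The divergence theorem on an element -/

/-- The divergence theorem on `cell i` for the vector field `x ↦ F x • v`. -/
def DivergenceFormula (i : ι) (v : Eucl d) (F : Eucl d → ℝ) : Prop :=
  ∫ x in M.cell i, lineDeriv ℝ F x v =
    ∑ e ∈ M.faces i, inner ℝ (M.normal i e) v * ∫ x in M.face e, F x ∂surface d

theorem surface_face_lt_top (hd : 0 < d) (hΩ : Bornology.IsBounded Ω) (e : κ) :
    surface d (closure (M.face e)) < ⊤ := by
  obtain ⟨i, hi⟩ := M.exists_mem_faces e
  obtain ⟨x, hx⟩ := M.face_nonempty e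
  obtain ⟨U, hU, hUe⟩ := M.face_eq_inter hi hx
  have hsub : closure (M.face e) ⊆
      closure Ω ∩ {y | inner ℝ (M.normal i e) y = inner ℝ (M.normal i e) x} := by
    refine Set.subset_inter (M.closure_face_subset_closure e)
      ((isClosed_hyperplane _ _).closure_subset_iff.2 ?_)
    rw [hUe]
    exact Set.inter_subset_right
  exact (measure_mono hsub).trans_lt
    (surface_hyperplane_inter_lt_top hd (M.isOutwardNormal_normal hi).unit _ hΩ.closure)

theorem isFiniteMeasure_face (hd : 0 < d) (hΩ : Bornology.IsBounded Ω) (e : κ) :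
    IsFiniteMeasure ((surface d).restrict (M.face e)) :=
  ⟨by
    rw [Measure.restrict_apply_univ]
    exact (measure_mono subset_closure).trans_lt (M.surface_face_lt_top hd hΩ e)⟩

theorem integrableOn_face (hd : 0 < d) (hΩ : Bornology.IsBounded Ω) (e : κ) {F : Eucl d → ℝ}
    (hF : Continuous F) : IntegrableOn F (M.face e) (surface d) := by
  have hcpt : IsCompact (closure (M.face e)) :=
    Metric.isCompact_of_isClosed_isBounded isClosed_closure
      (hΩ.closure.subset (M.closure_face_subset_closure e))
  obtain ⟨B, hB⟩ := hcpt.exists_bound_of_continuousOn hF.continuousOn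
  have := M.isFiniteMeasure_face hd hΩ e
  refine Integrable.of_bound hF.aestronglyMeasurable B ?_
  refine (ae_restrict_iff' (M.isFlatFace e).measurableSet).2 (Eventually.of_forall fun x hx => ?_)
  exact hB x (subset_closure hx)

theorem setIntegral_face_eq_zero {F : Eucl d → ℝ} {e : κ} (h : ∀ x ∈ M.face e, F x = 0) :
    ∫ x in M.face e, F x ∂surface d = 0 :=
  setIntegral_eq_zero_of_forall_eq_zero h

/-- Off the skeleton there are three local pictures. For functions supported inside the element or
outside its closure both sides vanish; around a point of an open face the element is a half-space.
-/
theorem exists_nhds_divergenceFormula (hd : 0 < d) (i : ι) (v : Eucl d) {x : Eucl d}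
    (hx : x ∉ M.skeleton) :
    ∃ V, IsOpen V ∧ x ∈ V ∧ ∀ (F : Eucl d → ℝ) (C : NNReal), LipschitzWith C F →
      HasCompactSupport F → tsupport F ⊆ V → M.DivergenceFormula i v F := by
  by_cases hxc : x ∈ M.cell i
  · refine ⟨M.cell i, M.isOpen_cell i, hxc, fun F C hF hc hV => ?_⟩
    rw [DivergenceFormula, setIntegral_eq_integral_of_forall_compl_eq_zero fun y hy =>
      lineDeriv_eq_zero_of_notMem_tsupport (fun h => hy (hV h)) v,
      integral_lineDeriv_eq_zero hF hc]
    refine (Finset.sum_eq_zero fun e _ => ?_).symm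
    rw [M.setIntegral_face_eq_zero fun y hy => image_eq_zero_of_notMem_tsupport
      fun h => M.notMem_cell_of_mem_face hy i (hV h), mul_zero]
  by_cases hxcl : x ∈ closure (M.cell i)
  · have hfr : x ∈ frontier (M.cell i) := by
      rw [(M.isOpen_cell i).frontier_eq]
      exact ⟨hxcl, hxc⟩
    obtain ⟨e, he, hxe⟩ := M.exists_mem_face_of_mem_frontier hfr hx
    obtain ⟨r, hr, h1, h2, h3⟩ := M.exists_ball_cell he hxe
    have hN := M.isOutwardNormal_normal he
    refine ⟨Metric.ball x r, Metric.isOpen_ball, Metric.mem_ball_self hr,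
      fun F C hF hc hV => ?_⟩
    rw [DivergenceFormula, Finset.sum_eq_single e]
    · have hm : MeasurableSet {y | inner ℝ (M.normal i e) y < inner ℝ (M.normal i e) x} :=
        (isOpen_lt (by fun_prop) continuous_const).measurableSet
      rw [setIntegral_eq_of_forall_ne_zero (M.isOpen_cell i).measurableSet hm fun y hy => h3 y (hV (by
            by_contra h
            exact hy (lineDeriv_eq_zero_of_notMem_tsupport h v))),
        setIntegral_eq_of_forall_ne_zero (M.isFlatFace e).measurableSet
          (measurableSet_hyperplane _ _) fun y hy => (h2 y (hV (subset_tsupport F hy))).1]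
      exact integral_halfspace_lineDeriv hd hN.unit hF hc v _
    · intro e' _ hne
      rw [M.setIntegral_face_eq_zero fun y hy => image_eq_zero_of_notMem_tsupport
        fun h => Set.disjoint_left.1 (h1 e' hne) (hV h) (subset_closure hy), mul_zero]
    · exact fun h => (h he).elim
  · refine ⟨(closure (M.cell i))ᶜ, isClosed_closure.isOpen_compl, hxcl, fun F C hF hc hV => ?_⟩
    rw [DivergenceFormula, setIntegral_eq_zero_of_forall_eq_zero fun y hy =>
      lineDeriv_eq_zero_of_notMem_tsupport (fun h => hV h (subset_closure hy)) v]
    refine (Finset.sum_eq_zero fun e he => ?_).symm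
    rw [M.setIntegral_face_eq_zero fun y hy => image_eq_zero_of_notMem_tsupport
      fun h => hV h (frontier_subset_closure (M.mem_faces.1 he hy)), mul_zero]

/-- The compact support is covered by finitely many good neighbourhoods. A subordinate smooth
partition of unity splits `F`, and the formula is linear, with derivatives added almost everywhere.
-/
theorem divergenceFormula_of_disjoint_skeleton (hd : 0 < d) (hΩ : Bornology.IsBounded Ω) (i : ι)
    (v : Eucl d) {F : Eucl d → ℝ} {C : NNReal} (hF : LipschitzWith C F)
    (hc : HasCompactSupport F) (hs : Disjoint (tsupport F) M.skeleton) :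
    M.DivergenceFormula i v F := by
  classical
  choose! V hVo hxV hV using fun (x : Eucl d) (hx : x ∉ M.skeleton) =>
    M.exists_nhds_divergenceFormula hd i v hx
  have hnot : ∀ x ∈ tsupport F, x ∉ M.skeleton := fun x hx => Set.disjoint_left.1 hs hx
  obtain ⟨t, ht, hcov⟩ := hc.elim_nhds_subcover V
    (fun x hx => (hVo x (hnot x hx)).mem_nhds (hxV x (hnot x hx)))
  obtain ⟨ρ, hρ⟩ := SmoothPartitionOfUnity.exists_isSubordinate (modelWithCornersSelf ℝ (Eucl d))
    (isClosed_tsupport F) (fun x : t => V x) (fun x => hVo x (hnot x (ht x x.2)))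
    (fun y hy => by
      obtain ⟨x, hx, hy⟩ := Set.mem_iUnion₂.1 (hcov hy)
      exact Set.mem_iUnion.2 ⟨⟨x, hx⟩, hy⟩)
  have hcs : ∀ x : t, HasCompactSupport fun y => ρ x y * F y := fun x => hc.mul_left
  have hlip : ∀ x : t, ∃ C, LipschitzWith C fun y => ρ x y * F y := fun x => by
    refine exists_lipschitzWith_of_hasCompactSupport (locallyLipschitz_mul ?_ hF.locallyLipschitz)
      (hcs x)
    exact ((ρ x).contMDiff.contDiff.of_le (by exact_mod_cast le_top)).locallyLipschitz
  have hform : ∀ x : t, M.DivergenceFormula i v fun y => ρ x y * F y := fun x => by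
    obtain ⟨C', hC'⟩ := hlip x
    refine hV x (hnot x (ht x x.2)) _ C' hC' (hcs x) ((tsupport_mul_subset_left).trans (hρ x))
  have hsum : F = fun y => ∑ x : t, ρ x y * F y := by
    funext y
    by_cases hy : y ∈ tsupport F
    · have h1 := ρ.sum_eq_one hy
      rw [finsum_eq_sum_of_fintype] at h1
      rw [← Finset.sum_mul, h1, one_mul]
    · simp [image_eq_zero_of_notMem_tsupport hy]
  have hint : ∀ x : t, Integrable (fun y => lineDeriv ℝ (fun z => ρ x z * F z) y v) := fun x => by
    obtain ⟨C', hC'⟩ := hlip x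
    exact integrable_lineDeriv hC' (hcs x) v
  rw [DivergenceFormula]
  calc ∫ y in M.cell i, lineDeriv ℝ F y v
      = ∫ y in M.cell i, ∑ x : t, lineDeriv ℝ (fun z => ρ x z * F z) y v := by
        refine integral_congr_ae (ae_restrict_of_ae ?_)
        conv => enter [1, x, 1]; rw [hsum]
        exact ae_lineDeriv_sum Finset.univ hlip v
    _ = ∑ x : t, ∫ y in M.cell i, lineDeriv ℝ (fun z => ρ x z * F z) y v :=
        integral_finsetSum _ fun x _ => (hint x).integrableOn
    _ = ∑ x : t, ∑ e ∈ M.faces i, inner ℝ (M.normal i e) v *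
          ∫ y in M.face e, ρ x y * F y ∂surface d := Finset.sum_congr rfl fun x _ => hform x
    _ = _ := by
        rw [Finset.sum_comm]
        refine Finset.sum_congr rfl fun e _ => ?_
        rw [← Finset.mul_sum, ← integral_finsetSum]
        · conv_rhs => rw [hsum]
        · intro x _
          obtain ⟨C', hC'⟩ := hlip x
          exact M.integrableOn_face hd hΩ e hC'.continuous

end PolytopalMesh

/-! ### Cutoff functions -/

/-- A Lipschitz function that vanishes within distance `ε` of `Z` and is `1` at distance `2ε`. -/
def cutoff {X : Type*} [PseudoMetricSpace X] (Z : Set X) (ε : ℝ) (x : X) : ℝ :=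
  min 1 (max 0 (ε⁻¹ * Metric.infDist x Z - 1))

section Cutoff

variable {X : Type*} [PseudoMetricSpace X] {Z : Set X} {ε : ℝ}

theorem cutoff_nonneg (x : X) : 0 ≤ cutoff Z ε x := le_min zero_le_one (le_max_left _ _)

theorem cutoff_le_one (x : X) : cutoff Z ε x ≤ 1 := min_le_left _ _

theorem abs_cutoff_le_one (x : X) : |cutoff Z ε x| ≤ 1 := by
  rw [abs_of_nonneg (cutoff_nonneg x)]
  exact cutoff_le_one x

theorem cutoff_eq_zero (hε : 0 < ε) {x : X} (hx : Metric.infDist x Z ≤ ε) :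
    cutoff Z ε x = 0 := by
  have : ε⁻¹ * Metric.infDist x Z ≤ 1 := by
    rw [inv_mul_le_iff₀ hε, mul_one]
    exact hx
  rw [cutoff, max_eq_left (by linarith), min_eq_right zero_le_one]

theorem cutoff_eq_one (hε : 0 < ε) {x : X} (hx : 2 * ε ≤ Metric.infDist x Z) :
    cutoff Z ε x = 1 := by
  have : 2 ≤ ε⁻¹ * Metric.infDist x Z := by
    rw [le_inv_mul_iff₀ hε]
    linarith
  rw [cutoff, min_eq_left]
  exact le_max_of_le_right (by linarith)

theorem lipschitzWith_cutoff (hε : 0 < ε) : LipschitzWith (ε⁻¹).toNNReal (cutoff Z ε) := by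
  have h1 : LipschitzWith (ε⁻¹).toNNReal fun x : X => ε⁻¹ * Metric.infDist x Z - 1 := by
    refine LipschitzWith.of_dist_le_mul fun x y => ?_
    rw [Real.coe_toNNReal _ (inv_nonneg.2 hε.le), Real.dist_eq]
    have h2 := (Metric.lipschitz_infDist_pt Z).dist_le_mul x y
    rw [Real.dist_eq, NNReal.coe_one, one_mul] at h2
    have h3 : ε⁻¹ * Metric.infDist x Z - 1 - (ε⁻¹ * Metric.infDist y Z - 1) =
      ε⁻¹ * (Metric.infDist x Z - Metric.infDist y Z) := by ring
    rw [h3, abs_mul, abs_of_pos (inv_pos.2 hε)]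
    exact mul_le_mul_of_nonneg_left h2 (inv_nonneg.2 hε.le)
  exact (h1.const_max 0).const_min 1

theorem tendsto_cutoff {u : ℕ → ℝ} (hu : Tendsto u atTop (𝓝 0)) (hu0 : ∀ k, 0 < u k)
    (hZ : IsClosed Z) (hne : Z.Nonempty) {x : X} (hx : x ∉ Z) :
    Tendsto (fun k => cutoff Z (u k) x) atTop (𝓝 1) := by
  have hpos := (hZ.notMem_iff_infDist_pos hne).1 hx
  refine tendsto_const_nhds.congr' ?_
  filter_upwards [hu.eventually_lt_const (half_pos hpos)] with k hk
  exact (cutoff_eq_one (hu0 k) (by linarith)).symm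

end Cutoff

/-! ### The divergence theorem for functions whose support meets the skeleton -/

namespace PolytopalMesh

set_option linter.unusedSectionVars false

variable {d : ℕ} {Ω : Set (Eucl d)} {ι κ : Type*} [Fintype ι] [Fintype κ]
  (M : PolytopalMesh d Ω ι κ)

theorem exists_volume_tube_skeleton_le (hΩ : Bornology.IsBounded Ω) :
    ∃ C : ℝ, 0 ≤ C ∧ ∀ ε : ℝ, 0 < ε → ε ≤ 1 →
      volume {y | ∃ z ∈ M.skeleton, dist y z ≤ ε} ≤ ENNReal.ofReal (C * ε ^ 2) := by
  obtain ⟨A, hA, hsub⟩ := M.exists_subset_iUnion_codim_two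
  have hb : Bornology.IsBounded M.skeleton := hΩ.closure.subset M.skeleton_subset_closure
  choose! C hC0 hC using fun L (hL : L ∈ A) => exists_volume_tube_le (hA L hL)
    (Set.inter_subset_right : M.skeleton ∩ L ⊆ L) (hb.subset Set.inter_subset_left)
  refine ⟨∑ L ∈ A, C L, Finset.sum_nonneg hC0, fun ε hε hε1 => ?_⟩
  have hcov : {y | ∃ z ∈ M.skeleton, dist y z ≤ ε} ⊆
      ⋃ L ∈ A, {y | ∃ z ∈ M.skeleton ∩ L, dist y z ≤ ε} := by
    rintro y ⟨z, hz, hyz⟩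
    obtain ⟨L, hL, hzL⟩ := Set.mem_iUnion₂.1 (hsub hz)
    exact Set.mem_iUnion₂.2 ⟨L, hL, z, ⟨hz, hzL⟩, hyz⟩
  calc volume {y | ∃ z ∈ M.skeleton, dist y z ≤ ε}
      ≤ ∑ L ∈ A, volume {y | ∃ z ∈ M.skeleton ∩ L, dist y z ≤ ε} :=
        (measure_mono hcov).trans (measure_biUnion_finset_le _ _)
    _ ≤ ∑ L ∈ A, ENNReal.ofReal (C L * ε ^ 2) := Finset.sum_le_sum fun L hL => hC L hL ε hε hε1
    _ = ENNReal.ofReal ((∑ L ∈ A, C L) * ε ^ 2) := by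
        rw [← ENNReal.ofReal_sum_of_nonneg fun L hL => mul_nonneg (hC0 L hL) (sq_nonneg ε),
          Finset.sum_mul]

theorem notMem_skeleton_of_mem_cell {i : ι} {x : Eucl d} (hx : x ∈ M.cell i) :
    x ∉ M.skeleton := by
  intro hs
  obtain ⟨e, he, -⟩ := Set.mem_iUnion.1 hs
  obtain ⟨i', hi'⟩ := M.face_incident e
  exact Set.disjoint_left.1 (M.cell_disjoint_frontier i i') hx
    (isClosed_frontier.closure_subset_iff.2 hi' he)

/-- The cutoff is constant at distance more than `2ε`, and its slope is at most `ε⁻¹`. The tube of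
radius `2ε` has volume at most `4Cε²`, so codimension two leaves a spare factor `ε`. -/
theorem norm_integral_mul_lineDeriv_cutoff_le {F : Eucl d → ℝ} {B : ℝ} (hB : ∀ x, ‖F x‖ ≤ B)
    (hΩ : Bornology.IsBounded Ω) (hne : M.skeleton.Nonempty) {C : ℝ} (hC0 : 0 ≤ C)
    (hC : ∀ ε : ℝ, 0 < ε → ε ≤ 1 →
      volume {y | ∃ z ∈ M.skeleton, dist y z ≤ ε} ≤ ENNReal.ofReal (C * ε ^ 2))
    (i : ι) (v : Eucl d) {ε : ℝ} (hε : 0 < ε) (hε1 : 2 * ε ≤ 1) :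
    ‖∫ x in M.cell i, F x * lineDeriv ℝ (cutoff M.skeleton ε) x v‖ ≤ 4 * B * ‖v‖ * C * ε := by
  have hB0 : 0 ≤ B := (norm_nonneg _).trans (hB 0)
  have hcpt : IsCompact M.skeleton := Metric.isCompact_of_isClosed_isBounded M.isClosed_skeleton
    (hΩ.closure.subset M.skeleton_subset_closure)
  set N : Set (Eucl d) := {y | Metric.infDist y M.skeleton ≤ 2 * ε} with hN
  have hNc : IsClosed N := isClosed_le (Metric.continuous_infDist_pt _) continuous_const
  have hNvol : volume N ≤ ENNReal.ofReal (C * (2 * ε) ^ 2) := by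
    refine (measure_mono fun y hy => ?_).trans (hC (2 * ε) (by linarith) hε1)
    obtain ⟨z, hz, hzd⟩ := hcpt.exists_infDist_eq_dist hne y
    exact ⟨z, hz, by rw [← hzd]; exact hy⟩
  have hzero : ∀ x ∉ N, F x * lineDeriv ℝ (cutoff M.skeleton ε) x v = 0 := by
    intro x hx
    have h1 : cutoff M.skeleton ε =ᶠ[𝓝 x] fun _ => 1 := by
      filter_upwards [hNc.isOpen_compl.mem_nhds hx] with y hy
      exact cutoff_eq_one hε (le_of_lt (not_le.1 hy))
    rw [h1.lineDeriv_eq]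
    simp [lineDeriv]
  have hbd : ∀ x, ‖F x * lineDeriv ℝ (cutoff M.skeleton ε) x v‖ ≤ B * (ε⁻¹ * ‖v‖) := by
    intro x
    rw [norm_mul]
    refine mul_le_mul (hB x) ?_ (norm_nonneg _) hB0
    have := abs_lineDeriv_le (lipschitzWith_cutoff (Z := M.skeleton) hε) x v
    rwa [Real.coe_toNNReal _ (inv_nonneg.2 hε.le)] at this
  have hset : ∫ x in M.cell i, F x * lineDeriv ℝ (cutoff M.skeleton ε) x v =
      ∫ x in M.cell i ∩ N, F x * lineDeriv ℝ (cutoff M.skeleton ε) x v := by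
    refine setIntegral_eq_of_forall_ne_zero (M.isOpen_cell i).measurableSet
      ((M.isOpen_cell i).measurableSet.inter hNc.measurableSet) fun y hy => ?_
    have : y ∈ N := by
      by_contra h
      exact hy (hzero y h)
    simp [this]
  have hlt : volume (M.cell i ∩ N) < ⊤ :=
    (measure_mono Set.inter_subset_right).trans_lt (hNvol.trans_lt ENNReal.ofReal_lt_top)
  rw [hset]
  refine (norm_setIntegral_le_of_norm_le_const hlt fun x _ => hbd x).trans ?_
  have hreal : volume.real (M.cell i ∩ N) ≤ C * (2 * ε) ^ 2 :=
    ENNReal.toReal_le_of_le_ofReal (by positivity)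
      ((measure_mono Set.inter_subset_right).trans hNvol)
  calc B * (ε⁻¹ * ‖v‖) * volume.real (M.cell i ∩ N)
      ≤ B * (ε⁻¹ * ‖v‖) * (C * (2 * ε) ^ 2) :=
        mul_le_mul_of_nonneg_left hreal (by positivity)
    _ = 4 * B * ‖v‖ * C * ε := by
        field_simp
        ring

/-- The divergence theorem on a polytopal element, for Lipschitz functions. -/
theorem divergenceFormula (hd : 0 < d) (hΩ : Bornology.IsBounded Ω) (i : ι)
    (v : Eucl d) {F : Eucl d → ℝ} {C : NNReal} (hF : LipschitzWith C F)
    (hc : HasCompactSupport F) : M.DivergenceFormula i v F := by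
  -- For empty `Z`, `Metric.infDist` is 0 and the cutoff would vanish identically.
  rcases M.skeleton.eq_empty_or_nonempty with hemp | hne
  · exact M.divergenceFormula_of_disjoint_skeleton hd hΩ i v hF hc (by simp [hemp])
  obtain ⟨B, hB⟩ := hF.continuous.bounded_above_of_compact_support hc
  obtain ⟨K, hK0, hK⟩ := M.exists_volume_tube_skeleton_le hΩ
  set Z := M.skeleton with hZ
  -- The factor 1/2 ensures `2 * u k ≤ 1`, as the volume bound for the tube of radius `2 * u k`
  -- requires.
  set u : ℕ → ℝ := fun k => (1 / 2) * (1 / ((k : ℝ) + 1)) with hu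
  have hu0 : ∀ k, 0 < u k := fun k => by positivity
  have hu1 : ∀ k, 2 * u k ≤ 1 := fun k => by
    have : 1 / ((k : ℝ) + 1) ≤ 1 := by
      rw [div_le_one (by positivity)]
      linarith [Nat.cast_nonneg (α := ℝ) k]
    simp only [hu]
    linarith
  have hulim : Tendsto u atTop (𝓝 0) := by
    simpa [hu] using (tendsto_one_div_add_atTop_nhds_zero_nat (𝕜 := ℝ)).const_mul (1 / 2 : ℝ)
  have hcutc : ∀ k, Continuous (cutoff Z (u k)) := fun k =>
    (lipschitzWith_cutoff (hu0 k)).continuous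
  have hcs : ∀ k, HasCompactSupport fun x => cutoff Z (u k) x * F x := fun k => hc.mul_left
  have hlip : ∀ k, ∃ C', LipschitzWith C' fun x => cutoff Z (u k) x * F x := fun k =>
    exists_lipschitzWith_of_hasCompactSupport (locallyLipschitz_mul
      (lipschitzWith_cutoff (hu0 k)).locallyLipschitz hF.locallyLipschitz) (hcs k)
  have hform : ∀ k, M.DivergenceFormula i v fun x => cutoff Z (u k) x * F x := fun k => by
    obtain ⟨C', hC'⟩ := hlip k
    refine M.divergenceFormula_of_disjoint_skeleton hd hΩ i v hC' (hcs k) ?_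
    refine Disjoint.symm (Set.disjoint_left.2 fun x hx hxt => ?_)
    have hev : ∀ᶠ y in 𝓝 x, cutoff Z (u k) y * F y = 0 := by
      have h1 : ∀ᶠ y in 𝓝 x, Metric.infDist y Z < u k :=
        (Metric.continuous_infDist_pt Z).continuousAt.eventually_lt_const
          (by simpa only [hZ, Metric.infDist_zero_of_mem hx] using hu0 k)
      filter_upwards [h1] with y hy
      rw [cutoff_eq_zero (hu0 k) hy.le, zero_mul]
    exact notMem_tsupport_iff_eventuallyEq.2 hev hxt
  have hLint : Integrable (fun x => lineDeriv ℝ F x v) := integrable_lineDeriv hF hc v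
  have hcell : ∀ x ∈ M.cell i, Tendsto (fun k => cutoff Z (u k) x) atTop (𝓝 1) := fun x hx =>
    tendsto_cutoff hulim hu0 M.isClosed_skeleton hne (M.notMem_skeleton_of_mem_cell hx)
  have hA : Tendsto (fun k => ∫ x in M.cell i, cutoff Z (u k) x * lineDeriv ℝ F x v) atTop
      (𝓝 (∫ x in M.cell i, lineDeriv ℝ F x v)) := by
    refine tendsto_integral_of_dominated_convergence (fun x => ‖lineDeriv ℝ F x v‖)
      (fun k => (hcutc k).aestronglyMeasurable.mul hLint.aestronglyMeasurable.restrict)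
      hLint.norm.integrableOn (fun k => Eventually.of_forall fun x => ?_) ?_
    · rw [norm_mul]
      exact mul_le_of_le_one_left (norm_nonneg _) (abs_cutoff_le_one x)
    · refine (ae_restrict_iff' (M.isOpen_cell i).measurableSet).2
        (Eventually.of_forall fun x hx => ?_)
      simpa using (hcell x hx).mul_const (lineDeriv ℝ F x v)
  have hBlim : Tendsto (fun k => ∫ x in M.cell i, F x * lineDeriv ℝ (cutoff Z (u k)) x v) atTop
      (𝓝 0) := by
    refine squeeze_zero_norm (fun k => M.norm_integral_mul_lineDeriv_cutoff_le hB hΩ hne hK0 hK i v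
      (hu0 k) (hu1 k)) ?_
    simpa using hulim.const_mul (4 * B * ‖v‖ * K)
  have hsplit : ∀ k, ∫ x in M.cell i, lineDeriv ℝ (fun y => cutoff Z (u k) y * F y) x v =
      (∫ x in M.cell i, cutoff Z (u k) x * lineDeriv ℝ F x v) +
        ∫ x in M.cell i, F x * lineDeriv ℝ (cutoff Z (u k)) x v := by
    intro k
    obtain ⟨C', hC'⟩ := hlip k
    have hae := ae_lineDeriv_mul (lipschitzWith_cutoff (Z := Z) (hu0 k)) hF v
    have hi1 : Integrable fun x => cutoff Z (u k) x * lineDeriv ℝ F x v := by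
      refine hLint.bdd_mul (c := 1) (hcutc k).aestronglyMeasurable
        (Eventually.of_forall fun x => abs_cutoff_le_one x)
    -- By the product rule this is almost everywhere a difference of two functions already known to
    -- be integrable.
    have hi2 : Integrable fun x => F x * lineDeriv ℝ (cutoff Z (u k)) x v := by
      refine ((integrable_lineDeriv hC' (hcs k) v).sub hi1).congr ?_
      filter_upwards [hae] with x hx
      simp only [Pi.sub_apply, hx]
      ring
    rw [← integral_add hi1.integrableOn hi2.integrableOn]
    refine integral_congr_ae (ae_restrict_of_ae ?_)
    filter_upwards [hae] with x hx
    rw [hx]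
    ring
  have hlhs : Tendsto (fun k => ∫ x in M.cell i, lineDeriv ℝ (fun y => cutoff Z (u k) y * F y) x v)
      atTop (𝓝 (∫ x in M.cell i, lineDeriv ℝ F x v)) := by
    simp only [hsplit]
    simpa using hA.add hBlim
  have hrhs : Tendsto (fun k => ∑ e ∈ M.faces i, inner ℝ (M.normal i e) v *
      ∫ x in M.face e, cutoff Z (u k) x * F x ∂surface d) atTop
      (𝓝 (∑ e ∈ M.faces i, inner ℝ (M.normal i e) v * ∫ x in M.face e, F x ∂surface d)) := by
    refine tendsto_finsetSum _ fun e _ => Tendsto.const_mul _ ?_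
    refine tendsto_integral_of_dominated_convergence (fun x => ‖F x‖)
      (fun k => ((hcutc k).mul hF.continuous).aestronglyMeasurable)
      (M.integrableOn_face hd hΩ e hF.continuous.norm)
      (fun k => Eventually.of_forall fun x => ?_) ?_
    · rw [norm_mul]
      exact mul_le_of_le_one_left (norm_nonneg _) (abs_cutoff_le_one x)
    · refine (ae_restrict_iff' (M.isFlatFace e).measurableSet).2
        (Eventually.of_forall fun x hx => ?_)
      simpa using (tendsto_cutoff hulim hu0 M.isClosed_skeleton hne
        (Set.disjoint_left.1 (M.face_disjoint_skeleton e) hx)).mul_const (F x)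
  refine tendsto_nhds_unique hlhs (hrhs.congr fun k => ?_)
  exact (hform k).symm

end PolytopalMesh

/-! ### Polynomial functions -/

section Polynomials

variable {d : ℕ}

@[simp] theorem pval_zero (x : Eucl d) : pval (0 : MvPolynomial (Fin d) ℝ) x = 0 := by simp [pval]

@[simp] theorem pval_add (p q : MvPolynomial (Fin d) ℝ) (x : Eucl d) :
    pval (p + q) x = pval p x + pval q x := by simp [pval]

@[simp] theorem pval_smul (a : ℝ) (p : MvPolynomial (Fin d) ℝ) (x : Eucl d) :
    pval (a • p) x = a * pval p x := by simp [pval, MvPolynomial.smul_eval]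

@[simp] theorem pval_sum {α : Type*} (s : Finset α) (p : α → MvPolynomial (Fin d) ℝ) (x : Eucl d) :
    pval (∑ a ∈ s, p a) x = ∑ a ∈ s, pval (p a) x := by simp [pval]

theorem continuous_pval (p : MvPolynomial (Fin d) ℝ) : Continuous (pval p) :=
  (MvPolynomial.continuous_eval p).comp (PiLp.continuous_ofLp 2 _)

theorem continuous_pvec (q : Fin d → MvPolynomial (Fin d) ℝ) : Continuous (pvec q) :=
  (PiLp.continuous_toLp 2 _).comp (continuous_pi fun m => continuous_pval (q m))

theorem pvec_apply (q : Fin d → MvPolynomial (Fin d) ℝ) (x : Eucl d) (m : Fin d) :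
    pvec q x m = pval (q m) x := rfl

theorem inner_pvec (b x : Eucl d) (q : Fin d → MvPolynomial (Fin d) ℝ) :
    inner ℝ b (pvec q x) = ∑ m, b m * pval (q m) x := by
  simp [PiLp.inner_apply, pvec_apply, mul_comm]

theorem inner_pvec_pvec (x : Eucl d) (q r : Fin d → MvPolynomial (Fin d) ℝ) :
    inner ℝ (pvec q x) (pvec r x) = ∑ m, pval (q m) x * pval (r m) x := by
  simp [PiLp.inner_apply, pvec_apply, mul_comm]

theorem hasFDerivAt_pval (p : MvPolynomial (Fin d) ℝ) (x : Eucl d) :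
    HasFDerivAt (pval p) (innerSL ℝ (pvec (pgrad p) x)) x := by
  induction p using MvPolynomial.induction_on with
  | C a =>
    have h1 : pval (MvPolynomial.C a : MvPolynomial (Fin d) ℝ) = fun _ => a := by
      funext y
      simp [pval]
    have h2 : pvec (pgrad (MvPolynomial.C a : MvPolynomial (Fin d) ℝ)) x = 0 := by
      ext m
      simp [pvec_apply, pgrad]
    rw [h1, h2, map_zero]
    exact hasFDerivAt_const a x
  | add p q hp hq =>
    have h1 : pval (p + q) = fun y => pval p y + pval q y := by
      funext y
      simp
    have h2 : pvec (pgrad (p + q)) x = pvec (pgrad p) x + pvec (pgrad q) x := by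
      ext m
      simp [pvec_apply, pgrad]
    rw [h1, h2, map_add]
    exact hp.add hq
  | mul_X p m hp =>
    have h1 : pval (p * MvPolynomial.X m) = fun y => pval p y * y m := by
      funext y
      simp [pval]
    have h2 : pvec (pgrad (p * MvPolynomial.X m)) x =
        pval p x • EuclideanSpace.single m 1 + x m • pvec (pgrad p) x := by
      ext l
      simp only [pvec_apply, pgrad, Derivation.leibniz, MvPolynomial.pderiv_X, smul_eq_mul,
        PiLp.add_apply, PiLp.smul_apply, pval, map_add, map_mul, MvPolynomial.eval_X]
      congr 1
      by_cases h : l = m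
      · subst h
        simp
      · simp [h, Ne.symm h]
    rw [h1, h2]
    have h3 : HasFDerivAt (fun y : Eucl d => y m) (EuclideanSpace.proj m : Eucl d →L[ℝ] ℝ) x :=
      (EuclideanSpace.proj m : Eucl d →L[ℝ] ℝ).hasFDerivAt
    refine (hp.mul h3).congr_fderiv ?_
    ext w
    simp [EuclideanSpace.inner_single_left]

theorem contDiff_pval (p : MvPolynomial (Fin d) ℝ) : ContDiff ℝ 1 (pval p) := by
  rw [contDiff_one_iff_fderiv]
  refine ⟨fun x => (hasFDerivAt_pval p x).differentiableAt, ?_⟩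
  have h : fderiv ℝ (pval p) = fun x => innerSL ℝ (pvec (pgrad p) x) :=
    funext fun x => (hasFDerivAt_pval p x).fderiv
  rw [h]
  exact (innerSL ℝ).continuous.comp (continuous_pvec _)

theorem gradient_pval (p : MvPolynomial (Fin d) ℝ) (x : Eucl d) :
    gradient (pval p) x = pvec (pgrad p) x := by
  refine HasGradientAt.gradient ?_
  rw [hasGradientAt_iff_hasFDerivAt]
  exact hasFDerivAt_pval p x

/-- An open set contains a box, that is, a product of infinite sets, and a polynomial that vanishes
on such a product is zero. -/
theorem eq_zero_of_pval_eq_zero {p : MvPolynomial (Fin d) ℝ} {U : Set (Eucl d)} (hU : IsOpen U)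
    (hne : U.Nonempty) (h : ∀ x ∈ U, pval p x = 0) : p = 0 := by
  obtain ⟨x, hx⟩ := hne
  obtain ⟨r, hr, hball⟩ := Metric.isOpen_iff.1 (hU.preimage (PiLp.continuous_toLp 2 _))
    (WithLp.ofLp x) (by simpa using hx)
  refine MvPolynomial.funext_set (fun m => Metric.ball (x m) r) (fun m => ?_) fun y hy => ?_
  · rw [Real.ball_eq_Ioo]
    exact Set.Ioo_infinite (by linarith)
  · have hy' : y ∈ Metric.ball (WithLp.ofLp x) r := by
      rw [ball_pi _ hr]
      exact hy
    simpa [pval] using h _ (hball hy')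

/-- The drop in degree is not needed: the residual `β·∇u + cu` only has to stay in the space that
contains `u`. -/
theorem pderiv_mem_Poly {r : ℕ} {p : MvPolynomial (Fin d) ℝ} (hp : p ∈ Poly d r) (m : Fin d) :
    MvPolynomial.pderiv m p ∈ Poly d r := by
  rw [MvPolynomial.mem_restrictTotalDegree] at hp
  rw [p.as_sum, map_sum]
  refine Submodule.sum_mem _ fun s hs => ?_
  rw [MvPolynomial.pderiv_monomial, MvPolynomial.mem_restrictTotalDegree]
  refine (MvPolynomial.totalDegree_monomial_le _ _).trans (le_trans ?_
    ((MvPolynomial.le_totalDegree hs).trans hp))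
  have h : s - Finsupp.single m 1 ≤ s := tsub_le_self
  exact Finsupp.degree_mono h

theorem Poly_mono {r r' : ℕ} (h : r ≤ r') : Poly d r ≤ Poly d r' := fun p hp => by
  rw [MvPolynomial.mem_restrictTotalDegree] at hp ⊢
  exact hp.trans h

/-- The directional derivative of a polynomial. -/
def pdir (b : Eucl d) (p : MvPolynomial (Fin d) ℝ) : MvPolynomial (Fin d) ℝ :=
  ∑ m, b m • MvPolynomial.pderiv m p

theorem pval_pdir (b : Eucl d) (p : MvPolynomial (Fin d) ℝ) (x : Eucl d) :
    pval (pdir b p) x = inner ℝ b (pvec (pgrad p) x) := by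
  simp [pdir, inner_pvec, pgrad]

theorem pdir_mem_Poly {r : ℕ} {p : MvPolynomial (Fin d) ℝ} (hp : p ∈ Poly d r) (b : Eucl d) :
    pdir b p ∈ Poly d r :=
  Submodule.sum_mem _ fun m _ => Submodule.smul_mem _ _ (pderiv_mem_Poly hp m)

end Polynomials

namespace PolytopalMesh

set_option linter.unusedSectionVars false

variable {d : ℕ} {Ω : Set (Eucl d)} {ι κ : Type*} [Fintype ι] [Fintype κ]
  (M : PolytopalMesh d Ω ι κ)

/-! ### Polynomials on elements and faces -/

theorem cell_nonempty (i : ι) : (M.cell i).Nonempty := (M.isConnected_cell i).nonempty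

theorem isBounded_cell (hΩ : Bornology.IsBounded Ω) (i : ι) : Bornology.IsBounded (M.cell i) :=
  hΩ.subset (M.cell_subset i)

theorem integrableOn_of_isBounded {s : Set (Eucl d)} (hs : Bornology.IsBounded s)
    {F : Eucl d → ℝ} (hF : Continuous F) : IntegrableOn F s := by
  obtain ⟨R, hR⟩ := hs.subset_closedBall 0
  exact (hF.continuousOn.integrableOn_compact (isCompact_closedBall (0 : Eucl d) R)).mono_set hR

theorem integrableOn_cell (hΩ : Bornology.IsBounded Ω) (i : ι) {F : Eucl d → ℝ}
    (hF : Continuous F) : IntegrableOn F (M.cell i) :=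
  integrableOn_of_isBounded (M.isBounded_cell hΩ i) hF

/-- A continuous nonnegative function with vanishing integral over an element vanishes there. -/
theorem eq_zero_of_integral_cell_eq_zero (hΩ : Bornology.IsBounded Ω) {i : ι} {F : Eucl d → ℝ}
    (hF : Continuous F) (h0 : ∀ x, 0 ≤ F x) (h : ∫ x in M.cell i, F x = 0) :
    ∀ x ∈ M.cell i, F x = 0 := by
  have hae := (integral_eq_zero_iff_of_nonneg h0 (M.integrableOn_cell hΩ i hF)).1 h
  have := Measure.eqOn_open_of_ae_eq hae (M.isOpen_cell i) hF.continuousOn continuousOn_const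
  exact fun x hx => this hx

/-- A continuous function that vanishes almost everywhere on a face vanishes there. -/
theorem eq_zero_of_ae_face (hd : 0 < d) {e : κ} {F : Eucl d → ℝ}
    (hF : Continuous F) (h : ∀ᵐ x ∂(surface d).restrict (M.face e), F x = 0) :
    ∀ x ∈ M.face e, F x = 0 := by
  intro x hx
  by_contra hne
  obtain ⟨i, hi⟩ := M.exists_mem_faces e
  obtain ⟨U, hU, hUe⟩ := M.face_eq_inter hi hx
  have hV : IsOpen (U ∩ {y | F y ≠ 0}) := hU.inter (isOpen_ne_fun hF continuous_const)
  have hxU : x ∈ U := by rw [hUe] at hx; exact hx.1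
  have hpos := surface_inter_hyperplane_pos hd (M.isOutwardNormal_normal hi).unit hV
    (⟨hxU, hne⟩ : x ∈ U ∩ {y | F y ≠ 0}) rfl
  rw [ae_restrict_iff' (M.isFlatFace e).measurableSet] at h
  refine hpos.ne' (measure_mono_null ?_ h)
  rintro y ⟨⟨hyU, hyF⟩, hyH⟩
  simp only [Set.mem_compl_iff, Set.mem_ofPred_eq]
  intro hy
  exact hyF (hy (by rw [hUe]; exact ⟨hyU, hyH⟩))

theorem eq_zero_of_integral_face_eq_zero (hd : 0 < d) (hΩ : Bornology.IsBounded Ω) {e : κ}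
    {F : Eucl d → ℝ} (hF : Continuous F) (h0 : ∀ x, 0 ≤ F x)
    (h : ∫ x in M.face e, F x ∂surface d = 0) : ∀ x ∈ M.face e, F x = 0 :=
  M.eq_zero_of_ae_face hd hF
    ((integral_eq_zero_iff_of_nonneg h0 (M.integrableOn_face hd hΩ e hF)).1 h)

theorem meshSize_pos (hd : 0 < d) (hΩ : Bornology.IsBounded Ω) (i : ι) : 0 < M.meshSize i := by
  refine Metric.diam_pos ?_ (M.isBounded_cell hΩ i)
  have : Nontrivial (Eucl d) := by
    have : Nonempty (Fin d) := ⟨⟨0, hd⟩⟩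
    infer_instance
  obtain ⟨x, hx⟩ := M.cell_nonempty i
  exact (infinite_of_mem_nhds x ((M.isOpen_cell i).mem_nhds hx)).nontrivial

/-! ### The discrete weak gradient -/

theorem surjective_dual_of_injective {V : Type*} [AddCommGroup V] [Module ℝ V]
    [FiniteDimensional ℝ V] {A : V →ₗ[ℝ] Module.Dual ℝ V} (hA : Function.Injective A) :
    Function.Surjective A :=
  (LinearMap.injective_iff_surjective_of_finrank_eq_finrank
    (Subspace.dual_finrank_eq (K := ℝ) (V := V)).symm).1 hA

/-- The functions on the faces are polynomials (of some degree). -/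
def IsPolyWeakFun (σ : WeakFun d ι κ) : Prop := ∀ e, ∃ p, σ.2 e = (M.face e).indicator (pval p)

theorem IsTest.isPolyWeakFun {M : PolytopalMesh d Ω ι κ} {β : ι → Eucl d} {j : ℕ}
    {σ : WeakFun d ι κ} (h : M.IsTest β j σ) : M.IsPolyWeakFun σ := fun e => by
  obtain ⟨p, -, hp⟩ := h.bdry e
  exact ⟨p, hp⟩

theorem setIntegral_face_indicator (e : κ) (p : MvPolynomial (Fin d) ℝ) (F : Eucl d → ℝ → ℝ) :
    ∫ x in M.face e, F x ((M.face e).indicator (pval p) x) ∂surface d =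
      ∫ x in M.face e, F x (pval p x) ∂surface d :=
  setIntegral_congr_fun (M.isFlatFace e).measurableSet fun x hx => by
    simp only [Set.indicator_of_mem hx]

theorem integrableOn_face_mul (hd : 0 < d) (hΩ : Bornology.IsBounded Ω) {σ : WeakFun d ι κ}
    (hσ : M.IsPolyWeakFun σ) (e : κ) {F : Eucl d → ℝ} (hF : Continuous F) :
    IntegrableOn (fun x => σ.2 e x * F x) (M.face e) (surface d) := by
  obtain ⟨p, hp⟩ := hσ e
  refine (M.integrableOn_face hd hΩ e ((continuous_pval p).mul hF)).congr_fun (fun x hx => ?_)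
    (M.isFlatFace e).measurableSet
  simp only [hp, Set.indicator_of_mem hx, Pi.mul_apply]

/-- The `L²` inner product on vectors of polynomials of degree at most `r` on an element. -/
def gramForm (hΩ : Bornology.IsBounded Ω) (r : ℕ) (i : ι) :
    (Fin d → Poly d r) →ₗ[ℝ] Module.Dual ℝ (Fin d → Poly d r) :=
  LinearMap.mk₂ ℝ
    (fun q ψ => ∫ x in M.cell i, ∑ m, pval (q m : MvPolynomial (Fin d) ℝ) x *
      pval (ψ m : MvPolynomial (Fin d) ℝ) x)
    (fun q q' ψ => by
      rw [← integral_add]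
      · simp [add_mul, Finset.sum_add_distrib]
      all_goals
        refine M.integrableOn_cell hΩ i (continuous_finsetSum _ fun m _ => ?_)
        exact (continuous_pval _).mul (continuous_pval _))
    (fun a q ψ => by
      rw [smul_eq_mul, ← integral_const_mul]
      simp [Finset.mul_sum, mul_assoc])
    (fun q ψ ψ' => by
      rw [← integral_add]
      · simp [mul_add, Finset.sum_add_distrib]
      all_goals
        refine M.integrableOn_cell hΩ i (continuous_finsetSum _ fun m _ => ?_)
        exact (continuous_pval _).mul (continuous_pval _))
    (fun a q ψ => by
      rw [smul_eq_mul, ← integral_const_mul]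
      simp [Finset.mul_sum, mul_left_comm])

/-- Pairing `q` with itself gives an integral of squares, so the form is positive definite. -/
theorem gramForm_injective (hΩ : Bornology.IsBounded Ω) (r : ℕ) (i : ι) :
    Function.Injective (M.gramForm hΩ r i) := by
  rw [injective_iff_map_eq_zero]
  intro q hq
  have h : ∫ x in M.cell i, ∑ m, pval (q m : MvPolynomial (Fin d) ℝ) x *
      pval (q m : MvPolynomial (Fin d) ℝ) x = 0 := by
    simpa [gramForm] using LinearMap.congr_fun hq q
  have h2 := M.eq_zero_of_integral_cell_eq_zero hΩ (continuous_finsetSum _ fun m _ =>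
    (continuous_pval _).mul (continuous_pval _)) (fun x => Finset.sum_nonneg fun m _ =>
      mul_self_nonneg _) h
  funext m
  refine Subtype.ext (eq_zero_of_pval_eq_zero (M.isOpen_cell i) (M.cell_nonempty i)
    fun x hx => ?_)
  exact mul_self_eq_zero.1
    ((Finset.sum_eq_zero_iff_of_nonneg fun m _ => mul_self_nonneg _).1 (h2 x hx) m
      (Finset.mem_univ m))

theorem gramForm_surjective (hΩ : Bornology.IsBounded Ω) (r : ℕ) (i : ι) :
    Function.Surjective (M.gramForm hΩ r i) :=
  surjective_dual_of_injective (M.gramForm_injective hΩ r i)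

/-- The right-hand side of the defining identity is a linear functional of `ψ`, and the
nondegenerate `gramForm` represents it. Polynomial face values make the face integrals converge,
hence additive in `ψ`. -/
theorem exists_isDiscreteWeakGrad (hd : 0 < d) (hΩ : Bornology.IsBounded Ω) (r : ℕ) (i : ι)
    {σ : WeakFun d ι κ} (hσ : M.IsPolyWeakFun σ) : ∃ q, M.IsDiscreteWeakGrad r i σ q := by
  have hcd : ∀ ψ : Fin d → MvPolynomial (Fin d) ℝ, Continuous fun x =>
      pval (σ.1 i) x * pval (pdiv ψ) x := fun ψ => (continuous_pval _).mul (continuous_pval _)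
  have hcn : ∀ (ψ : Fin d → MvPolynomial (Fin d) ℝ) (e : κ), Continuous fun x =>
      inner ℝ (pvec ψ x) (M.normal i e) := fun ψ e =>
    (continuous_pvec ψ).inner continuous_const
  have hpadd : ∀ (ψ φ : Fin d → MvPolynomial (Fin d) ℝ) x,
      pvec (ψ + φ) x = pvec ψ x + pvec φ x := fun ψ φ x => by
    ext m
    simp [pvec_apply]
  have hpsmul : ∀ (a : ℝ) (ψ : Fin d → MvPolynomial (Fin d) ℝ) x,
      pvec (a • ψ) x = a • pvec ψ x := fun a ψ x => by
    ext m
    simp [pvec_apply]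
  let ℓ : (Fin d → MvPolynomial (Fin d) ℝ) →ₗ[ℝ] ℝ :=
    { toFun := fun ψ => - (∫ x in M.cell i, pval (σ.1 i) x * pval (pdiv ψ) x) +
        ∑ e ∈ M.faces i, ∫ x in M.face e,
          σ.2 e x * inner ℝ (pvec ψ x) (M.normal i e) ∂(surface d)
      map_add' := fun ψ φ => by
        have h1 : ∀ x, pval (σ.1 i) x * pval (pdiv (ψ + φ)) x =
            pval (σ.1 i) x * pval (pdiv ψ) x + pval (σ.1 i) x * pval (pdiv φ) x := fun x => by
          simp [pdiv, Finset.sum_add_distrib, mul_add]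
        have h2 : ∀ e x, σ.2 e x * inner ℝ (pvec (ψ + φ) x) (M.normal i e) =
            σ.2 e x * inner ℝ (pvec ψ x) (M.normal i e) +
            σ.2 e x * inner ℝ (pvec φ x) (M.normal i e) := fun e x => by
          rw [hpadd, inner_add_left, mul_add]
        simp only [h1, h2]
        rw [integral_add (M.integrableOn_cell hΩ i (hcd ψ)) (M.integrableOn_cell hΩ i (hcd φ))]
        simp only [fun e => integral_add (M.integrableOn_face_mul hd hΩ hσ e (hcn ψ e))
          (M.integrableOn_face_mul hd hΩ hσ e (hcn φ e)), Finset.sum_add_distrib]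
        ring
      map_smul' := fun a ψ => by
        have h1 : ∀ x, pval (σ.1 i) x * pval (pdiv (a • ψ)) x =
            a * (pval (σ.1 i) x * pval (pdiv ψ) x) := fun x => by
          have h3 : pdiv (a • ψ) = a • pdiv ψ := by simp [pdiv, Finset.smul_sum]
          rw [h3, pval_smul]
          ring
        have h2 : ∀ e x, σ.2 e x * inner ℝ (pvec (a • ψ) x) (M.normal i e) =
            a * (σ.2 e x * inner ℝ (pvec ψ x) (M.normal i e)) := fun e x => by
          rw [hpsmul, real_inner_smul_left]
          ring
        simp only [h1, h2, integral_const_mul, ← Finset.mul_sum, RingHom.id_apply, smul_eq_mul]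
        ring }
  let incl : (Fin d → Poly d r) →ₗ[ℝ] (Fin d → MvPolynomial (Fin d) ℝ) :=
    LinearMap.pi fun m => (Poly d r).subtype.comp (LinearMap.proj m)
  obtain ⟨q, hq⟩ := M.gramForm_surjective hΩ r i (ℓ.comp incl)
  refine ⟨fun m => q m, fun m => (q m).2, fun ψ hψ => ?_⟩
  have := LinearMap.congr_fun hq fun m => ⟨ψ m, hψ m⟩
  simp only [inner_pvec_pvec]
  exact this

theorem isDiscreteWeakGrad_weakGrad (hd : 0 < d) (hΩ : Bornology.IsBounded Ω) (r : ℕ) (i : ι)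
    {σ : WeakFun d ι κ} (hσ : M.IsPolyWeakFun σ) :
    M.IsDiscreteWeakGrad r i σ (M.weakGrad r i σ) := by
  have h := M.exists_isDiscreteWeakGrad hd hΩ r i hσ
  rw [weakGrad, dif_pos h]
  exact h.choose_spec

/-! ### The bilinear forms of the scheme -/

/-- Since `β` is constant on an element, `β v` is an admissible `ψ` in the definition of the weak
gradient. The resulting expression no longer contains the chosen gradient, which makes linearity in
`σ` visible. -/
theorem bForm_eq (hd : 0 < d) (hΩ : Bornology.IsBounded Ω) {k : ℕ} (β : ι → Eucl d) (c : ι → ℝ)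
    {v : CellPoly d ι} (hv : M.IsTrial (k - 1) v) {σ : WeakFun d ι κ} (hσ : M.IsPolyWeakFun σ) :
    M.bForm k β c v σ = ∑ i, (∑ e ∈ M.faces i, inner ℝ (M.normal i e) (β i) *
      (∫ x in M.face e, σ.2 e x * pval (v i) x ∂surface d) -
        ∫ x in M.cell i, pval (σ.1 i) x * pval (pdir (β i) (v i) + c i • v i) x) := by
  refine Finset.sum_congr rfl fun i _ => ?_
  have hw := M.isDiscreteWeakGrad_weakGrad hd hΩ (k - 1) i hσ
  have h := hw.eq (fun m => β i m • v i) fun m => Submodule.smul_mem _ _ (hv i)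
  have h1 : ∀ x, pvec (fun m => β i m • v i) x = pval (v i) x • β i := fun x => by
    ext m
    simp [pvec_apply, mul_comm]
  have h2 : pdiv (fun m => β i m • v i) = pdir (β i) (v i) := by simp [pdiv, pdir]
  have hc1 : Continuous fun x => inner ℝ (pvec (M.weakGrad (k - 1) i σ) x) (pval (v i) x • β i) :=
    (continuous_pvec _).inner ((continuous_pval _).smul continuous_const)
  have hc2 : Continuous fun x => pval (σ.1 i) x * (c i * pval (v i) x) :=
    (continuous_pval _).mul (continuous_const.mul (continuous_pval _))
  have hc3 : Continuous fun x => pval (σ.1 i) x * pval (pdir (β i) (v i)) x :=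
    (continuous_pval _).mul (continuous_pval _)
  have h3 : ∀ x, pval (v i) x * (inner ℝ (β i) (pvec (M.weakGrad (k - 1) i σ) x) -
      c i * pval (σ.1 i) x) = inner ℝ (pvec (M.weakGrad (k - 1) i σ) x) (pval (v i) x • β i) -
        pval (σ.1 i) x * (c i * pval (v i) x) := fun x => by
    rw [real_inner_smul_right, real_inner_comm]
    ring
  simp only [h1, h2] at h
  simp only [h3, pval_add, pval_smul, mul_add]
  rw [integral_sub (M.integrableOn_cell hΩ i hc1) (M.integrableOn_cell hΩ i hc2), h,
    integral_add (M.integrableOn_cell hΩ i hc3) (M.integrableOn_cell hΩ i hc2)]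
  have h4 : ∀ e, ∫ x in M.face e, σ.2 e x * inner ℝ (pval (v i) x • β i) (M.normal i e) ∂surface d =
      inner ℝ (M.normal i e) (β i) * ∫ x in M.face e, σ.2 e x * pval (v i) x ∂surface d := fun e => by
    rw [← integral_const_mul]
    congr 1
    funext x
    rw [real_inner_smul_left, real_inner_comm]
    ring
  simp only [h4]
  ring

theorem integral_cell_add (hΩ : Bornology.IsBounded Ω) (i : ι) {F G H K : Eucl d → ℝ}
    (hF : Continuous F) (hG : Continuous G) (hH : Continuous H) (hK : Continuous K) :
    ∫ x in M.cell i, (F x * G x + H x * K x) =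
      (∫ x in M.cell i, F x * G x) + ∫ x in M.cell i, H x * K x :=
  integral_add (M.integrableOn_cell hΩ i (hF.mul hG)) (M.integrableOn_cell hΩ i (hH.mul hK))

theorem smul_indicator_pval (s : Set (Eucl d)) (a : ℝ) (p : MvPolynomial (Fin d) ℝ) :
    a • s.indicator (pval p) = s.indicator (pval (a • p)) := by
  funext x
  by_cases hx : x ∈ s <;> simp [hx]

theorem pdir_add (b : Eucl d) (p q : MvPolynomial (Fin d) ℝ) :
    pdir b (p + q) = pdir b p + pdir b q := by simp [pdir, Finset.sum_add_distrib]

/-! ### Linear structure of the discrete spaces and bilinearity of the forms -/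

variable {M}

theorem IsPolyWeakFun.add {σ σ' : WeakFun d ι κ} (h : M.IsPolyWeakFun σ)
    (h' : M.IsPolyWeakFun σ') : M.IsPolyWeakFun (σ + σ') := fun e => by
  obtain ⟨p, hp⟩ := h e
  obtain ⟨q, hq⟩ := h' e
  refine ⟨p + q, ?_⟩
  have : pval (p + q) = pval p + pval q := funext fun x => pval_add p q x
  rw [Prod.snd_add, Pi.add_apply, hp, hq, this, Set.indicator_add']

theorem IsPolyWeakFun.smul {σ : WeakFun d ι κ} (h : M.IsPolyWeakFun σ) (a : ℝ) :
    M.IsPolyWeakFun (a • σ) := fun e => by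
  obtain ⟨p, hp⟩ := h e
  refine ⟨a • p, ?_⟩
  rw [Prod.smul_snd, Pi.smul_apply, hp, smul_indicator_pval]

theorem IsTrial.add {r : ℕ} {v v' : CellPoly d ι} (h : M.IsTrial r v) (h' : M.IsTrial r v') :
    M.IsTrial r (v + v') := fun i => Submodule.add_mem _ (h i) (h' i)

theorem IsTrial.smul {r : ℕ} {v : CellPoly d ι} (h : M.IsTrial r v) (a : ℝ) :
    M.IsTrial r (a • v) := fun i => Submodule.smul_mem _ a (h i)

theorem IsTest.add {β : ι → Eucl d} {j : ℕ} {σ σ' : WeakFun d ι κ} (h : M.IsTest β j σ)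
    (h' : M.IsTest β j σ') : M.IsTest β j (σ + σ') where
  interior i := Submodule.add_mem _ (h.interior i) (h'.interior i)
  bdry e := by
    obtain ⟨p, hpm, hp⟩ := h.bdry e
    obtain ⟨q, hqm, hq⟩ := h'.bdry e
    refine ⟨p + q, Submodule.add_mem _ hpm hqm, ?_⟩
    have : pval (p + q) = pval p + pval q := funext fun x => pval_add p q x
    rw [Prod.snd_add, Pi.add_apply, hp, hq, this, Set.indicator_add']
  outflow e he := by rw [Prod.snd_add, Pi.add_apply, h.outflow e he, h'.outflow e he, add_zero]

theorem IsTest.smul {β : ι → Eucl d} {j : ℕ} {σ : WeakFun d ι κ} (h : M.IsTest β j σ) (a : ℝ) :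
    M.IsTest β j (a • σ) where
  interior i := Submodule.smul_mem _ a (h.interior i)
  bdry e := by
    obtain ⟨p, hpm, hp⟩ := h.bdry e
    refine ⟨a • p, Submodule.smul_mem _ a hpm, ?_⟩
    rw [Prod.smul_snd, Pi.smul_apply, hp, smul_indicator_pval]
  outflow e he := by rw [Prod.smul_snd, Pi.smul_apply, h.outflow e he, smul_zero]

theorem isTest_zero {β : ι → Eucl d} {j : ℕ} : M.IsTest β j 0 where
  interior i := Submodule.zero_mem _
  bdry e := ⟨0, Submodule.zero_mem _, by
    have : pval (0 : MvPolynomial (Fin d) ℝ) = fun _ => 0 := funext fun x => pval_zero x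
    rw [this, Set.indicator_zero]
    rfl⟩
  outflow e _ := rfl

theorem isTrial_zero {r : ℕ} : M.IsTrial r 0 := fun _ => Submodule.zero_mem _

variable (M)

theorem bForm_add_left (hd : 0 < d) (hΩ : Bornology.IsBounded Ω) {k : ℕ} (β : ι → Eucl d)
    (c : ι → ℝ) {v v' : CellPoly d ι} (hv : M.IsTrial (k - 1) v) (hv' : M.IsTrial (k - 1) v')
    {σ : WeakFun d ι κ} (hσ : M.IsPolyWeakFun σ) :
    M.bForm k β c (v + v') σ = M.bForm k β c v σ + M.bForm k β c v' σ := by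
  rw [M.bForm_eq hd hΩ β c (hv.add hv') hσ, M.bForm_eq hd hΩ β c hv hσ,
    M.bForm_eq hd hΩ β c hv' hσ, ← Finset.sum_add_distrib]
  refine Finset.sum_congr rfl fun i _ => ?_
  have h1 : ∀ x, pval (σ.1 i) x * pval (pdir (β i) ((v + v') i) + c i • (v + v') i) x =
      pval (σ.1 i) x * pval (pdir (β i) (v i) + c i • v i) x +
      pval (σ.1 i) x * pval (pdir (β i) (v' i) + c i • v' i) x := fun x => by
    simp only [Pi.add_apply, pdir_add, smul_add, pval_add]
    ring
  have h2 : ∀ e, ∫ x in M.face e, σ.2 e x * pval ((v + v') i) x ∂surface d =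
      (∫ x in M.face e, σ.2 e x * pval (v i) x ∂surface d) +
        ∫ x in M.face e, σ.2 e x * pval (v' i) x ∂surface d := fun e => by
    rw [← integral_add (M.integrableOn_face_mul hd hΩ hσ e (continuous_pval _))
      (M.integrableOn_face_mul hd hΩ hσ e (continuous_pval _))]
    simp [mul_add]
  simp only [h1, h2, mul_add, Finset.sum_add_distrib]
  rw [M.integral_cell_add hΩ i (continuous_pval _) (continuous_pval _) (continuous_pval _)
    (continuous_pval _)]
  ring

theorem bForm_smul_left (k : ℕ) (β : ι → Eucl d) (c : ι → ℝ) (a : ℝ) (v : CellPoly d ι)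
    (σ : WeakFun d ι κ) : M.bForm k β c (a • v) σ = a * M.bForm k β c v σ := by
  simp only [bForm, Finset.mul_sum, ← integral_const_mul, Pi.smul_apply, pval_smul, mul_assoc]

theorem bForm_add_right (hd : 0 < d) (hΩ : Bornology.IsBounded Ω) {k : ℕ} (β : ι → Eucl d)
    (c : ι → ℝ) {v : CellPoly d ι} (hv : M.IsTrial (k - 1) v)
    {σ σ' : WeakFun d ι κ} (hσ : M.IsPolyWeakFun σ) (hσ' : M.IsPolyWeakFun σ') :
    M.bForm k β c v (σ + σ') = M.bForm k β c v σ + M.bForm k β c v σ' := by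
  rw [M.bForm_eq hd hΩ β c hv (hσ.add hσ'), M.bForm_eq hd hΩ β c hv hσ,
    M.bForm_eq hd hΩ β c hv hσ', ← Finset.sum_add_distrib]
  refine Finset.sum_congr rfl fun i _ => ?_
  have h2 : ∀ e, ∫ x in M.face e, (σ + σ').2 e x * pval (v i) x ∂surface d =
      (∫ x in M.face e, σ.2 e x * pval (v i) x ∂surface d) +
        ∫ x in M.face e, σ'.2 e x * pval (v i) x ∂surface d := fun e => by
    rw [← integral_add (M.integrableOn_face_mul hd hΩ hσ e (continuous_pval _))
      (M.integrableOn_face_mul hd hΩ hσ' e (continuous_pval _))]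
    simp [add_mul]
  simp only [h2, Prod.fst_add, Pi.add_apply, pval_add (σ.1 i), add_mul, mul_add,
    Finset.sum_add_distrib]
  rw [M.integral_cell_add hΩ i (continuous_pval _) (continuous_pval _) (continuous_pval _)
    (continuous_pval _)]
  ring

theorem bForm_smul_right (hd : 0 < d) (hΩ : Bornology.IsBounded Ω) {k : ℕ} (β : ι → Eucl d)
    (c : ι → ℝ) {v : CellPoly d ι} (hv : M.IsTrial (k - 1) v)
    {σ : WeakFun d ι κ} (hσ : M.IsPolyWeakFun σ) (a : ℝ) :
    M.bForm k β c v (a • σ) = a * M.bForm k β c v σ := by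
  rw [M.bForm_eq hd hΩ β c hv (hσ.smul a), M.bForm_eq hd hΩ β c hv hσ, Finset.mul_sum]
  refine Finset.sum_congr rfl fun i _ => ?_
  simp only [Prod.smul_fst, Prod.smul_snd, Pi.smul_apply, pval_smul, smul_eq_mul, mul_assoc,
    integral_const_mul, mul_sub, Finset.mul_sum]
  simp only [mul_left_comm]

theorem continuous_adjointOp (β : ι → Eucl d) (c : ι → ℝ) (σ : WeakFun d ι κ) (i : ι) :
    Continuous (adjointOp β c σ i) :=
  (continuous_const.inner (continuous_pvec _)).sub (continuous_const.mul (continuous_pval _))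

theorem adjointOp_add (β : ι → Eucl d) (c : ι → ℝ) (σ σ' : WeakFun d ι κ) (i : ι) (x : Eucl d) :
    adjointOp β c (σ + σ') i x = adjointOp β c σ i x + adjointOp β c σ' i x := by
  simp only [adjointOp, inner_pvec, pgrad, Prod.fst_add, Pi.add_apply, map_add, pval_add, mul_add,
    Finset.sum_add_distrib]
  ring

theorem adjointOp_smul (β : ι → Eucl d) (c : ι → ℝ) (a : ℝ) (σ : WeakFun d ι κ) (i : ι)
    (x : Eucl d) : adjointOp β c (a • σ) i x = a * adjointOp β c σ i x := by
  simp only [adjointOp, inner_pvec, pgrad, Prod.smul_fst, Pi.smul_apply, Derivation.map_smul,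
    pval_smul, mul_sub, Finset.mul_sum]
  simp only [mul_left_comm]

theorem integrableOn_face_stabilizer (hd : 0 < d) (hΩ : Bornology.IsBounded Ω)
    {ρ σ : WeakFun d ι κ} (hρ : M.IsPolyWeakFun ρ) (hσ : M.IsPolyWeakFun σ) (i : ι) (e : κ) :
    IntegrableOn (fun x => (pval (ρ.1 i) x - ρ.2 e x) * (pval (σ.1 i) x - σ.2 e x)) (M.face e)
      (surface d) := by
  obtain ⟨p, hp⟩ := hρ e
  obtain ⟨q, hq⟩ := hσ e
  refine (M.integrableOn_face hd hΩ e (((continuous_pval (ρ.1 i)).sub (continuous_pval p)).mul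
    ((continuous_pval (σ.1 i)).sub (continuous_pval q)))).congr_fun (fun x hx => ?_)
    (M.isFlatFace e).measurableSet
  simp only [hp, hq, Set.indicator_of_mem hx, Pi.mul_apply, Pi.sub_apply]

theorem stabilizer_comm (β : ι → Eucl d) (c : ι → ℝ) (τ : ℝ) (ρ σ : WeakFun d ι κ) :
    M.stabilizer β c τ ρ σ = M.stabilizer β c τ σ ρ := by
  simp only [stabilizer, mul_comm]

theorem stabilizer_add_right (hd : 0 < d) (hΩ : Bornology.IsBounded Ω) (β : ι → Eucl d)
    (c : ι → ℝ) (τ : ℝ) {ρ σ σ' : WeakFun d ι κ} (hρ : M.IsPolyWeakFun ρ)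
    (hσ : M.IsPolyWeakFun σ) (hσ' : M.IsPolyWeakFun σ') :
    M.stabilizer β c τ ρ (σ + σ') = M.stabilizer β c τ ρ σ + M.stabilizer β c τ ρ σ' := by
  rw [stabilizer, stabilizer, stabilizer, ← Finset.sum_add_distrib]
  refine Finset.sum_congr rfl fun i _ => ?_
  have h1 : ∀ e, ∫ x in M.face e, (pval (ρ.1 i) x - ρ.2 e x) *
      (pval ((σ + σ').1 i) x - (σ + σ').2 e x) ∂surface d =
      (∫ x in M.face e, (pval (ρ.1 i) x - ρ.2 e x) * (pval (σ.1 i) x - σ.2 e x) ∂surface d) +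
      ∫ x in M.face e, (pval (ρ.1 i) x - ρ.2 e x) * (pval (σ'.1 i) x - σ'.2 e x) ∂surface d :=
    fun e => by
      rw [← integral_add (M.integrableOn_face_stabilizer hd hΩ hρ hσ i e)
        (M.integrableOn_face_stabilizer hd hΩ hρ hσ' i e)]
      congr 1
      funext x
      simp only [Prod.fst_add, Prod.snd_add, Pi.add_apply, pval_add]
      ring
  simp only [h1, adjointOp_add, mul_add, Finset.sum_add_distrib]
  rw [M.integral_cell_add hΩ i (continuous_adjointOp ..) (continuous_adjointOp ..)
    (continuous_adjointOp ..) (continuous_adjointOp ..)]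
  ring

theorem stabilizer_smul_right (β : ι → Eucl d) (c : ι → ℝ) (τ a : ℝ) (ρ σ : WeakFun d ι κ) :
    M.stabilizer β c τ ρ (a • σ) = a * M.stabilizer β c τ ρ σ := by
  rw [stabilizer, stabilizer, Finset.mul_sum]
  refine Finset.sum_congr rfl fun i _ => ?_
  have h1 : ∀ e, ∫ x in M.face e, (pval (ρ.1 i) x - ρ.2 e x) *
      (pval ((a • σ).1 i) x - (a • σ).2 e x) ∂surface d =
      a * ∫ x in M.face e, (pval (ρ.1 i) x - ρ.2 e x) * (pval (σ.1 i) x - σ.2 e x) ∂surface d :=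
    fun e => by
      rw [← integral_const_mul]
      congr 1
      funext x
      simp only [Prod.smul_fst, Prod.smul_snd, Pi.smul_apply, pval_smul, smul_eq_mul]
      ring
  have h2 : ∀ x, adjointOp β c ρ i x * adjointOp β c (a • σ) i x =
      a * (adjointOp β c ρ i x * adjointOp β c σ i x) := fun x => by
    rw [adjointOp_smul]
    ring
  simp only [h1, h2, integral_const_mul, ← Finset.mul_sum]
  ring

/-! ### Normal flux on boundary faces and the load functional -/

/-- The sum of `β · n` over the elements adjacent to a face. -/
def faceFlux [DecidableEq κ] (β : ι → Eucl d) (e : κ) : ℝ :=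
  ∑ i with e ∈ M.faces i, inner ℝ (β i) (M.normal i e)

/-- Open faces are pairwise disjoint, so a single face indicator survives. In particular `β · n` is
constant along a boundary face. -/
theorem normalFlux_of_mem_face [DecidableEq κ] (β : ι → Eucl d) {e : κ}
    (he : M.face e ⊆ frontier Ω) {x : Eucl d} (hx : x ∈ M.face e) :
    M.normalFlux β x = M.faceFlux β e := by
  rw [normalFlux, faceFlux, Finset.sum_filter]
  refine Finset.sum_congr rfl fun i _ => ?_
  split_ifs with hi
  · rw [Finset.sum_eq_single e]
    · rw [if_pos he, Set.indicator_of_mem hx]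
    · intro e' _ hne
      have : x ∉ M.face e' := fun h =>
        hne (M.eq_of_mem_face_of_mem_closure hx (subset_closure h)).symm
      rw [Set.indicator_of_notMem this, ite_self]
    · exact fun h => (h hi).elim
  · refine Finset.sum_eq_zero fun e' he' => ?_
    have : x ∉ M.face e' := fun h => by
      rw [M.eq_of_mem_face_of_mem_closure hx (subset_closure h)] at hi
      exact hi he'
    rw [Set.indicator_of_notMem this, ite_self]

theorem integrableOn_face_load (hd : 0 < d) (hΩ : Bornology.IsBounded Ω) (β : ι → Eucl d)
    {g : Eucl d → ℝ} (hg : MemLp g 2 ((surface d).restrict (M.inflow β))) {σ : WeakFun d ι κ}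
    (hσ : M.IsPolyWeakFun σ) {e : κ} (he : M.face e ⊆ M.inflow β) :
    IntegrableOn (fun x => σ.2 e x * (M.normalFlux β x * g x)) (M.face e) (surface d) := by
  classical
  have hfin := M.isFiniteMeasure_face hd hΩ e
  obtain ⟨p, hp⟩ := hσ e
  have hgi : IntegrableOn g (M.face e) (surface d) :=
    (hg.mono_measure (Measure.restrict_mono he le_rfl)).integrable (by norm_num)
  have hcpt : IsCompact (closure (M.face e)) :=
    Metric.isCompact_of_isClosed_isBounded isClosed_closure
      (hΩ.closure.subset (M.closure_face_subset_closure e))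
  obtain ⟨B, hB⟩ := hcpt.exists_bound_of_continuousOn (continuous_pval p).continuousOn
  have h1 : IntegrableOn (fun x => pval p x * (M.faceFlux β e * g x)) (M.face e) (surface d) := by
    refine Integrable.bdd_mul (hgi.const_mul _) (continuous_pval p).aestronglyMeasurable (c := B) ?_
    exact (ae_restrict_iff' (M.isFlatFace e).measurableSet).2
      (Eventually.of_forall fun x hx => hB x (subset_closure hx))
  refine h1.congr_fun (fun x hx => ?_) (M.isFlatFace e).measurableSet
  simp only [hp, Set.indicator_of_mem hx]
  rw [M.normalFlux_of_mem_face β (fun y hy => (he hy).1) hx]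

theorem integrableOn_cell_mul (hΩ : Bornology.IsBounded Ω) {f : Eucl d → ℝ}
    (hf : MemLp f 2 (volume.restrict Ω)) (i : ι) (p : MvPolynomial (Fin d) ℝ) :
    IntegrableOn (fun x => f x * pval p x) (M.cell i) := by
  have hcpt : IsCompact (closure (M.cell i)) :=
    Metric.isCompact_of_isClosed_isBounded isClosed_closure (M.isBounded_cell hΩ i).closure
  obtain ⟨B, hB⟩ := hcpt.exists_bound_of_continuousOn (continuous_pval p).continuousOn
  have : IsFiniteMeasure (volume.restrict Ω) := ⟨by
    rw [Measure.restrict_apply_univ]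
    exact hΩ.measure_lt_top⟩
  have hfi : IntegrableOn f (M.cell i) :=
    IntegrableOn.mono_set (hf.integrable (by norm_num)) (M.cell_subset i)
  refine Integrable.mul_bdd (c := B) hfi (continuous_pval p).aestronglyMeasurable ?_
  exact (ae_restrict_iff' (M.isOpen_cell i).measurableSet).2
    (Eventually.of_forall fun x hx => hB x (subset_closure hx))

theorem load_add (hd : 0 < d) (hΩ : Bornology.IsBounded Ω) (β : ι → Eucl d) {f g : Eucl d → ℝ}
    (hf : MemLp f 2 (volume.restrict Ω)) (hg : MemLp g 2 ((surface d).restrict (M.inflow β)))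
    {σ σ' : WeakFun d ι κ} (hσ : M.IsPolyWeakFun σ) (hσ' : M.IsPolyWeakFun σ') :
    M.load β f g (σ + σ') = M.load β f g σ + M.load β f g σ' := by
  classical
  simp only [load]
  have h1 : ∀ i, ∫ x in M.cell i, f x * pval ((σ + σ').1 i) x =
      (∫ x in M.cell i, f x * pval (σ.1 i) x) + ∫ x in M.cell i, f x * pval (σ'.1 i) x :=
    fun i => by
      rw [← integral_add (M.integrableOn_cell_mul hΩ hf i _) (M.integrableOn_cell_mul hΩ hf i _)]
      simp [mul_add]
  have h2 : ∑ e with M.face e ⊆ M.inflow β, ∫ x in M.face e,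
      (σ + σ').2 e x * (M.normalFlux β x * g x) ∂surface d =
      (∑ e with M.face e ⊆ M.inflow β, ∫ x in M.face e,
        σ.2 e x * (M.normalFlux β x * g x) ∂surface d) +
      ∑ e with M.face e ⊆ M.inflow β, ∫ x in M.face e,
        σ'.2 e x * (M.normalFlux β x * g x) ∂surface d := by
    rw [← Finset.sum_add_distrib]
    refine Finset.sum_congr rfl fun e he => ?_
    have he' := (Finset.mem_filter.1 he).2
    rw [← integral_add (M.integrableOn_face_load hd hΩ β hg hσ he')
      (M.integrableOn_face_load hd hΩ β hg hσ' he')]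
    simp [add_mul]
  simp only [h1, Finset.sum_add_distrib]
  rw [h2]
  ring

theorem load_smul (β : ι → Eucl d) (f g : Eucl d → ℝ) (a : ℝ) (σ : WeakFun d ι κ) :
    M.load β f g (a • σ) = a * M.load β f g σ := by
  simp only [load, mul_sub, Finset.mul_sum, ← integral_const_mul, Prod.smul_fst, Prod.smul_snd,
    Pi.smul_apply, pval_smul, smul_eq_mul, mul_assoc]
  simp only [mul_left_comm a]

/-! ### The scheme as a square linear system -/

/-- The discrete space `M_{r,h} × W_{j,h}^{0,Γ₊}`. -/
def discreteSpace (r j : ℕ) (β : ι → Eucl d) : Submodule ℝ (CellPoly d ι × WeakFun d ι κ) where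
  carrier := {p | M.IsTrial r p.1 ∧ M.IsTest β j p.2}
  add_mem' hp hq := ⟨hp.1.add hq.1, hp.2.add hq.2⟩
  zero_mem' := ⟨isTrial_zero, isTest_zero⟩
  smul_mem' a _ hp := ⟨hp.1.smul a, hp.2.smul a⟩

/-- The ambient product is infinite dimensional, but every discrete pair is the image of finitely
many polynomials of bounded degree; a face polynomial need not be unique, so only inclusion in a
range is used. -/
theorem finiteDimensional_discreteSpace (r j : ℕ) (β : ι → Eucl d) :
    FiniteDimensional ℝ (M.discreteSpace r j β) := by
  let E : (ι → Poly d r) × (ι → Poly d j) × (κ → Poly d j) →ₗ[ℝ]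
      CellPoly d ι × WeakFun d ι κ :=
    { toFun := fun p => (fun i => p.1 i, fun i => p.2.1 i,
        fun e => (M.face e).indicator (pval (p.2.2 e : MvPolynomial (Fin d) ℝ)))
      map_add' := fun p q => by
        refine Prod.ext rfl (Prod.ext rfl (funext fun e => funext fun x => ?_))
        by_cases hx : x ∈ M.face e <;> simp [hx]
      map_smul' := fun a p => by
        refine Prod.ext rfl (Prod.ext rfl (funext fun e => funext fun x => ?_))
        by_cases hx : x ∈ M.face e <;> simp [hx] }
  refine Submodule.finiteDimensional_of_le (S₂ := LinearMap.range E) ?_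
  rintro ⟨u, σ₀, σb⟩ ⟨hu, hσ⟩
  choose p hp hpσ using hσ.bdry
  exact ⟨(fun i => ⟨u i, hu i⟩, fun i => ⟨σ₀ i, hσ.interior i⟩, fun e => ⟨p e, hp e⟩),
    Prod.ext rfl (Prod.ext rfl (funext fun e => (hpσ e).symm))⟩

/-- The symmetric bilinear form of the scheme. -/
def schemeForm (hd : 0 < d) (hΩ : Bornology.IsBounded Ω) (k j : ℕ) (τ : ℝ) (β : ι → Eucl d)
    (c : ι → ℝ) :
    M.discreteSpace (k - 1) j β →ₗ[ℝ] Module.Dual ℝ (M.discreteSpace (k - 1) j β) :=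
  LinearMap.mk₂ ℝ
    (fun p q => M.stabilizer β c τ p.1.2 q.1.2 + M.bForm k β c p.1.1 q.1.2 +
      M.bForm k β c q.1.1 p.1.2)
    (fun p p' q => by
      have hq := q.2.2.isPolyWeakFun
      have hp := p.2.2.isPolyWeakFun
      have hp' := p'.2.2.isPolyWeakFun
      simp only [Submodule.coe_add, Prod.fst_add, Prod.snd_add]
      rw [M.stabilizer_comm β c τ _ q.1.2, M.stabilizer_add_right hd hΩ β c τ hq hp hp',
        M.bForm_add_left hd hΩ β c p.2.1 p'.2.1 hq, M.bForm_add_right hd hΩ β c q.2.1 hp hp',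
        M.stabilizer_comm β c τ _ q.1.2, M.stabilizer_comm β c τ _ q.1.2]
      ring)
    (fun a p q => by
      simp only [Submodule.coe_smul, Prod.smul_fst, Prod.smul_snd]
      rw [M.stabilizer_comm β c τ _ q.1.2, M.stabilizer_smul_right, M.bForm_smul_left,
        M.bForm_smul_right hd hΩ β c q.2.1 p.2.2.isPolyWeakFun, M.stabilizer_comm β c τ _ q.1.2,
        smul_eq_mul]
      ring)
    (fun p q q' => by
      have hp := p.2.2.isPolyWeakFun
      have hq := q.2.2.isPolyWeakFun
      have hq' := q'.2.2.isPolyWeakFun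
      simp only [Submodule.coe_add, Prod.fst_add, Prod.snd_add]
      rw [M.stabilizer_add_right hd hΩ β c τ hp hq hq',
        M.bForm_add_left hd hΩ β c q.2.1 q'.2.1 hp, M.bForm_add_right hd hΩ β c p.2.1 hq hq']
      ring)
    (fun a p q => by
      simp only [Submodule.coe_smul, Prod.smul_fst, Prod.smul_snd]
      rw [M.stabilizer_smul_right, M.bForm_smul_left,
        M.bForm_smul_right hd hΩ β c p.2.1 q.2.2.isPolyWeakFun, smul_eq_mul]
      ring)

theorem schemeForm_apply (hd : 0 < d) (hΩ : Bornology.IsBounded Ω) (k j : ℕ) (τ : ℝ)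
    (β : ι → Eucl d) (c : ι → ℝ) (p q : M.discreteSpace (k - 1) j β) :
    M.schemeForm hd hΩ k j τ β c p q = M.stabilizer β c τ p.1.2 q.1.2 +
      M.bForm k β c p.1.1 q.1.2 + M.bForm k β c q.1.1 p.1.2 := rfl

theorem bForm_zero_left (k : ℕ) (β : ι → Eucl d) (c : ι → ℝ) (σ : WeakFun d ι κ) :
    M.bForm k β c 0 σ = 0 := by
  simpa using M.bForm_smul_left k β c 0 0 σ

theorem stabilizer_zero_right (β : ι → Eucl d) (c : ι → ℝ) (τ : ℝ) (ρ : WeakFun d ι κ) :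
    M.stabilizer β c τ ρ 0 = 0 := by
  simpa using M.stabilizer_smul_right β c τ 0 ρ 0

theorem load_zero (β : ι → Eucl d) (f g : Eucl d → ℝ) : M.load β f g 0 = 0 := by
  simpa using M.load_smul β f g 0 0

theorem bForm_zero_right (hd : 0 < d) (hΩ : Bornology.IsBounded Ω) {k : ℕ} (β : ι → Eucl d)
    (c : ι → ℝ) {v : CellPoly d ι} (hv : M.IsTrial (k - 1) v) : M.bForm k β c v 0 = 0 := by
  have h0 : M.IsPolyWeakFun 0 := (isTest_zero (β := β) (j := 0)).isPolyWeakFun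
  simpa using M.bForm_smul_right hd hΩ β c hv h0 0

/-- The two equations of the scheme are recovered from the single one by testing with `(0, σ)` and
`(v, 0)`. -/
theorem isSchemeSolution_iff (hd : 0 < d) (hΩ : Bornology.IsBounded Ω) {k j : ℕ} {τ : ℝ}
    {β : ι → Eucl d} {c : ι → ℝ} {f g : Eucl d → ℝ} (p : M.discreteSpace (k - 1) j β) :
    M.IsSchemeSolution k j τ β c f g p.1.1 p.1.2 ↔
      ∀ q : M.discreteSpace (k - 1) j β,
        M.schemeForm hd hΩ k j τ β c p q = M.load β f g q.1.2 := by
  constructor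
  · intro h q
    rw [schemeForm_apply, h.primal _ q.2.2, h.dual _ q.2.1, add_zero]
  · intro h
    refine ⟨p.2.1, p.2.2, fun σ hσ => ?_, fun v hv => ?_⟩
    · have := h ⟨(0, σ), isTrial_zero, hσ⟩
      rwa [schemeForm_apply, bForm_zero_left, add_zero] at this
    · have := h ⟨(v, 0), hv, isTest_zero⟩
      rwa [schemeForm_apply, stabilizer_zero_right, M.bForm_zero_right hd hΩ β c p.2.1, load_zero,
        zero_add, zero_add] at this

/-- The scheme is uniquely solvable if the homogeneous scheme has only the trivial solution. -/
theorem existsUnique_isSchemeSolution (hd : 0 < d) (hΩ : Bornology.IsBounded Ω) {k j : ℕ} {τ : ℝ}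
    {β : ι → Eucl d} {c : ι → ℝ} {f g : Eucl d → ℝ}
    (hf : MemLp f 2 (volume.restrict Ω)) (hg : MemLp g 2 ((surface d).restrict (M.inflow β)))
    (h0 : ∀ u l, M.IsTrial (k - 1) u → M.IsTest β j l →
      (∀ σ, M.IsTest β j σ → M.stabilizer β c τ l σ + M.bForm k β c u σ = 0) →
      (∀ v, M.IsTrial (k - 1) v → M.bForm k β c v l = 0) → u = 0 ∧ l = 0) :
    ∃! p : CellPoly d ι × WeakFun d ι κ, M.IsSchemeSolution k j τ β c f g p.1 p.2 := by
  have := M.finiteDimensional_discreteSpace (k - 1) j β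
  have hinj : Function.Injective (M.schemeForm hd hΩ k j τ β c) := by
    rw [injective_iff_map_eq_zero]
    intro p hp
    have h1 : ∀ q, M.schemeForm hd hΩ k j τ β c p q = 0 := fun q => by rw [hp]; rfl
    obtain ⟨h2, h3⟩ := h0 p.1.1 p.1.2 p.2.1 p.2.2
      (fun σ hσ => by
        have := h1 ⟨(0, σ), isTrial_zero, hσ⟩
        rwa [schemeForm_apply, bForm_zero_left, add_zero] at this)
      (fun v hv => by
        have := h1 ⟨(v, 0), hv, isTest_zero⟩
        rwa [schemeForm_apply, stabilizer_zero_right, M.bForm_zero_right hd hΩ β c p.2.1,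
          zero_add, zero_add] at this)
    exact Subtype.ext (Prod.ext h2 h3)
  have hsurj : Function.Surjective (M.schemeForm hd hΩ k j τ β c) :=
    surjective_dual_of_injective hinj
  let ℓ : Module.Dual ℝ (M.discreteSpace (k - 1) j β) :=
    { toFun := fun q => M.load β f g q.1.2
      map_add' := fun q q' =>
        M.load_add hd hΩ β hf hg q.2.2.isPolyWeakFun q'.2.2.isPolyWeakFun
      map_smul' := fun a q => M.load_smul β f g a q.1.2 }
  obtain ⟨p, hp⟩ := hsurj ℓ
  refine ⟨p.1, (M.isSchemeSolution_iff hd hΩ p).2 fun q => LinearMap.congr_fun hp q, ?_⟩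
  intro p' hp'
  have hmem : p' ∈ M.discreteSpace (k - 1) j β := ⟨hp'.trial, hp'.test⟩
  have h1 := (M.isSchemeSolution_iff hd hΩ ⟨p', hmem⟩).1 hp'
  exact congrArg Subtype.val (hinj (hp.symm ▸ LinearMap.ext h1 :
    M.schemeForm hd hΩ k j τ β c ⟨p', hmem⟩ = M.schemeForm hd hΩ k j τ β c p))

end PolytopalMesh

/-! ### Functions that are Lipschitz along segments -/

/-- A mean value inequality without differentiability: the pointwise bounds give continuity and a
bound on right slopes, and `f` is compared with the line of slope `L` through `f 0`. -/
theorem sub_le_of_eventually_abs_sub_le {f : ℝ → ℝ} {L : ℝ}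
    (h : ∀ t ∈ Set.Icc (0 : ℝ) 1, ∀ᶠ s in 𝓝[Set.Icc 0 1] t, |f s - f t| ≤ L * |s - t|) :
    f 1 - f 0 ≤ L := by
  have hcont : ContinuousOn f (Set.Icc 0 1) := by
    intro t ht
    rw [ContinuousWithinAt, tendsto_iff_dist_tendsto_zero]
    refine squeeze_zero' (Eventually.of_forall fun s => dist_nonneg) (h t ht) ?_
    have : Tendsto (fun s => L * |s - t|) (𝓝 t) (𝓝 (L * |t - t|)) :=
      Continuous.tendsto (by fun_prop) t
    simpa using this.mono_left nhdsWithin_le_nhds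
  have hB : ∀ x, HasDerivAt (fun t => L * t + f 0) L x := fun x => by
    simpa using ((hasDerivAt_id x).const_mul L).add_const (f 0)
  have key := image_le_of_liminf_slope_right_le_deriv_boundary hcont
    (B := fun t => L * t + f 0) (B' := fun _ => L) (by simp)
    (fun x _ => (hB x).continuousAt.continuousWithinAt)
    (fun x _ => (hB x).hasDerivWithinAt) (fun x hx r hr => ?_)
  · have := key (Set.right_mem_Icc.2 zero_le_one)
    simp only [mul_one] at this
    linarith
  · have h1 : ∀ᶠ z in 𝓝[>] x, |f z - f x| ≤ L * |z - x| := by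
      have h2 : Set.Ioc x 1 ⊆ Set.Icc 0 1 := fun z hz => ⟨hx.1.trans hz.1.le, hz.2⟩
      have h3 := (h x ⟨hx.1, hx.2.le⟩).filter_mono (nhdsWithin_mono x h2)
      rwa [nhdsWithin_Ioc_eq_nhdsGT hx.2] at h3
    refine Eventually.frequently ?_
    filter_upwards [h1, self_mem_nhdsWithin] with z hz hxz
    have hpos : 0 < z - x := sub_pos.2 hxz
    rw [slope_def_field, div_lt_iff₀ hpos]
    rw [abs_of_pos hpos] at hz
    have := le_abs_self (f z - f x)
    have := mul_lt_mul_of_pos_right hr hpos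
    linarith

/-- `h` is `L`-Lipschitz along the segments contained in `Ω`. -/
def SegmentLipschitz {d : ℕ} (Ω : Set (Eucl d)) (L : ℝ) (h : Eucl d → ℝ) : Prop :=
  ∀ y z, segment ℝ y z ⊆ Ω → |h y - h z| ≤ L * dist y z

/-- Two points near the boundary are joined by three segments in Ω: up along `ν` by `s = (K + 1) *
dist y z`, across, and down. Their total length is `2 (K + 1) + 1` times the distance. -/
theorem HasLipschitzBoundary.exists_ball_lipschitz {d : ℕ} {Ω : Set (Eucl d)}
    (hΩ_lip : HasLipschitzBoundary Ω) {L : ℝ} (hL : 0 ≤ L)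
    {h : Eucl d → ℝ} (hseg : SegmentLipschitz Ω L h) {x : Eucl d} (hx : x ∈ frontier Ω) :
    ∃ r > 0, ∃ C ≥ 0, ∀ y ∈ Ω ∩ Metric.ball x r, ∀ z ∈ Ω ∩ Metric.ball x r,
      |h y - h z| ≤ C * dist y z := by
  obtain ⟨ν, γ, K, U, hν, hγ, hγν, hU, hxU, hgraph⟩ := hΩ_lip x hx
  obtain ⟨ρ, hρ, hball⟩ := Metric.isOpen_iff.1 hU x hxU
  have hK0 : (0 : ℝ) ≤ K := K.2
  -- With radius `r`, the lift is at most `2 (K + 1) r`, so the path stays within `(2 K + 3) r = ρ`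
  -- of `x`, where the graph description holds.
  refine ⟨ρ / (2 * K + 3), by positivity, L * (2 * (K + 1) + 1), by positivity, ?_⟩
  rintro y ⟨hy, hyr⟩ z ⟨hz, hzr⟩
  set r := ρ / (2 * K + 3) with hr
  have hrρ : r * (2 * K + 3) = ρ := by
    rw [hr]
    field_simp
  set D := dist y z with hD
  have hD0 : 0 ≤ D := dist_nonneg
  have hDr : D ≤ 2 * r := by
    have := dist_triangle_right y z x
    rw [Metric.mem_ball] at hyr hzr
    linarith
  set s := (K + 1) * D with hs
  have hs0 : 0 ≤ s := by positivity
  have hsr : s ≤ (K + 1) * (2 * r) := mul_le_mul_of_nonneg_left hDr (by positivity)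
  have hr0 : 0 ≤ r := by positivity
  have hνν : inner ℝ ν ν = (1 : ℝ) := by rw [real_inner_self_eq_norm_sq, hν]; norm_num
  have hmemball : ∀ w ∈ Metric.ball x r, ∀ t ∈ Set.Icc 0 s, w + t • ν ∈ Metric.ball x ρ := by
    intro w hw t ht
    rw [Metric.mem_ball] at hw ⊢
    have h1 : dist (w + t • ν) w = t := by
      rw [dist_eq_norm, add_sub_cancel_left, norm_smul, hν, mul_one, Real.norm_eq_abs,
        abs_of_nonneg ht.1]
    have := dist_triangle (w + t • ν) w x
    have := ht.2
    linarith
  have hup : ∀ w ∈ Ω, w ∈ Metric.ball x r → segment ℝ w (w + s • ν) ⊆ Ω := by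
    intro w hw hwr p hp
    rw [segment_eq_image'] at hp
    obtain ⟨θ, hθ, rfl⟩ := hp
    have h2 : w + θ • (w + s • ν - w) = w + (θ * s) • ν := by
      rw [add_sub_cancel_left, smul_smul]
    have hθs : θ * s ∈ Set.Icc 0 s := ⟨mul_nonneg hθ.1 hs0, mul_le_of_le_one_left hs0 hθ.2⟩
    simp only [h2]
    rw [hgraph _ (hball (hmemball w hwr _ hθs)), hγν, inner_add_right, inner_smul_right, hνν]
    have h3 := (hgraph w (hball (by simpa using hmemball w hwr 0 ⟨le_rfl, hs0⟩))).1 hw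
    have := hθs.1
    linarith
  -- Along the crossing the height drops by at most `D` and `γ` rises by at most `K * D`; the lift
  -- `(K + 1) * D` compensates for both.
  have hmid : segment ℝ (y + s • ν) (z + s • ν) ⊆ Ω := by
    intro p hp
    have hpρ : p ∈ Metric.ball x ρ := (convex_ball x ρ).segment_subset
      (hmemball y hyr s ⟨hs0, le_rfl⟩) (hmemball z hzr s ⟨hs0, le_rfl⟩) hp
    rw [segment_eq_image'] at hp
    obtain ⟨θ, hθ, rfl⟩ := hp
    have h2 : y + s • ν + θ • (z + s • ν - (y + s • ν)) = (y + θ • (z - y)) + s • ν := by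
      module
    simp only [h2] at hpρ ⊢
    rw [hgraph _ (hball hpρ), hγν, inner_add_right, inner_smul_right, hνν]
    have h3 := (hgraph y (hball (by simpa using hmemball y hyr 0 ⟨le_rfl, hs0⟩))).1 hy
    have h4 : dist (y + θ • (z - y)) y ≤ D := by
      rw [dist_eq_norm, add_sub_cancel_left, norm_smul, Real.norm_eq_abs, abs_of_nonneg hθ.1,
        ← dist_eq_norm, dist_comm z y]
      exact mul_le_of_le_one_left hD0 hθ.2
    have h5 := hγ.dist_le_mul (y + θ • (z - y)) y
    rw [Real.dist_eq] at h5
    have h6 := le_abs_self (γ (y + θ • (z - y)) - γ y)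
    have h7 : (K : ℝ) * dist (y + θ • (z - y)) y ≤ K * D := mul_le_mul_of_nonneg_left h4 hK0
    have h8 : |inner ℝ ν (y + θ • (z - y) - y)| ≤ D := by
      refine (abs_real_inner_le_norm _ _).trans ?_
      rw [hν, one_mul, ← dist_eq_norm]
      exact h4
    rw [inner_sub_right] at h8
    have h9 := (abs_le.1 h8).1
    rw [hs]
    linarith
  have e1 := hseg _ _ (hup y hy hyr)
  have e2 := hseg _ _ hmid
  have e3 := hseg _ _ (hup z hz hzr)
  have d1 : ∀ w : Eucl d, dist w (w + s • ν) = s := fun w => by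
    rw [dist_comm, dist_eq_norm, add_sub_cancel_left, norm_smul, hν, mul_one, Real.norm_eq_abs,
      abs_of_nonneg hs0]
  rw [d1] at e1 e3
  rw [dist_add_right] at e2
  have e4 := abs_le.1 e1
  have e5 := abs_le.1 e2
  have e6 := abs_le.1 e3
  have e7 : L * (2 * (K + 1) + 1) * D = L * s + L * D + L * s := by rw [hs]; ring
  rw [e7, abs_le]
  constructor <;> linarith

/-- Compactness of the closure gives finitely many balls with local constants. Points closer than a
Lebesgue number `δ` share a ball; for points farther apart the bound on `h` gives the slope `2 * |B|
/ δ`. -/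
theorem HasLipschitzBoundary.exists_lipschitzOnWith {d : ℕ} {Ω : Set (Eucl d)} (hΩ_open : IsOpen Ω)
    (hΩ_bdd : Bornology.IsBounded Ω) (hΩ_lip : HasLipschitzBoundary Ω) {L : ℝ} (hL : 0 ≤ L)
    {h : Eucl d → ℝ} (hseg : SegmentLipschitz Ω L h) {B : ℝ} (hB : ∀ x ∈ Ω, |h x| ≤ B) :
    ∃ K, LipschitzOnWith K h Ω := by
  have hloc : ∀ x ∈ closure Ω, ∃ r > 0, ∃ C ≥ 0, ∀ y ∈ Ω ∩ Metric.ball x r,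
      ∀ z ∈ Ω ∩ Metric.ball x r, |h y - h z| ≤ C * dist y z := by
    intro x hx
    by_cases hxΩ : x ∈ Ω
    · obtain ⟨r, hr, hball⟩ := Metric.isOpen_iff.1 hΩ_open x hxΩ
      refine ⟨r, hr, L, hL, fun y hy z hz => hseg y z ?_⟩
      exact ((convex_ball x r).segment_subset hy.2 hz.2).trans hball
    · exact hΩ_lip.exists_ball_lipschitz hL hseg (by rw [hΩ_open.frontier_eq]; exact ⟨hx, hxΩ⟩)
  choose! r hr C hC hrC using hloc
  have hcpt : IsCompact (closure Ω) :=
    Metric.isCompact_of_isClosed_isBounded isClosed_closure hΩ_bdd.closure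
  obtain ⟨t, ht, hcov⟩ := hcpt.elim_nhds_subcover (fun x => Metric.ball x (r x))
    fun x hx => Metric.ball_mem_nhds x (hr x hx)
  obtain ⟨δ, hδ, hleb⟩ := lebesgue_number_lemma_of_metric (c := fun x : t => Metric.ball (x : Eucl d) (r x))
    hcpt (fun _ => Metric.isOpen_ball) (fun y hy => by
      obtain ⟨x, hx, hy⟩ := Set.mem_iUnion₂.1 (hcov hy)
      exact Set.mem_iUnion.2 ⟨⟨x, hx⟩, hy⟩)
  have hCsum : ∀ x ∈ t, C x ≤ ∑ x ∈ t, C x := fun x hx =>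
    Finset.single_le_sum (f := C) (fun x hx => hC x (ht x hx)) hx
  have hC0 : 0 ≤ ∑ x ∈ t, C x := Finset.sum_nonneg fun x hx => hC x (ht x hx)
  refine ⟨(∑ x ∈ t, C x + 2 * |B| / δ).toNNReal, LipschitzOnWith.of_dist_le_mul
    fun y hy z hz => ?_⟩
  rw [Real.coe_toNNReal _ (by positivity), Real.dist_eq]
  by_cases hyz : dist y z < δ
  · obtain ⟨⟨x, hx⟩, hxb⟩ := hleb y (subset_closure hy)
    have h1 := hrC x (ht x hx) y ⟨hy, hxb (Metric.mem_ball_self hδ)⟩ z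
      ⟨hz, hxb (by rwa [Metric.mem_ball, dist_comm])⟩
    refine h1.trans (mul_le_mul_of_nonneg_right ?_ dist_nonneg)
    have : 0 ≤ 2 * |B| / δ := by positivity
    linarith [hCsum x hx]
  · rw [not_lt] at hyz
    have h1 : |h y - h z| ≤ 2 * |B| := by
      have := abs_sub (h y) (h z)
      have := hB y hy
      have := hB z hz
      have := le_abs_self B
      linarith
    have h2 : 2 * |B| ≤ 2 * |B| / δ * dist y z := by
      rw [div_mul_eq_mul_div, le_div_iff₀ hδ]
      exact mul_le_mul_of_nonneg_left hyz (by positivity)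
    have h3 : 0 ≤ (∑ x ∈ t, C x) * dist y z := mul_nonneg hC0 dist_nonneg
    rw [add_mul]
    linarith

namespace PolytopalMesh

set_option linter.unusedSectionVars false

variable {d : ℕ} {Ω : Set (Eucl d)} {ι κ : Type*} [Fintype ι] [Fintype κ]
  (M : PolytopalMesh d Ω ι κ)

/-! ### Gluing polynomials that agree on the faces -/

/-- The segment from `z` to a generic point avoids the skeleton. -/
theorem exists_segment_disjoint_skeleton {z : Eucl d} (hz : z ∉ M.skeleton) {U : Set (Eucl d)}
    (hU : IsOpen U) (hne : U.Nonempty) : ∃ y ∈ U, Disjoint (segment ℝ y z) M.skeleton := by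
  obtain ⟨A, hA, hsub⟩ := M.exists_subset_iUnion_codim_two
  -- The cones with apex `z` over the codimension-two subspaces have codimension at least one, hence
  -- measure zero. A segment from `z` that hits some `L` away from `z` has its other endpoint in the
  -- corresponding cone.
  set N : Set (Eucl d) := ⋃ L ∈ A, (affineSpan ℝ (insert z (L : Set (Eucl d))) : Set (Eucl d))
    with hN
  have hN0 : volume N = 0 := by
    refine (measure_biUnion_null_iff A.countable_toSet).2 fun L hL => ?_
    refine Measure.addHaar_affineSubspace _ _ fun htop => ?_
    have h1 := finrank_vectorSpan_insert_le L z
    rw [← direction_affineSpan, htop, AffineSubspace.direction_top, finrank_top,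
      finrank_euclideanSpace_fin] at h1
    have := hA L hL
    omega
  obtain ⟨y, hyU, hyN⟩ : (U \ N).Nonempty := by
    rw [Set.nonempty_iff_ne_empty]
    intro hemp
    have : U ⊆ N := Set.sdiff_eq_empty.1 hemp
    exact (hU.measure_pos volume hne).ne' (measure_mono_null this hN0)
  refine ⟨y, hyU, Set.disjoint_left.2 fun w hw hws => hyN ?_⟩
  obtain ⟨L, hL, hwL⟩ := Set.mem_iUnion₂.1 (hsub hws)
  refine Set.mem_iUnion₂.2 ⟨L, hL, ?_⟩
  rw [segment_symm, segment_eq_image_lineMap] at hw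
  obtain ⟨t, ht, rfl⟩ := hw
  have ht0 : t ≠ 0 := by
    rintro rfl
    rw [AffineMap.lineMap_apply_zero] at hws
    exact hz hws
  have h1 : AffineMap.lineMap z y t ∈ affineSpan ℝ (insert z (L : Set (Eucl d))) :=
    subset_affineSpan ℝ _ (Set.mem_insert_of_mem _ hwL)
  have h2 : z ∈ affineSpan ℝ (insert z (L : Set (Eucl d))) :=
    subset_affineSpan ℝ _ (Set.mem_insert _ _)
  have h3 : AffineMap.lineMap z (AffineMap.lineMap z y t) t⁻¹ = y := by
    simp [AffineMap.lineMap_apply, smul_smul, inv_mul_cancel₀ ht0]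
  rw [← h3]
  exact AffineMap.lineMap_mem _ h2 h1

/-- The polynomials `p i` on the elements agree on common faces. -/
def IsCompatible (p : CellPoly d ι) : Prop :=
  ∀ x, x ∉ M.skeleton → ∀ i i', x ∈ closure (M.cell i) → x ∈ closure (M.cell i') →
    pval (p i) x = pval (p i') x

theorem exists_lipschitz_constant (hΩ : Bornology.IsBounded Ω) (p : CellPoly d ι) :
    ∃ L : ℝ, 0 ≤ L ∧ ∀ i, ∀ x ∈ closure Ω, ∀ y ∈ closure Ω,
      |pval (p i) x - pval (p i) y| ≤ L * dist x y := by
  have hcpt : IsCompact (closure Ω) :=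
    Metric.isCompact_of_isClosed_isBounded isClosed_closure hΩ.closure
  choose K hK using fun i => LocallyLipschitzOn.exists_lipschitzOnWith_of_compact hcpt
    (contDiff_pval (p i)).locallyLipschitz.locallyLipschitzOn
  refine ⟨∑ i, (K i : ℝ), Finset.sum_nonneg fun i _ => (K i).2, fun i x hx y hy => ?_⟩
  have h1 := (hK i).dist_le_mul x hx y hy
  rw [Real.dist_eq] at h1
  exact h1.trans (mul_le_mul_of_nonneg_right (Finset.single_le_sum (f := fun i => (K i : ℝ))
    (fun i _ => (K i).2) (Finset.mem_univ i)) dist_nonneg)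

variable {M}

/-- Along a segment off the skeleton, all polynomials available at a point give the same value
there, so the choice of an element at each parameter is harmless and the one-dimensional estimate
applies. -/
theorem IsCompatible.abs_sub_le {p : CellPoly d ι} (hp : M.IsCompatible p) {L : ℝ}
    (hL : ∀ i, ∀ x ∈ closure Ω, ∀ y ∈ closure Ω, |pval (p i) x - pval (p i) y| ≤ L * dist x y)
    {y z : Eucl d} {i j : ι} (hy : y ∈ M.cell i) (hz : z ∈ M.cell j)
    (hseg : segment ℝ y z ⊆ Ω) (hs : Disjoint (segment ℝ y z) M.skeleton) :
    |pval (p i) y - pval (p j) z| ≤ L * dist y z := by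
  have hmem : ∀ t ∈ Set.Icc (0 : ℝ) 1, AffineMap.lineMap y z t ∈ segment ℝ y z := fun t ht => by
    rw [segment_eq_image_lineMap]
    exact ⟨t, ht, rfl⟩
  have hidx : ∀ x ∈ closure Ω, ∃ i, x ∈ closure (M.cell i) := fun x hx =>
    M.exists_mem_closure_cell hx
  have : Nonempty ι := ⟨i⟩
  choose! idx hidx using hidx
  set f : ℝ → ℝ := fun t => pval (p (idx (AffineMap.lineMap y z t))) (AffineMap.lineMap y z t)
    with hf
  have hΩm : ∀ t ∈ Set.Icc (0 : ℝ) 1, AffineMap.lineMap y z t ∈ closure Ω := fun t ht =>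
    subset_closure (hseg (hmem t ht))
  have hloc : ∀ t ∈ Set.Icc (0 : ℝ) 1, ∀ᶠ s in 𝓝[Set.Icc 0 1] t,
      |f s - f t| ≤ L * dist y z * |s - t| := by
    intro t ht
    -- Finitely many closed sets: near `t` the segment meets only closed elements that already
    -- contain the point at `t`. Both values can then be computed with one polynomial.
    have h1 : ∀ᶠ s in 𝓝 t, ∀ l : ι, AffineMap.lineMap y z s ∈ closure (M.cell l) →
        AffineMap.lineMap y z t ∈ closure (M.cell l) := by
      rw [eventually_all]
      intro l
      by_cases hl : (AffineMap.lineMap y z t : Eucl d) ∈ closure (M.cell l)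
      · exact Eventually.of_forall fun s _ => hl
      · have hc : Continuous fun s : ℝ => (AffineMap.lineMap y z s : Eucl d) :=
          AffineMap.lineMap_continuous
        filter_upwards [(isClosed_closure.isOpen_compl.preimage hc).mem_nhds hl] with s hs hs'
        exact (hs hs').elim
    filter_upwards [h1.filter_mono nhdsWithin_le_nhds, self_mem_nhdsWithin] with s hs1 hs2
    have h2 : f t = pval (p (idx (AffineMap.lineMap y z s))) (AffineMap.lineMap y z t) :=
      hp _ (Set.disjoint_left.1 hs (hmem t ht)) _ _ (hidx _ (hΩm t ht))
        (hs1 _ (hidx _ (hΩm s hs2)))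
    rw [h2]
    refine (hL _ _ (hΩm s hs2) _ (hΩm t ht)).trans (le_of_eq ?_)
    rw [dist_lineMap_lineMap, Real.dist_eq]
    ring
  have h0 : f 0 = pval (p i) y := by
    have h1 := hidx _ (hΩm 0 (by simp))
    simp only [hf, AffineMap.lineMap_apply_zero] at h1 ⊢
    exact hp y (M.notMem_skeleton_of_mem_cell hy) _ _ h1 (subset_closure hy)
  have h1 : f 1 = pval (p j) z := by
    have h1 := hidx _ (hΩm 1 (by simp))
    simp only [hf, AffineMap.lineMap_apply_one] at h1 ⊢
    exact hp z (M.notMem_skeleton_of_mem_cell hz) _ _ h1 (subset_closure hz)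
  have e1 := sub_le_of_eventually_abs_sub_le hloc
  have e2 := sub_le_of_eventually_abs_sub_le (f := fun t => - f t) (L := L * dist y z)
    (fun t ht => (hloc t ht).mono fun s hs => by
      rw [← neg_sub', abs_neg]
      exact hs)
  rw [← h0, ← h1, abs_le]
  constructor <;> linarith

/-- The estimate is a closed condition on the pair of endpoints. They are perturbed into the open
elements, generically enough to miss the skeleton and slightly enough for the segment to stay in Ω.
-/
theorem IsCompatible.abs_sub_le_of_mem_closure (hΩ : IsOpen Ω) {p : CellPoly d ι}
    (hp : M.IsCompatible p) {L : ℝ}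
    (hL : ∀ i, ∀ x ∈ closure Ω, ∀ y ∈ closure Ω, |pval (p i) x - pval (p i) y| ≤ L * dist x y)
    {y z : Eucl d} {i j : ι} (hy : y ∈ closure (M.cell i)) (hz : z ∈ closure (M.cell j))
    (hseg : segment ℝ y z ⊆ Ω) : |pval (p i) y - pval (p j) z| ≤ L * dist y z := by
  set G : Set (Eucl d × Eucl d) := {q | |pval (p i) q.1 - pval (p j) q.2| ≤ L * dist q.1 q.2} with hG
  have hGc : IsClosed G := by
    have h1 := (continuous_pval (p i)).comp (continuous_fst (X := Eucl d) (Y := Eucl d))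
    have h2 := (continuous_pval (p j)).comp (continuous_snd (X := Eucl d) (Y := Eucl d))
    exact isClosed_le (h1.sub h2).abs (continuous_const.mul (continuous_fst.dist continuous_snd))
  suffices h : (y, z) ∈ closure G by
    rw [hGc.closure_eq] at h
    exact h
  have hcpt : IsCompact (segment ℝ y z) := by
    rw [segment_eq_image_lineMap]
    exact isCompact_Icc.image AffineMap.lineMap_continuous
  obtain ⟨δ, hδ, hthick⟩ := hcpt.exists_thickening_subset_open hΩ hseg
  rw [Metric.mem_closure_iff]
  intro ε hε
  have hm : 0 < min ε δ := lt_min hε hδ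
  obtain ⟨z', hz', hzz'⟩ := Metric.mem_closure_iff.1 hz _ hm
  obtain ⟨y', ⟨hy'b, hy'⟩, hdisj⟩ := M.exists_segment_disjoint_skeleton
    (M.notMem_skeleton_of_mem_cell hz') (Metric.isOpen_ball.inter (M.isOpen_cell i))
    (by
      obtain ⟨w, hw, hyw⟩ := Metric.mem_closure_iff.1 hy _ hm
      exact ⟨w, by rwa [Metric.mem_ball, dist_comm], hw⟩ :
        (Metric.ball y (min ε δ) ∩ M.cell i).Nonempty)
  rw [Metric.mem_ball, dist_comm] at hy'b
  refine ⟨(y', z'), hp.abs_sub_le hL hy' hz' ?_ hdisj, ?_⟩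
  · intro w hw
    rw [segment_eq_image] at hw
    obtain ⟨t, ht, rfl⟩ := hw
    refine hthick (Metric.mem_thickening_iff.2 ⟨(1 - t) • y + t • z, ?_, ?_⟩)
    · rw [segment_eq_image]
      exact ⟨t, ht, rfl⟩
    · have h1 : (1 - t) • y' + t • z' - ((1 - t) • y + t • z) =
        (1 - t) • (y' - y) + t • (z' - z) := by module
      rw [dist_eq_norm, h1]
      refine (norm_add_le _ _).trans_lt ?_
      rw [norm_smul, norm_smul, Real.norm_eq_abs, Real.norm_eq_abs,
        abs_of_nonneg (sub_nonneg.2 ht.2), abs_of_nonneg ht.1, ← dist_eq_norm, ← dist_eq_norm,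
        dist_comm y', dist_comm z']
      have h2 : dist y y' ≤ max (dist y y') (dist z z') := le_max_left _ _
      have h3 : dist z z' ≤ max (dist y y') (dist z z') := le_max_right _ _
      have h4 : max (dist y y') (dist z z') < δ :=
        max_lt (hy'b.trans_le (min_le_right _ _)) (hzz'.trans_le (min_le_right _ _))
      have h5 := mul_le_mul_of_nonneg_left h2 (sub_nonneg.2 ht.2)
      have h6 := mul_le_mul_of_nonneg_left h3 ht.1
      linarith
  · rw [Prod.dist_eq]
    exact max_lt (hy'b.trans_le (min_le_left _ _)) (hzz'.trans_le (min_le_left _ _))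

/-- Compatible polynomials are the restrictions of one Lipschitz function. -/
theorem IsCompatible.exists_lipschitzWith (hΩ_open : IsOpen Ω) (hΩ_bdd : Bornology.IsBounded Ω)
    (hΩ_lip : HasLipschitzBoundary Ω) {p : CellPoly d ι} (hp : M.IsCompatible p) :
    ∃ (φ : Eucl d → ℝ) (K : NNReal), LipschitzWith K φ ∧
      ∀ i, ∀ x ∈ closure (M.cell i), φ x = pval (p i) x := by
  classical
  obtain ⟨L, hL0, hL⟩ := exists_lipschitz_constant hΩ_bdd p
  set h : Eucl d → ℝ := fun x => if hx : ∃ i, x ∈ closure (M.cell i) then pval (p hx.choose) x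
    else 0 with hh
  have hhx : ∀ x ∈ closure Ω, ∃ i, x ∈ closure (M.cell i) ∧ h x = pval (p i) x := fun x hx => by
    have hex := M.exists_mem_closure_cell hx
    exact ⟨hex.choose, hex.choose_spec, by simp only [hh, dif_pos hex]⟩
  have hseg : SegmentLipschitz Ω L h := by
    intro y z hyz
    obtain ⟨i, hi, hyi⟩ := hhx y (subset_closure (hyz (left_mem_segment ℝ y z)))
    obtain ⟨j, hj, hzj⟩ := hhx z (subset_closure (hyz (right_mem_segment ℝ y z)))
    rw [hyi, hzj]
    exact hp.abs_sub_le_of_mem_closure hΩ_open hL hi hj hyz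
  have hcpt : IsCompact (closure Ω) :=
    Metric.isCompact_of_isClosed_isBounded isClosed_closure hΩ_bdd.closure
  choose B hB using fun i => hcpt.exists_bound_of_continuousOn (continuous_pval (p i)).continuousOn
  have hbd : ∀ x ∈ Ω, |h x| ≤ ∑ i, |B i| := fun x hx => by
    obtain ⟨i, -, hi⟩ := hhx x (subset_closure hx)
    rw [hi]
    exact ((hB i x (subset_closure hx)).trans (le_abs_self _)).trans
      (Finset.single_le_sum (f := fun i => |B i|) (fun i _ => abs_nonneg _) (Finset.mem_univ i))
  obtain ⟨K, hK⟩ := hΩ_lip.exists_lipschitzOnWith hΩ_open hΩ_bdd hL0 hseg hbd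
  obtain ⟨φ, hφ, hφh⟩ := hK.extend_real
  refine ⟨φ, K, hφ, fun i => ?_⟩
  -- Compatibility makes the chosen index irrelevant on the open element, and continuity extends the
  -- identity to its closure.
  have hcell : Set.EqOn φ (pval (p i)) (M.cell i) := fun x hx => by
    obtain ⟨j, hj, hxj⟩ := hhx x (subset_closure (M.cell_subset i hx))
    rw [← hφh (M.cell_subset i hx), hxj]
    exact hp x (M.notMem_skeleton_of_mem_cell hx) _ _ hj (subset_closure hx)
  exact hcell.closure hφ.continuous (continuous_pval (p i))

end PolytopalMesh

/-! ### Lipschitz functions are Sobolev functions with traces -/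

theorem inner_gradient {d : ℕ} {F : Eucl d → ℝ} {x : Eucl d} (hF : DifferentiableAt ℝ F x)
    (b : Eucl d) : inner ℝ b (gradient F x) = lineDeriv ℝ F x b := by
  rw [hF.lineDeriv_eq_fderiv, real_inner_comm, gradient, InnerProductSpace.toDual_symm_apply]

theorem gradient_apply {d : ℕ} {F : Eucl d → ℝ} {x : Eucl d} (hF : DifferentiableAt ℝ F x)
    (m : Fin d) : gradient F x m = lineDeriv ℝ F x (EuclideanSpace.single m 1) := by
  rw [← inner_gradient hF, EuclideanSpace.inner_single_left]
  simp

theorem measurable_gradient {d : ℕ} (F : Eucl d → ℝ) : Measurable (gradient F) :=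
  (InnerProductSpace.toDual ℝ (Eucl d)).symm.continuous.measurable.comp (measurable_fderiv ℝ F)

/-- No exceptional set is needed, since the gradient is 0 where `F` is not differentiable. -/
theorem norm_gradient_le {d : ℕ} {F : Eucl d → ℝ} {C : NNReal} (hF : LipschitzWith C F)
    (x : Eucl d) : ‖gradient F x‖ ≤ C := by
  rw [gradient, LinearIsometryEquiv.norm_map]
  exact norm_fderiv_le_of_lipschitz ℝ hF

theorem isFiniteMeasure_restrict_of_isBounded {d : ℕ} {Ω : Set (Eucl d)}
    (hΩ : Bornology.IsBounded Ω) : IsFiniteMeasure ((volume : Measure (Eucl d)).restrict Ω) :=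
  ⟨by
    rw [Measure.restrict_apply_univ]
    exact hΩ.measure_lt_top⟩

theorem memLp_restrict_of_continuous {d : ℕ} {μ : Measure (Eucl d)} {s : Set (Eucl d)}
    [IsFiniteMeasure (μ.restrict s)] (hsm : MeasurableSet s) (hs : Bornology.IsBounded s)
    {F : Eucl d → ℝ} (hF : Continuous F) (q : ENNReal) : MemLp F q (μ.restrict s) := by
  obtain ⟨B, hB⟩ := (Metric.isCompact_of_isClosed_isBounded isClosed_closure
    hs.closure).exists_bound_of_continuousOn hF.continuousOn
  refine MemLp.of_bound hF.aestronglyMeasurable B ?_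
  exact (ae_restrict_iff' hsm).2 (Eventually.of_forall fun x hx => hB x (subset_closure hx))

/-- The trace condition holds with the constant sequence `φ`, and the weak gradient comes from
integration by parts for Lipschitz functions. -/
theorem isH1WithTrace_of_lipschitzWith {d : ℕ} {Ω : Set (Eucl d)} (hΩ_open : IsOpen Ω)
    (hΩ_bdd : Bornology.IsBounded Ω) (hfr : surface d (frontier Ω) < ⊤) {φ : Eucl d → ℝ}
    {K : NNReal} (hφ : LipschitzWith K φ) : IsH1WithTrace Ω φ (gradient φ) φ where
  memLp_fun := by
    have := isFiniteMeasure_restrict_of_isBounded hΩ_bdd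
    exact memLp_restrict_of_continuous hΩ_open.measurableSet hΩ_bdd hφ.continuous 2
  memLp_grad := by
    have := isFiniteMeasure_restrict_of_isBounded hΩ_bdd
    exact MemLp.of_bound (measurable_gradient φ).aestronglyMeasurable K
      (Eventually.of_forall fun x => norm_gradient_le hφ x)
  weak_gradient := by
    intro ψ hψ hc hsupp m
    obtain ⟨D, hD⟩ := exists_lipschitzWith_of_hasCompactSupport
      (hψ.of_le (by exact_mod_cast le_top) : ContDiff ℝ 1 ψ).locallyLipschitz hc
    have hdiff : Differentiable ℝ ψ := hψ.differentiable (by simp)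
    have h1 := LipschitzWith.integral_lineDeriv_mul_eq (μ := (volume : Measure (Eucl d)))
      hφ hD hc (EuclideanSpace.single m (1 : ℝ))
    rw [setIntegral_eq_integral_of_forall_compl_eq_zero,
      setIntegral_eq_integral_of_forall_compl_eq_zero]
    · have h2 : ∫ x, gradient φ x m * ψ x =
          ∫ x, lineDeriv ℝ φ x (EuclideanSpace.single m 1) * ψ x := by
        refine integral_congr_ae ?_
        filter_upwards [hφ.ae_differentiableAt (μ := volume)] with x hx
        rw [gradient_apply hx]
      rw [h2, h1, ← integral_neg]
      congr 1
      funext x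
      rw [gradient_apply (hdiff x), lineDeriv_neg]
      ring
    · intro x hx
      rw [image_eq_zero_of_notMem_tsupport fun h => hx (hsupp h), mul_zero]
    · intro x hx
      rw [gradient_apply (hdiff x),
        lineDeriv_eq_zero_of_notMem_tsupport fun h => hx (hsupp h), mul_zero]
  memLp_trace := by
    have : IsFiniteMeasure ((surface d).restrict (frontier Ω)) := ⟨by
      rwa [Measure.restrict_apply_univ]⟩
    exact memLp_restrict_of_continuous isClosed_frontier.measurableSet
      (hΩ_bdd.closure.subset frontier_subset_closure) hφ.continuous 2
  trace := ⟨fun _ => φ, fun _ => ⟨K, hφ⟩, by simp, by simp, by simp⟩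

/-- Moving along `-ν` from a boundary point leads below the graph, into an open set that misses Ω.
So Ω has no slits, with the domain on both sides of its boundary. -/
theorem HasLipschitzBoundary.exists_mem_ball_notMem_closure {d : ℕ} {Ω : Set (Eucl d)}
    (hΩ_open : IsOpen Ω) (hΩ_lip : HasLipschitzBoundary Ω) {x : Eucl d} (hx : x ∈ frontier Ω)
    {r : ℝ} (hr : 0 < r) : ∃ y ∈ Metric.ball x r, y ∉ closure Ω := by
  obtain ⟨ν, γ, K, U, hν, hγ, hγν, hU, hxU, hgraph⟩ := hΩ_lip x hx
  have hxΩ : x ∉ Ω := by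
    rw [hΩ_open.frontier_eq] at hx
    exact hx.2
  have h1 : inner ℝ ν x ≤ γ x := not_lt.1 fun h => hxΩ ((hgraph x hxU).2 h)
  have hc : Continuous fun t : ℝ => x + t • ν := by fun_prop
  have hnear : ∀ᶠ t in 𝓝 (0 : ℝ), x + t • ν ∈ U ∩ Metric.ball x r :=
    ((hU.inter Metric.isOpen_ball).preimage hc).mem_nhds
      (by simpa using And.intro hxU hr)
  obtain ⟨t, ht, ht0⟩ := ((hnear.filter_mono nhdsWithin_le_nhds).and
    (self_mem_nhdsWithin (s := Set.Iio (0 : ℝ)))).exists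
  refine ⟨x + t • ν, ht.2, fun hcl => ?_⟩
  have hV : IsOpen (U ∩ {y | inner ℝ ν y < γ y}) :=
    hU.inter (isOpen_lt (by fun_prop) hγ.continuous)
  have hmem : x + t • ν ∈ U ∩ {y | inner ℝ ν y < γ y} := by
    refine ⟨ht.1, ?_⟩
    have hνν : inner ℝ ν ν = (1 : ℝ) := by rw [real_inner_self_eq_norm_sq, hν]; norm_num
    have ht0' : t < 0 := ht0
    simp only [Set.mem_ofPred_eq, hγν, inner_add_right, inner_smul_right, hνν]
    linarith
  obtain ⟨y, hy, hyΩ⟩ := mem_closure_iff.1 hcl _ hV hmem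
  exact lt_asymm ((hgraph y hy.1).1 hyΩ) hy.2

namespace PolytopalMesh

set_option linter.unusedSectionVars false

variable {d : ℕ} {Ω : Set (Eucl d)} {ι κ : Type*} [Fintype ι] [Fintype κ]
  (M : PolytopalMesh d Ω ι κ)

/-! ### Boundary faces -/

theorem surface_frontier_lt_top (M : PolytopalMesh d Ω ι κ) (hd : 0 < d) (hΩ_open : IsOpen Ω)
    (hΩ : Bornology.IsBounded Ω) : surface d (frontier Ω) < ⊤ := by
  refine (measure_mono (M.frontier_subset hΩ_open)).trans_lt ?_
  refine (measure_iUnion_fintype_le _ _).trans_lt ?_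
  exact ENNReal.sum_lt_top.2 fun e _ => M.surface_face_lt_top hd hΩ e

/-- One half-ball at `x` lies in an element, and the other does not meet the frontier of Ω. If the
other half also lay in Ω, the exterior points near `x` would form an open set inside a plane. So it
is exterior, and the flat piece between the halves is boundary. -/
theorem exists_ball_inter_face_subset_frontier (hΩ_open : IsOpen Ω)
    (hΩ_lip : HasLipschitzBoundary Ω) {e : κ} {x : Eucl d} (hx : x ∈ M.face e)
    (hxΩ : x ∈ frontier Ω) : ∃ r > 0, Metric.ball x r ∩ M.face e ⊆ frontier Ω := by
  obtain ⟨i, hi⟩ := M.exists_mem_faces e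
  obtain ⟨r, hr, h1, h2, h3⟩ := M.exists_ball_cell hi hx
  refine ⟨r, hr, ?_⟩
  set n := M.normal i e
  have hN : ‖n‖ = 1 := (M.isOutwardNormal_normal hi).unit
  have hnn : inner ℝ n n = (1 : ℝ) := by rw [real_inner_self_eq_norm_sq, hN]; norm_num
  have hmove : ∀ (W : Set (Eucl d)), IsOpen W → ∀ y ∈ W, ∃ t : ℝ, 0 < t ∧ y + t • n ∈ W := by
    intro W hW y hy
    have hc : Continuous fun t : ℝ => y + t • n := by fun_prop
    have hnear : ∀ᶠ t in 𝓝 (0 : ℝ), y + t • n ∈ W :=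
      (hW.preimage hc).mem_nhds (by simpa using hy)
    obtain ⟨t, ht, ht0⟩ := ((hnear.filter_mono nhdsWithin_le_nhds).and
      (self_mem_nhdsWithin (s := Set.Ioi (0 : ℝ)))).exists
    exact ⟨t, ht0, ht⟩
  have hlin : IsLinearMap ℝ fun y : Eucl d => inner ℝ n y :=
    ⟨fun a b => inner_add_right _ _ _, fun c a => by simp [inner_smul_right]⟩
  have hpre : IsPreconnected (Metric.ball x r ∩ {y | inner ℝ n x < inner ℝ n y}) :=
    ((convex_ball x r).inter (convex_halfSpace_gt hlin _)).isPreconnected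
  have hdisj : Disjoint (Metric.ball x r ∩ {y | inner ℝ n x < inner ℝ n y}) (frontier Ω) := by
    refine Set.disjoint_left.2 fun y hy hyf => ?_
    obtain ⟨e', he'⟩ := Set.mem_iUnion.1 (M.frontier_subset hΩ_open hyf)
    by_cases h : e' = e
    · subst h
      exact (ne_of_gt hy.2) (((h2 y hy.1).2).1 he')
    · exact Set.disjoint_left.1 (h1 e' h) hy.1 he'
  rcases isPreconnected_subset_or_disjoint_closure hpre hΩ_open hdisj with h | h
  · exfalso
    obtain ⟨y, hy, hyc⟩ := hΩ_lip.exists_mem_ball_notMem_closure hΩ_open hxΩ hr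
    have hW : IsOpen (Metric.ball x r ∩ (closure Ω)ᶜ) :=
      Metric.isOpen_ball.inter isClosed_closure.isOpen_compl
    have hflat : ∀ z ∈ Metric.ball x r ∩ (closure Ω)ᶜ, inner ℝ n z = inner ℝ n x := by
      rintro z ⟨hz, hzc⟩
      rcases lt_trichotomy (inner ℝ n z) (inner ℝ n x) with hlt | heq | hgt
      · exact (hzc (subset_closure (M.cell_subset i ((h3 z hz).2 hlt)))).elim
      · exact heq
      · exact (hzc (subset_closure (h ⟨hz, hgt⟩))).elim
    obtain ⟨t, ht0, ht⟩ := hmove _ hW y ⟨hy, hyc⟩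
    have e1 := hflat _ ht
    rw [inner_add_right, inner_smul_right, hnn, hflat y ⟨hy, hyc⟩] at e1
    linarith
  · rintro y ⟨hy, hye⟩
    rw [hΩ_open.frontier_eq]
    refine ⟨M.face_subset_closure e hye, fun hyΩ => ?_⟩
    obtain ⟨t, ht0, ht⟩ := hmove _ (hΩ_open.inter Metric.isOpen_ball) y ⟨hyΩ, hy⟩
    refine Set.disjoint_left.1 h ⟨ht.2, ?_⟩ (subset_closure ht.1)
    have e1 := ((h2 y hy).1).1 hye
    simp only [Set.mem_ofPred_eq, inner_add_right, inner_smul_right, hnn, e1]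
    linarith

/-- A face that meets the boundary lies on the boundary. -/
theorem face_subset_frontier (hΩ_open : IsOpen Ω) (hΩ_lip : HasLipschitzBoundary Ω) {e : κ}
    {x : Eucl d} (hx : x ∈ M.face e) (hxΩ : x ∈ frontier Ω) : M.face e ⊆ frontier Ω := by
  -- The points of the face on the boundary are relatively open by the previous lemma and relatively
  -- closed, and the face is connected.
  choose! r hr hball using fun (y : Eucl d) (hy : y ∈ M.face e ∩ frontier Ω) =>
    M.exists_ball_inter_face_subset_frontier hΩ_open hΩ_lip hy.1 hy.2
  set u : Set (Eucl d) := ⋃ y ∈ M.face e ∩ frontier Ω, Metric.ball y (r y) with hu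
  have hsub : ∀ z ∈ M.face e, z ∈ u → z ∈ frontier Ω := fun z hz hzu => by
    obtain ⟨y, hy, hzy⟩ := Set.mem_iUnion₂.1 hzu
    exact hball y hy ⟨hzy, hz⟩
  have hcover : M.face e ⊆ u ∪ (frontier Ω)ᶜ := fun z hz => by
    by_cases hzf : z ∈ frontier Ω
    · exact Or.inl (Set.mem_iUnion₂.2 ⟨z, ⟨hz, hzf⟩, Metric.mem_ball_self (hr z ⟨hz, hzf⟩)⟩)
    · exact Or.inr hzf
  rcases isPreconnected_iff_subset_of_disjoint.1 (M.isFlatFace e).connected.isPreconnected u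
    (frontier Ω)ᶜ (isOpen_biUnion fun _ _ => Metric.isOpen_ball) isClosed_frontier.isOpen_compl
    hcover (by
      rw [Set.eq_empty_iff_forall_notMem]
      rintro z ⟨hz, hzu, hzf⟩
      exact hzf (hsub z hz hzu)) with h | h
  · exact fun z hz => hsub z hz (h hz)
  · exact (h hx hxΩ).elim

/-- Test functions vanish only on faces contained in `Γ₊`; this shows that such faces cover `Γ₊` up
to the skeleton. -/
theorem face_subset_outflow (hΩ_open : IsOpen Ω) (hΩ_lip : HasLipschitzBoundary Ω)
    (β : ι → Eucl d) {e : κ} {x : Eucl d} (hx : x ∈ M.face e) (hxo : x ∈ M.outflow β) :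
    M.face e ⊆ M.outflow β := by
  classical
  have hfr := M.face_subset_frontier hΩ_open hΩ_lip hx hxo.1
  refine fun y hy => ⟨hfr hy, fun hyi => hxo.2 ⟨hxo.1, ?_⟩⟩
  rw [M.normalFlux_of_mem_face β hfr hx, ← M.normalFlux_of_mem_face β hfr hy]
  exact hyi.2

/-! ### The dual variable of a homogeneous solution -/

/-- The adjoint equation is checked in the open elements, which fill Ω up to a null set. The
boundary condition is checked on open faces, as the skeleton has zero surface measure. -/
theorem isAdjointSolution_of_lipschitzWith (hd : 0 < d) (hΩ_open : IsOpen Ω)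
    (hΩ_bdd : Bornology.IsBounded Ω) (hΩ_lip : HasLipschitzBoundary Ω) (β : ι → Eucl d)
    (c : ι → ℝ) {φ : Eucl d → ℝ} {K : NNReal} (hφ : LipschitzWith K φ) {p : CellPoly d ι}
    (hp : ∀ i, ∀ x ∈ closure (M.cell i), φ x = pval (p i) x)
    (hout : ∀ e, M.face e ⊆ M.outflow β → ∀ x ∈ M.face e, φ x = 0)
    (hop : ∀ i, ∀ x ∈ M.cell i, inner ℝ (β i) (pvec (pgrad (p i)) x) - c i * pval (p i) x = 0) :
    IsAdjointSolution Ω (M.piecewiseConst β) (M.piecewiseConst c) (M.normalFlux β) (fun _ => 0)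
      φ := by
  refine ⟨gradient φ, φ, isH1WithTrace_of_lipschitzWith hΩ_open hΩ_bdd
    (M.surface_frontier_lt_top hd hΩ_open hΩ_bdd) hφ, ?_, ?_⟩
  · have h0 : ∀ᵐ x ∂surface d, x ∉ M.skeleton := measure_eq_zero_iff_ae_notMem.1 M.surface_skeleton
    have hz : ∀ᵐ x ∂surface d, x ∈ M.outflow β → φ x = 0 := by
      filter_upwards [h0] with x hx hxo
      obtain ⟨e, he⟩ := Set.mem_iUnion.1 (M.frontier_subset hΩ_open hxo.1)
      have hxe : x ∈ M.face e := by
        by_contra h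
        exact hx (Set.mem_iUnion.2 ⟨e, he, h⟩)
      exact hout e (M.face_subset_outflow hΩ_open hΩ_lip β hxe hxo) x hxe
    -- The measurability used here is that of the zero set of `φ`, not of `Γ₊`.
    exact ae_restrict_of_ae_restrict_of_subset subset_rfl
      ((ae_restrict_iff₀ (hφ.continuous.measurable
        (measurableSet_singleton 0)).nullMeasurableSet).2 hz)
  · refine M.ae_restrict_of_forall_cell fun i x hx => ?_
    have hloc : φ =ᶠ[𝓝 x] pval (p i) := by
      filter_upwards [(M.isOpen_cell i).mem_nhds hx] with y hy
      exact hp i y (subset_closure hy)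
    have hgrad : gradient φ x = pvec (pgrad (p i)) x := by
      rw [← gradient_pval, gradient, gradient, hloc.fderiv_eq]
    rw [M.piecewiseConst_of_mem β hx, M.piecewiseConst_of_mem c hx, hgrad,
      hp i x (subset_closure hx)]
    exact hop i x hx

/-- All weights are positive and all integrands are squares of functions that agree with continuous
ones on their domain, so each square vanishes pointwise. -/
theorem stabilizer_self_eq_zero (hd : 0 < d) (hΩ : Bornology.IsBounded Ω) {β : ι → Eucl d}
    {c : ι → ℝ} {τ : ℝ} (hτ : 0 < τ) {l : WeakFun d ι κ} (hl : M.IsPolyWeakFun l)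
    (h : M.stabilizer β c τ l l = 0) :
    (∀ i, ∀ e ∈ M.faces i, ∀ x ∈ M.face e, pval (l.1 i) x = l.2 e x) ∧
      ∀ i, ∀ x ∈ M.cell i, adjointOp β c l i x = 0 := by
  have hA : ∀ i e, 0 ≤ ∫ x in M.face e,
      (pval (l.1 i) x - l.2 e x) * (pval (l.1 i) x - l.2 e x) ∂surface d := fun i e =>
    integral_nonneg fun x => mul_self_nonneg _
  have hB : ∀ i, 0 ≤ ∫ x in M.cell i, adjointOp β c l i x * adjointOp β c l i x := fun i =>
    integral_nonneg fun x => mul_self_nonneg _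
  have hm : ∀ i, 0 < (M.meshSize i)⁻¹ := fun i => inv_pos.2 (M.meshSize_pos hd hΩ i)
  have hterm := (Finset.sum_eq_zero_iff_of_nonneg fun i _ =>
    add_nonneg (mul_nonneg (hm i).le (Finset.sum_nonneg fun e (_ : e ∈ M.faces i) => hA i e))
      (mul_nonneg hτ.le (hB i))).1 h
  have hboth : ∀ i, (M.meshSize i)⁻¹ * (∑ e ∈ M.faces i, ∫ x in M.face e,
      (pval (l.1 i) x - l.2 e x) * (pval (l.1 i) x - l.2 e x) ∂surface d) = 0 ∧
      τ * (∫ x in M.cell i, adjointOp β c l i x * adjointOp β c l i x) = 0 := fun i =>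
    (add_eq_zero_iff_of_nonneg
      (mul_nonneg (hm i).le (Finset.sum_nonneg fun e (_ : e ∈ M.faces i) => hA i e))
      (mul_nonneg hτ.le (hB i))).1 (hterm i (Finset.mem_univ i))
  refine ⟨fun i e he x hx => ?_, fun i x hx => ?_⟩
  · have h1 := ((mul_eq_zero.1 (hboth i).1).resolve_left (hm i).ne')
    have h2 := (Finset.sum_eq_zero_iff_of_nonneg fun e _ => hA i e).1 h1 e he
    obtain ⟨p, hp⟩ := hl e
    rw [hp, M.setIntegral_face_indicator e p fun x a => (pval (l.1 i) x - a) *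
      (pval (l.1 i) x - a)] at h2
    have h3 := M.eq_zero_of_integral_face_eq_zero hd hΩ
      (((continuous_pval (l.1 i)).sub (continuous_pval p)).mul
        ((continuous_pval (l.1 i)).sub (continuous_pval p))) (fun x => mul_self_nonneg _) h2 x hx
    rw [hp, Set.indicator_of_mem hx]
    exact sub_eq_zero.1 (mul_self_eq_zero.1 h3)
  · have h1 := ((mul_eq_zero.1 (hboth i).2).resolve_left hτ.ne')
    have h2 := M.eq_zero_of_integral_cell_eq_zero hΩ ((continuous_adjointOp β c l i).mul
      (continuous_adjointOp β c l i)) (fun x => mul_self_nonneg _) h1 x hx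
    exact mul_self_eq_zero.1 h2

theorem dual_eq_zero_of_stabilizer_eq_zero (hd : 0 < d) (hΩ_open : IsOpen Ω)
    (hΩ_bdd : Bornology.IsBounded Ω) (hΩ_lip : HasLipschitzBoundary Ω) {β : ι → Eucl d}
    {c : ι → ℝ} (h_adjoint : AdjointUniqueness Ω (M.piecewiseConst β) (M.piecewiseConst c)
      (M.normalFlux β)) {τ : ℝ} (hτ : 0 < τ) {j : ℕ} {l : WeakFun d ι κ} (hl : M.IsTest β j l)
    (h : M.stabilizer β c τ l l = 0) : l = 0 := by
  obtain ⟨hface, hop⟩ := M.stabilizer_self_eq_zero hd hΩ_bdd hτ hl.isPolyWeakFun h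
  -- Off the skeleton, two elements can share only a face point, where both polynomials equal the
  -- single-valued face component.
  have hcomp : M.IsCompatible l.1 := by
    intro x hx i i' hi hi'
    by_cases hxi : x ∈ M.cell i
    · have : i = i' := by
        by_contra hne
        exact Set.disjoint_left.1 (M.cell_disjoint_closure hne) hxi hi'
      rw [this]
    · have hfr : x ∈ frontier (M.cell i) := by
        rw [(M.isOpen_cell i).frontier_eq]
        exact ⟨hi, hxi⟩
      obtain ⟨e, he, hxe⟩ := M.exists_mem_face_of_mem_frontier hfr hx
      rw [hface i e he x hxe,
        hface i' e (M.mem_faces_of_mem_face_of_mem_closure hxe hi') x hxe]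
  obtain ⟨φ, K, hφ, hφp⟩ := hcomp.exists_lipschitzWith hΩ_open hΩ_bdd hΩ_lip
  have hsol := M.isAdjointSolution_of_lipschitzWith hd hΩ_open hΩ_bdd hΩ_lip β c hφ hφp
    (fun e he x hx => by
      obtain ⟨i, hi⟩ := M.exists_mem_faces e
      rw [hφp i x (frontier_subset_closure (M.mem_faces.1 hi hx)), hface i e hi x hx,
        hl.outflow e he]
      rfl) hop
  have hsol0 := M.isAdjointSolution_of_lipschitzWith hd hΩ_open hΩ_bdd hΩ_lip β c
    (φ := fun _ => 0) (K := 0) (LipschitzWith.const' 0) (p := 0) (fun i x _ => by simp)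
    (fun e _ x _ => rfl) (fun i x _ => by simp [inner_pvec, pgrad])
  have hae := h_adjoint (fun _ => 0) MemLp.zero' φ (fun _ => 0) hsol hsol0
  have hφ0 := Measure.eqOn_open_of_ae_eq hae hΩ_open hφ.continuous.continuousOn continuousOn_const
  have hl1 : l.1 = 0 := by
    funext i
    refine eq_zero_of_pval_eq_zero (M.isOpen_cell i) (M.cell_nonempty i) fun x hx => ?_
    rw [← hφp i x (subset_closure hx)]
    exact hφ0 (M.cell_subset i hx)
  refine Prod.ext hl1 (funext fun e => funext fun x => ?_)
  by_cases hx : x ∈ M.face e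
  · obtain ⟨i, hi⟩ := M.exists_mem_faces e
    rw [← hface i e hi x hx, hl1]
    simp
  · obtain ⟨p, hp⟩ := hl.isPolyWeakFun e
    rw [hp, Set.indicator_of_notMem hx]
    rfl

end PolytopalMesh

/-! ### Convergence of integrals -/

/-- Hölder's inequality turns convergence in L² of `h n` into convergence in L¹ of the products. -/
theorem tendsto_integral_mul {α : Type*} [MeasurableSpace α] {μ : Measure α} {f g : α → ℝ}
    {h : ℕ → α → ℝ} (hf : MemLp f 2 μ) (hg : MemLp g 2 μ) (hh : ∀ n, MemLp (h n) 2 μ)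
    (hlim : Tendsto (fun n => eLpNorm (fun x => h n x - g x) 2 μ) atTop (𝓝 0)) :
    Tendsto (fun n => ∫ x, f x * h n x ∂μ) atTop (𝓝 (∫ x, f x * g x ∂μ)) := by
  refine tendsto_integral_of_L1' _ (hf.integrable_mul hg).aestronglyMeasurable
    (Eventually.of_forall fun n => hf.integrable_mul (hh n)) ?_
  have h0 : Tendsto (fun n => eLpNorm f 2 μ * eLpNorm (fun x => h n x - g x) 2 μ) atTop (𝓝 0) := by
    simpa using ENNReal.Tendsto.const_mul hlim (Or.inr hf.eLpNorm_ne_top)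
  refine tendsto_of_tendsto_of_tendsto_of_le_of_le tendsto_const_nhds h0 (fun _ => zero_le) ?_
  intro n
  have h1 : ((fun x => f x * h n x) - f * g) = f • fun x => h n x - g x := by
    funext x
    simp only [Pi.sub_apply, Pi.mul_apply, smul_eq_mul, Pi.smul_apply']
    ring
  beta_reduce
  rw [h1]
  exact eLpNorm_smul_le_mul_eLpNorm ((hh n).sub hg).aestronglyMeasurable hf.aestronglyMeasurable

theorem tendsto_eLpNorm_inner {d : ℕ} {μ : Measure (Eucl d)} (b : Eucl d)
    {H : ℕ → Eucl d → Eucl d} {G : Eucl d → Eucl d}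
    (h : Tendsto (fun n => eLpNorm (fun x => H n x - G x) 2 μ) atTop (𝓝 0)) :
    Tendsto (fun n => eLpNorm (fun x => inner ℝ b (H n x) - inner ℝ b (G x)) 2 μ) atTop (𝓝 0) := by
  have h0 : Tendsto (fun n => ENNReal.ofReal ‖b‖ * eLpNorm (fun x => H n x - G x) 2 μ) atTop
      (𝓝 0) := by
    simpa only [mul_zero] using ENNReal.Tendsto.const_mul h (Or.inr ENNReal.ofReal_ne_top)
  refine tendsto_of_tendsto_of_tendsto_of_le_of_le tendsto_const_nhds h0 (fun _ => zero_le) ?_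
  refine fun n => eLpNorm_le_mul_eLpNorm_of_ae_le_mul (Eventually.of_forall fun x => ?_) 2
  rw [← inner_sub_right]
  exact norm_inner_le_norm _ _

theorem tendsto_eLpNorm_mono {α : Type*} [MeasurableSpace α] {E : Type*} [NormedAddCommGroup E]
    {μ ν : Measure α} (hμ : μ ≤ ν) {h : ℕ → α → E}
    (hlim : Tendsto (fun n => eLpNorm (h n) 2 ν) atTop (𝓝 0)) :
    Tendsto (fun n => eLpNorm (h n) 2 μ) atTop (𝓝 0) :=
  tendsto_of_tendsto_of_tendsto_of_le_of_le tendsto_const_nhds hlim (fun _ => zero_le)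
    fun n => eLpNorm_mono_measure (h n) hμ

namespace PolytopalMesh

set_option linter.unusedSectionVars false

variable {d : ℕ} {Ω : Set (Eucl d)} {ι κ : Type*} [Fintype ι] [Fintype κ]
  (M : PolytopalMesh d Ω ι κ)

/-! ### The flux of a piecewise polynomial across a face -/

open Classical in
/-- The sum over the elements adjacent to a face of the outward fluxes of `β v`. -/
def fluxJump (β : ι → Eucl d) (v : CellPoly d ι) (e : κ) : MvPolynomial (Fin d) ℝ :=
  ∑ i, if e ∈ M.faces i then (inner ℝ (M.normal i e) (β i) : ℝ) • v i else 0

theorem fluxJump_mem_Poly {r : ℕ} (β : ι → Eucl d) {v : CellPoly d ι} (hv : M.IsTrial r v)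
    (e : κ) : M.fluxJump β v e ∈ Poly d r :=
  Submodule.sum_mem _ fun i _ => by
    split_ifs
    · exact Submodule.smul_mem _ _ (hv i)
    · exact Submodule.zero_mem _

/-- The face function `w` is common to both adjacent elements, so regrouping by faces collects the
fluxes into one jump. -/
theorem sum_flux_eq (β : ι → Eucl d) (v : CellPoly d ι) {w : κ → Eucl d → ℝ}
    (hw : ∀ i e, IntegrableOn (fun x => w e x * pval (v i) x) (M.face e) (surface d)) :
    ∑ i, ∑ e ∈ M.faces i, inner ℝ (M.normal i e) (β i) *
        (∫ x in M.face e, w e x * pval (v i) x ∂surface d) =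
      ∑ e, ∫ x in M.face e, w e x * pval (M.fluxJump β v e) x ∂surface d := by
  classical
  have h1 : ∀ i, ∑ e ∈ M.faces i, inner ℝ (M.normal i e) (β i) *
      (∫ x in M.face e, w e x * pval (v i) x ∂surface d) =
      ∑ e, (if e ∈ M.faces i then (inner ℝ (M.normal i e) (β i) : ℝ) else 0) *
        (∫ x in M.face e, w e x * pval (v i) x ∂surface d) := fun i => by
    simp only [ite_mul, zero_mul, Finset.sum_ite_mem, Finset.univ_inter]
  simp only [h1]
  rw [Finset.sum_comm]
  refine Finset.sum_congr rfl fun e _ => ?_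
  simp only [← integral_const_mul]
  rw [← integral_finsetSum _ fun i _ => (hw i e).const_mul _]
  congr 1
  funext x
  rw [fluxJump, pval_sum, Finset.mul_sum]
  refine Finset.sum_congr rfl fun i _ => ?_
  split_ifs
  · rw [pval_smul]
    ring
  · simp

/-- A piecewise polynomial `b`-orthogonal to the test space satisfies the homogeneous transport
equation on each element and the homogeneous flux conditions on the faces off the outflow
boundary. -/
theorem primal_homogeneous (hd : 0 < d) (hΩ : Bornology.IsBounded Ω) {k j : ℕ}
    (hj : k - 1 ≤ j) {β : ι → Eucl d} {c : ι → ℝ} {u : CellPoly d ι} (hu : M.IsTrial (k - 1) u)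
    (h : ∀ σ, M.IsTest β j σ → M.bForm k β c u σ = 0) :
    (∀ i, pdir (β i) (u i) + c i • u i = 0) ∧
      ∀ e, ¬ M.face e ⊆ M.outflow β → ∀ x ∈ M.face e, pval (M.fluxJump β u e) x = 0 := by
  classical
  set r : CellPoly d ι := fun i => pdir (β i) (u i) + c i • u i with hr
  -- The residuals themselves serve as the test function. The minus sign makes both contributions to
  -- `b` sums of squares, and `hj` keeps the degrees admissible.
  set σ : WeakFun d ι κ := (-r, fun e => if M.face e ⊆ M.outflow β then 0 else
    (M.face e).indicator (pval (M.fluxJump β u e))) with hσ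
  have hσt : M.IsTest β j σ := by
    refine ⟨fun i => Submodule.neg_mem _ (Poly_mono hj (Submodule.add_mem _
      (pdir_mem_Poly (hu i) _) (Submodule.smul_mem _ _ (hu i)))), fun e => ?_, fun e he => ?_⟩
    · by_cases he : M.face e ⊆ M.outflow β
      · refine ⟨0, Submodule.zero_mem _, ?_⟩
        simp only [hσ, if_pos he]
        funext x
        by_cases hx : x ∈ M.face e <;> simp [hx]
      · exact ⟨_, Poly_mono hj (M.fluxJump_mem_Poly β hu e), by simp only [hσ, if_neg he]⟩
    · simp only [hσ, if_pos he]
  have hb := h σ hσt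
  rw [M.bForm_eq hd hΩ β c hu hσt.isPolyWeakFun, Finset.sum_sub_distrib,
    M.sum_flux_eq β u fun i e => M.integrableOn_face_mul hd hΩ hσt.isPolyWeakFun e
      (continuous_pval _)] at hb
  have hface : ∀ e, ∫ x in M.face e, σ.2 e x * pval (M.fluxJump β u e) x ∂surface d =
      if M.face e ⊆ M.outflow β then 0 else
        ∫ x in M.face e, pval (M.fluxJump β u e) x * pval (M.fluxJump β u e) x ∂surface d := by
    intro e
    by_cases he : M.face e ⊆ M.outflow β
    · simp [hσ, if_pos he]
    · simp only [hσ, if_neg he]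
      exact M.setIntegral_face_indicator e _ fun x a => a * pval (M.fluxJump β u e) x
  have hcell : ∀ i, ∫ x in M.cell i, pval (σ.1 i) x * pval (pdir (β i) (u i) + c i • u i) x =
      - ∫ x in M.cell i, pval (r i) x * pval (r i) x := by
    intro i
    rw [← integral_neg]
    congr 1
    funext x
    have : pval (σ.1 i) x = - pval (r i) x := by simp [hσ, pval]
    rw [this, neg_mul]
  simp only [hface, hcell, Finset.sum_neg_distrib, sub_neg_eq_add] at hb
  have hA : ∀ e, 0 ≤ if M.face e ⊆ M.outflow β then 0 else
      ∫ x in M.face e, pval (M.fluxJump β u e) x * pval (M.fluxJump β u e) x ∂surface d := by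
    intro e
    split_ifs
    · exact le_rfl
    · exact integral_nonneg fun x => mul_self_nonneg _
  have hB : ∀ i, 0 ≤ ∫ x in M.cell i, pval (r i) x * pval (r i) x := fun i =>
    integral_nonneg fun x => mul_self_nonneg _
  obtain ⟨h1, h2⟩ := (add_eq_zero_iff_of_nonneg (Finset.sum_nonneg fun e _ => hA e)
    (Finset.sum_nonneg fun i _ => hB i)).1 hb
  refine ⟨fun i => ?_, fun e he x hx => ?_⟩
  · refine eq_zero_of_pval_eq_zero (M.isOpen_cell i) (M.cell_nonempty i) fun x hx => ?_
    exact mul_self_eq_zero.1 (M.eq_zero_of_integral_cell_eq_zero hΩ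
      ((continuous_pval (r i)).mul (continuous_pval (r i))) (fun x => mul_self_nonneg _)
      ((Finset.sum_eq_zero_iff_of_nonneg fun i _ => hB i).1 h2 i (Finset.mem_univ i)) x hx)
  · have h3 := (Finset.sum_eq_zero_iff_of_nonneg fun e _ => hA e).1 h1 e (Finset.mem_univ e)
    rw [if_neg he] at h3
    exact mul_self_eq_zero.1 (M.eq_zero_of_integral_face_eq_zero hd hΩ
      ((continuous_pval _).mul (continuous_pval _)) (fun x => mul_self_nonneg _) h3 x hx)

/-! ### The primal variable of a homogeneous solution -/

/-- The divergence theorem for `φ p b`: the term in which the derivative falls on `p` becomes `-a φ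
p` by the equation for `p`. -/
theorem integral_cell_transport (hd : 0 < d) (hΩ : Bornology.IsBounded Ω) (i : ι) (b : Eucl d)
    {a : ℝ} {p : MvPolynomial (Fin d) ℝ} (hp : pdir b p + a • p = 0) {φ : Eucl d → ℝ} {K : NNReal}
    (hφ : LipschitzWith K φ) :
    ∫ x in M.cell i, pval p x * (inner ℝ b (gradient φ x) - a * φ x) =
      ∑ e ∈ M.faces i, inner ℝ (M.normal i e) b *
        ∫ x in M.face e, φ x * pval p x ∂surface d := by
  obtain ⟨R, hR0, hR⟩ : ∃ R > 0, closure Ω ⊆ Metric.ball (0 : Eucl d) R :=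
    (hΩ.closure.subset_ball_lt 0 0)
  -- The bump equals 1 near the closure of Ω, so it provides compact support without changing either
  -- side.
  let χ : ContDiffBump (0 : Eucl d) := ⟨R, R + 1, hR0, by linarith⟩
  have hχ : ∀ x ∈ Metric.ball (0 : Eucl d) R, χ x = 1 := fun x hx =>
    χ.one_of_mem_closedBall (Metric.ball_subset_closedBall hx)
  set F : Eucl d → ℝ := fun x => χ x * (φ x * pval p x) with hF
  have hFc : HasCompactSupport F := χ.hasCompactSupport.mul_right
  have hFl : LocallyLipschitz F :=
    locallyLipschitz_mul (χ.contDiff (n := 1)).locallyLipschitz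
      (locallyLipschitz_mul hφ.locallyLipschitz (contDiff_pval p).locallyLipschitz)
  obtain ⟨C, hC⟩ := exists_lipschitzWith_of_hasCompactSupport hFl hFc
  have hdiv := M.divergenceFormula hd hΩ i b hC hFc
  have hloc : ∀ x ∈ closure Ω, F =ᶠ[𝓝 x] fun y => φ y * pval p y := fun x hx => by
    filter_upwards [Metric.isOpen_ball.mem_nhds (hR hx)] with y hy
    simp only [hF, hχ y hy, one_mul]
  have hleft : ∫ x in M.cell i, lineDeriv ℝ F x b =
      ∫ x in M.cell i, pval p x * (inner ℝ b (gradient φ x) - a * φ x) := by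
    refine setIntegral_congr_ae (M.isOpen_cell i).measurableSet ?_
    filter_upwards [hφ.ae_differentiableAt (μ := volume)] with x hx hxi
    have h1 := (hx.hasFDerivAt.mul (hasFDerivAt_pval p x)).hasLineDerivAt b
    have h2 : lineDeriv ℝ F x b = lineDeriv ℝ (fun y => φ y * pval p y) x b :=
      (hloc x (subset_closure (M.cell_subset i hxi))).lineDeriv_eq
    have h3 : inner ℝ b (pvec (pgrad p) x) = - (a * pval p x) := by
      have := congrArg (fun q => pval q x) hp
      simp only [pval_add, pval_smul, pval_zero, pval_pdir] at this
      linarith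
    have h4 : lineDeriv ℝ (fun y => φ y * pval p y) x b =
        φ x * inner ℝ b (pvec (pgrad p) x) + pval p x * inner ℝ b (gradient φ x) := by
      rw [inner_gradient hx, hx.lineDeriv_eq_fderiv]
      refine h1.lineDeriv.trans ?_
      simp [real_inner_comm]
    rw [h2, h4, h3]
    ring
  rw [← hleft, hdiv]
  refine Finset.sum_congr rfl fun e _ => ?_
  congr 1
  refine setIntegral_congr_fun (M.isFlatFace e).measurableSet fun x hx => ?_
  exact (hloc x (M.face_subset_closure e hx)).eq_of_nhds

/-- The piecewise polynomial function with the polynomials `v`. -/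
def glue (v : CellPoly d ι) (x : Eucl d) : ℝ := ∑ i, (M.cell i).indicator (pval (v i)) x

theorem glue_of_mem (v : CellPoly d ι) {i : ι} {x : Eucl d} (hx : x ∈ M.cell i) :
    M.glue v x = pval (v i) x := by
  rw [glue, Finset.sum_eq_single i]
  · exact Set.indicator_of_mem hx _
  · intro j _ hj
    exact Set.indicator_of_notMem
      (fun h => Set.disjoint_left.1 (M.cell_disjoint j i hj) h hx) _
  · simp

theorem memLp_pval_cell (hΩ : Bornology.IsBounded Ω) (i : ι) (p : MvPolynomial (Fin d) ℝ) :
    MemLp (pval p) 2 (volume.restrict (M.cell i)) := by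
  have := isFiniteMeasure_restrict_of_isBounded (M.isBounded_cell hΩ i)
  exact memLp_restrict_of_continuous (M.isOpen_cell i).measurableSet (M.isBounded_cell hΩ i)
    (continuous_pval p) 2

theorem memLp_glue (hΩ : Bornology.IsBounded Ω) (v : CellPoly d ι) :
    MemLp (M.glue v) 2 (volume.restrict Ω) := by
  refine memLp_finsetSum _ fun i _ => ?_
  refine (memLp_indicator_iff_restrict (M.isOpen_cell i).measurableSet).2 ?_
  rw [Measure.restrict_restrict_of_subset (M.cell_subset i)]
  exact M.memLp_pval_cell hΩ i (v i)

theorem integrableOn_of_forall_cell {F : Eucl d → ℝ} (hF : ∀ i, IntegrableOn F (M.cell i)) :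
    IntegrableOn F Ω :=
  (integrableOn_finite_iUnion.2 hF).congr_set_ae M.iUnion_cell_ae_eq.symm

/-- For a Lipschitz test function, summing `integral_cell_transport` over the elements leaves only
face jumps. A general test function is reached through the Lipschitz sequence that defines its
trace. -/
theorem isWeakSolution_glue (hd : 0 < d) (hΩ_open : IsOpen Ω) (hΩ : Bornology.IsBounded Ω)
    {β : ι → Eucl d} {c : ι → ℝ} {u : CellPoly d ι}
    (hcell : ∀ i, pdir (β i) (u i) + c i • u i = 0)
    (hface : ∀ e, ¬ M.face e ⊆ M.outflow β → ∀ x ∈ M.face e, pval (M.fluxJump β u e) x = 0) :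
    IsWeakSolution Ω (M.piecewiseConst β) (M.piecewiseConst c) (M.normalFlux β) (fun _ => 0)
      (fun _ => 0) (M.glue u) := by
  refine ⟨M.memLp_glue hΩ u, fun σ G w hσ hw => ?_⟩
  simp only [zero_mul, integral_zero, sub_zero]
  obtain ⟨φ, hφ, hφσ, hφG, hφw⟩ := hσ.trace
  choose K hK using hφ
  have hφH : ∀ n, IsH1WithTrace Ω (φ n) (gradient (φ n)) (φ n) := fun n =>
    isH1WithTrace_of_lipschitzWith hΩ_open hΩ (M.surface_frontier_lt_top hd hΩ_open hΩ) (hK n)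
  have hle : ∀ i, volume.restrict (M.cell i) ≤ volume.restrict Ω := fun i =>
    Measure.restrict_mono (M.cell_subset i) le_rfl
  have hσi := fun i => hσ.memLp_fun.mono_measure (hle i)
  have hφi := fun n i => (hφH n).memLp_fun.mono_measure (hle i)
  have hGi := fun i => (hσ.memLp_grad.mono_measure (hle i)).const_inner (𝕜 := ℝ) (β i)
  have hgi := fun n i => ((hφH n).memLp_grad.mono_measure (hle i)).const_inner (𝕜 := ℝ) (β i)
  have hui := fun i => M.memLp_pval_cell hΩ i (u i)
  have hsplit : ∀ i {H : Eucl d → Eucl d} {s : Eucl d → ℝ},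
      MemLp (fun x => inner ℝ (β i) (H x)) 2 (volume.restrict (M.cell i)) →
      MemLp s 2 (volume.restrict (M.cell i)) →
      ∫ x in M.cell i, pval (u i) x * (inner ℝ (β i) (H x) - c i * s x) =
        (∫ x in M.cell i, pval (u i) x * inner ℝ (β i) (H x)) -
          c i * ∫ x in M.cell i, pval (u i) x * s x := by
    intro i H s hH hs
    have hi1 : IntegrableOn (fun x => pval (u i) x * inner ℝ (β i) (H x)) (M.cell i) :=
      (hui i).integrable_mul hH
    have hi2 : IntegrableOn (fun x => pval (u i) x * s x) (M.cell i) :=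
      (hui i).integrable_mul hs
    rw [← integral_const_mul, ← integral_sub hi1 (hi2.const_mul _)]
    congr 1
    funext x
    ring
  have hlim : Tendsto (fun n => ∑ i, ∫ x in M.cell i, pval (u i) x *
      (inner ℝ (β i) (gradient (φ n) x) - c i * φ n x)) atTop
      (𝓝 (∑ i, ∫ x in M.cell i, pval (u i) x * (inner ℝ (β i) (G x) - c i * σ x))) := by
    refine tendsto_finsetSum _ fun i _ => ?_
    rw [hsplit i (hGi i) (hσi i)]
    simp only [fun n => hsplit i (hgi n i) (hφi n i)]
    exact (tendsto_integral_mul (hui i) (hGi i) (fun n => hgi n i)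
        (tendsto_eLpNorm_inner (β i) (tendsto_eLpNorm_mono (hle i) hφG))).sub
      ((tendsto_integral_mul (hui i) (hσi i) (fun n => hφi n i)
        (tendsto_eLpNorm_mono (hle i) hφσ)).const_mul _)
  have hzero : Tendsto (fun n => ∑ i, ∫ x in M.cell i, pval (u i) x *
      (inner ℝ (β i) (gradient (φ n) x) - c i * φ n x)) atTop (𝓝 (∑ _e : κ, 0)) := by
    have heq : ∀ n, ∑ i, ∫ x in M.cell i, pval (u i) x *
        (inner ℝ (β i) (gradient (φ n) x) - c i * φ n x) =
        ∑ e, ∫ x in M.face e, φ n x * pval (M.fluxJump β u e) x ∂surface d := fun n => by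
      rw [← M.sum_flux_eq β u (w := fun _ => φ n) fun i e =>
        M.integrableOn_face hd hΩ e ((hK n).continuous.mul (continuous_pval _))]
      exact Finset.sum_congr rfl fun i _ => M.integral_cell_transport hd hΩ i _ (hcell i) (hK n)
    simp only [heq]
    refine tendsto_finsetSum _ fun e _ => ?_
    -- The approximants need not vanish on `Γ₊`, and the jump need not vanish there either. Only the
    -- L² limit `w` of their boundary values is zero, so this term vanishes in the limit; on all
    -- other faces it is zero for each `n`.
    by_cases he : M.face e ⊆ M.outflow β
    · have hle' : (surface d).restrict (M.face e) ≤ (surface d).restrict (frontier Ω) :=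
        Measure.restrict_mono (fun x hx => (he hx).1) le_rfl
      have hw0 : ∀ᵐ x ∂(surface d).restrict (M.face e), w x = 0 :=
        ae_mono (Measure.restrict_mono he le_rfl) hw
      have hJ : MemLp (pval (M.fluxJump β u e)) 2 ((surface d).restrict (M.face e)) := by
        have := M.isFiniteMeasure_face hd hΩ e
        exact memLp_restrict_of_continuous (M.isFlatFace e).measurableSet
          (hΩ.closure.subset (M.face_subset_closure e)) (continuous_pval _) 2
      have h1 := tendsto_integral_mul hJ (hσ.memLp_trace.mono_measure hle')
        (fun n => (hφH n).memLp_trace.mono_measure hle') (tendsto_eLpNorm_mono hle' hφw)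
      have h2 : ∫ x in M.face e, pval (M.fluxJump β u e) x * w x ∂surface d = 0 :=
        integral_eq_zero_of_ae (by
          filter_upwards [hw0] with x hx
          simp [hx])
      rw [h2] at h1
      simpa only [mul_comm] using h1
    · have h1 : ∀ n, ∫ x in M.face e, φ n x * pval (M.fluxJump β u e) x ∂surface d = 0 :=
        fun n => setIntegral_eq_zero_of_forall_eq_zero fun x hx => by
          rw [hface e he x hx, mul_zero]
      simp only [h1]
      exact tendsto_const_nhds
  have hsum : ∑ i, ∫ x in M.cell i, pval (u i) x * (inner ℝ (β i) (G x) - c i * σ x) = 0 := by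
    simpa using tendsto_nhds_unique hlim hzero
  have hcongr : ∀ i, Set.EqOn (fun x => pval (u i) x * (inner ℝ (β i) (G x) - c i * σ x))
      (fun x => M.glue u x * (inner ℝ (M.piecewiseConst β x) (G x) - M.piecewiseConst c x * σ x))
      (M.cell i) := fun i x hx => by
    simp only [M.glue_of_mem u hx, M.piecewiseConst_of_mem β hx, M.piecewiseConst_of_mem c hx]
  rw [M.integral_eq_sum (M.integrableOn_of_forall_cell fun i => ?_), ← hsum]
  · exact Finset.sum_congr rfl fun i _ =>
      (setIntegral_congr_fun (M.isOpen_cell i).measurableSet (hcongr i)).symm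
  · have hint : IntegrableOn (fun x => pval (u i) x * (inner ℝ (β i) (G x) - c i * σ x))
        (M.cell i) := (hui i).integrable_mul ((hGi i).sub ((hσi i).const_mul (c i)))
    exact hint.congr_fun (hcongr i) (M.isOpen_cell i).measurableSet

theorem primal_eq_zero (hd : 0 < d) (hΩ_open : IsOpen Ω) (hΩ : Bornology.IsBounded Ω)
    {β : ι → Eucl d} {c : ι → ℝ}
    (h_transport : TransportUniqueness Ω (M.piecewiseConst β) (M.piecewiseConst c)
      (M.normalFlux β)) {k j : ℕ} (hj : k - 1 ≤ j) {u : CellPoly d ι} (hu : M.IsTrial (k - 1) u)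
    (h : ∀ σ, M.IsTest β j σ → M.bForm k β c u σ = 0) : u = 0 := by
  obtain ⟨hcell, hface⟩ := M.primal_homogeneous hd hΩ hj hu h
  have h0 : IsWeakSolution Ω (M.piecewiseConst β) (M.piecewiseConst c) (M.normalFlux β)
      (fun _ => 0) (fun _ => 0) fun _ => 0 := ⟨MemLp.zero', fun σ G w _ _ => by simp⟩
  have hae := h_transport (fun _ => 0) (fun _ => 0) MemLp.zero' MemLp.zero' _ _
    (M.isWeakSolution_glue hd hΩ_open hΩ hcell hface) h0
  funext i
  refine eq_zero_of_pval_eq_zero (M.isOpen_cell i) (M.cell_nonempty i) ?_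
  refine Measure.eqOn_open_of_ae_eq (μ := volume) ?_ (M.isOpen_cell i)
    (continuous_pval _).continuousOn continuousOn_const
  filter_upwards [ae_restrict_of_ae_restrict_of_subset (M.cell_subset i) hae,
    ae_restrict_mem (M.isOpen_cell i).measurableSet] with x hx hxi
  rw [← M.glue_of_mem u hxi, hx]

end PolytopalMesh

end PDWG

end

/-! ### Unique solvability of the scheme -/

theorem mainTheorem1 (d : ℕ) (hd : d = 2 ∨ d = 3) (Ω : Set (PDWG.Eucl d))
    (hΩ_open : IsOpen Ω) (hΩ_bdd : Bornology.IsBounded Ω) (hΩ_conn : IsConnected Ω)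
    (hΩ_lip : PDWG.HasLipschitzBoundary Ω)
    {ι κ : Type*} [Fintype ι] [Fintype κ] (M : PDWG.PolytopalMesh d Ω ι κ)
    (β : ι → PDWG.Eucl d) (c : ι → ℝ)
    (h_transport : PDWG.TransportUniqueness Ω (M.piecewiseConst β) (M.piecewiseConst c)
      (M.normalFlux β))
    (h_adjoint : PDWG.AdjointUniqueness Ω (M.piecewiseConst β) (M.piecewiseConst c)
      (M.normalFlux β))
    (f g : PDWG.Eucl d → ℝ) (hf : MemLp f 2 (volume.restrict Ω))
    (hg : MemLp g 2 ((PDWG.surface d).restrict (M.inflow β)))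
    (k j : ℕ) (hk : 1 ≤ k) (hj : j = k - 1 ∨ j = k) (τ : ℝ) (hτ : 0 < τ) :
    ∃! p : PDWG.CellPoly d ι × PDWG.WeakFun d ι κ,
      M.IsSchemeSolution k j τ β c f g p.1 p.2 := by
  have hd0 : 0 < d := by omega
  refine M.existsUnique_isSchemeSolution hd0 hΩ_bdd hf hg fun u l hu hl hprimal hdual => ?_
  -- The dual variable is its own test function; the second equation with `v = u` cancels the
  -- coupling term.
  have hs : M.stabilizer β c τ l l = 0 := by
    have h := hprimal l hl
    rwa [hdual u hu, add_zero] at h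
  obtain rfl := M.dual_eq_zero_of_stabilizer_eq_zero hd0 hΩ_open hΩ_bdd hΩ_lip h_adjoint hτ hl hs
  refine ⟨M.primal_eq_zero hd0 hΩ_open hΩ_bdd h_transport (by omega : k - 1 ≤ j) hu
    fun σ hσ => ?_, rfl⟩
  have h := hprimal σ hσ
  rwa [M.stabilizer_comm, M.stabilizer_zero_right, zero_add] at h
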